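/- \textbf{Setting.} Let $\Sigma$ be the brick-wall drawing of the hexagonal lattice: its vertex set is $V=\mathbb Z^2\subset\mathbb R^2$, each vertex is joined to its horizontal neighbours, and $(x,y)$ is joined to $(x,y+1)$ iff $x+y$ is odd. Its faces are the bricks $[x,x+2]\times[y,y+1]$ with $x+y$ odd, each with six vertices; they are coloured $\mathtt r,\mathtt g,\mathtt b$ so that adjacent faces have different colours. Put a qubit at each vertex. For $\Lambda\subseteq V$ let $\mathcal A(\Lambda)$ be the norm closure of the union of the algebras $\bigotimes_{v\in S}M_2(\mathbb C)$ over finite $S\subseteq\Lambda$, and let $\mathcal A=\mathcal A(V)$ be the quasi-local algebra. For a face $f$ let $K_f=\prod_{v\in\partial f}\sigma^{\mathtt x}_v$ and $J_f=\prod_{v\in\partial f}\sigma^{\mathtt z}_v$. Let $\omega_0$ be the translation-invariant ground state of the Hamiltonian $-\sum_f K_f-\sum_f J_f$, i.e. the state on $\mathcal A$ that is invariant under the translations of the lattice and satisfies $-i\,\omega_0(A^\dagger\delta(A))\ge 0$ for every local $A$, where $\delta(A)=-i\sum_f[K_f+J_f,A]$. Let $(\pi_0,\mathcal H,\Omega)$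 be a GNS representation of $\omega_0$. \textbf{Strings.} A half-infinite string $\gamma$ of colour $c$ is a sequence $(f_0,v_0,v_1,f_1,v_2,v_3,f_2,\dots)$ of faces $f_i$ of colour $c$ and pairwise distinct vertices such that, for every $i$, $v_{2i}\in\partial f_i$, $v_{2i+1}\in\partial f_{i+1}$, $f_i\ne f_{i+1}$, and $v_{2i}v_{2i+1}$ is an edge. For $k\in\{\mathtt x,\mathtt z\}$ let $S_n^{k}=\prod_{j<2n}\sigma^k_{v_j}$, and let $S_n^{\mathtt y}=S_n^{\mathtt x}S_n^{\mathtt z}$. Define the endomorphism $\rho^{ck}_\gamma(A)=\lim_n (S_n^{k})^\dagger A\,S_n^{k}$ of $\mathcal A$ (norm limit). \textbf{Cones.} A cone is a translate of $\{x\in\mathbb R^2: x\cdot a>\|x\|\cos\theta\}$ with $a$ a unit vector and $0<\theta<\pi$; for a cone $\Lambda$, $\mathcal A(\Lambda)$ and $\mathcal A(\Lambda^c)$ refer to the vertices inside and outside $\Lambda$. Fix a cone $\Lambda_0$ and let $\mathcal A^{au}$ be the norm closure of $\bigcup_{x\in\mathbb Z^2}\pi_0(\mathcal A(\Lambda_0+x))''$.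 A cone $\Lambda$ is \emph{to the left of} a cone $\Lambda'$ if they are disjoint, both lie in some translate $\Lambda_0+x$ ($x\in\mathbb Z^2$), and, for each such $x$, $\Lambda$ can be rotated counterclockwise around its apex until it meets the complement of $\Lambda_0+x$ without meeting $\Lambda'$ on the way. A representation $\pi$ of $\mathcal A$ on $\mathcal H$ is localized in $\Lambda$ if $\pi=\pi_0$ on $\mathcal A(\Lambda^c)$; an endomorphism $\rho$ is localized in $\Lambda$ if $\pi_0\circ\rho$ is. \textbf{Braiding.} For endomorphisms $\rho,\rho'$ of $\mathcal A$, with $\rho$ localized in a cone $\Lambda$, choose a unitary $U\in\mathcal A^{au}$ such that $U\,\pi_0(\rho'(\cdot))\,U^\dagger$ is localized in a cone to the left of $\Lambda$, and put $\varepsilon_{\rho,\rho'}=U^\dagger\bar\rho(U)$. Here $\bar\rho$ is the $*$-homomorphism $\mathcal A^{au}\to \mathbf B(\mathcal H)$ with $\bar\rho\circ\pi_0=\pi_0\circ\rho$ that is continuous in the weak operator topology on each $\pi_0(\mathcal A(\Lambda_0+x))''$. \textbf{Proposition.} Let $c,c'\in\{\mathtt r,\mathtt g,\mathtt b\}$ and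 $k,k'\in\{\mathtt x,\mathtt y,\mathtt z\}$. Let $\gamma,\gamma'$ be half-infinite strings of colours $c,c'$ whose vertices lie in cones $\Lambda,\Lambda'$, respectively, such that there is a cone to the left of $\Lambda$ and a cone to the left of $\Lambda'$. Then the operators $\varepsilon_{ck,c'k'}:=\varepsilon_{\rho_\gamma^{ck},\rho_{\gamma'}^{c'k'}}$ and $\varepsilon_{c'k',ck}:=\varepsilon_{\rho_{\gamma'}^{c'k'},\rho_{\gamma}^{ck}}$ exist and do not depend on the choices made in their definition, and: \begin{itemize} \item if $c=c'$ or $k=k'$, then $\varepsilon_{ck,c'k'}=\mathbb 1$; \item if $c\ne c'$ and $k\neq k'$, then $\varepsilon_{ck,c'k'}$ and $\varepsilon_{c'k',ck}$ both lie in $\{\mathbb 1,-\mathbb 1\}$, and exactly one of them equals $-\mathbb 1$. \end{itemize} -/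

import Mathlib

open Filter Topology
open scoped ComplexOrder

noncomputable section

namespace ColorCode

/-! ## The coloured trivalent lattice

The brick-wall drawing of the hexagonal lattice: the vertices are the points of `ℤ × ℤ`, every
vertex is joined to its two horizontal neighbours, and `(x, y)` is joined to `(x, y + 1)` exactly
when `x + y` is odd. -/

abbrev Vertex : Type := ℤ × ℤ

/-- The edges of the lattice. -/
def lattice : SimpleGraph Vertex :=
  SimpleGraph.fromRel fun v w =>
    w = (v.1 + 1, v.2) ∨ (Odd (v.1 + v.2) ∧ w = (v.1, v.2 + 1))

/-- The faces are the bricks `[x, x + 2] × [y, y + 1]` with `x + y` odd. -/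
structure Face where
  x : ℤ
  y : ℤ
  odd : Odd (x + y)

/-- The six vertices of a face. -/
def Face.boundary (f : Face) : List Vertex :=
  [(f.x, f.y), (f.x + 1, f.y), (f.x + 2, f.y),
   (f.x, f.y + 1), (f.x + 1, f.y + 1), (f.x + 2, f.y + 1)]

inductive Color
  | r | g | b
  deriving DecidableEq

/-- The colouring of the faces by three colours such that adjacent faces have different colours
(it is unique up to a permutation of the colours). -/
def Face.color (f : Face) : Color :=
  if f.x % 3 = 0 then Color.r else if f.x % 3 = 1 then Color.g else Color.b

/-- The Pauli types `x`, `y`, `z`. -/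
inductive Pauli
  | x | y | z
  deriving DecidableEq

/-! ## The quasi-local algebra

There is a qubit at each vertex.  The quasi-local algebra, the norm completion of the union of
the matrix algebras `⨂_{v ∈ Λ} M₂(ℂ)` over the finite sets `Λ` of vertices, is realised
faithfully on the Hilbert space with the orthonormal basis of all `0`-`1` configurations on the
vertices: it is the norm closed `*`-algebra generated there by the Pauli matrices at the
vertices. -/

abbrev Config : Type := Vertex → ZMod 2

/-- The Hilbert space `ℓ²` of the configurations. -/
abbrev ConfigSpace : Type := lp (fun _ : Config => ℂ) 2

/-- The bounded operator `ψ ↦ (s ↦ w s * ψ (e s))`, for a bijection `e` of the configurations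
and a weight `w` with `|w| ≤ 1`. -/
def monomialOp (e : Config ≃ Config) (w : Config → ℂ) (hw : ∀ s, ‖w s‖ ≤ 1) :
    ConfigSpace →L[ℂ] ConfigSpace :=
  have key : ∀ ψ : ConfigSpace, ∀ s, ‖w s * ψ (e s)‖ ^ (2 : ENNReal).toReal
      ≤ ‖ψ (e s)‖ ^ (2 : ENNReal).toReal := by
    intro ψ s
    refine Real.rpow_le_rpow (norm_nonneg _) ?_ (by norm_num)
    rw [norm_mul]
    exact mul_le_of_le_one_left (norm_nonneg _) (hw s)
  have sum1 : ∀ ψ : ConfigSpace, Summable fun s => ‖ψ (e s)‖ ^ (2 : ENNReal).toReal := by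
    intro ψ
    exact (e.summable_iff (f := fun s => ‖ψ s‖ ^ (2 : ENNReal).toReal)).mpr
      ((lp.memℓp ψ).summable (by norm_num))
  have mem : ∀ ψ : ConfigSpace, Memℓp (fun s => w s * ψ (e s)) 2 := by
    intro ψ
    refine memℓp_gen ((sum1 ψ).of_nonneg_of_le (fun s => ?_) (key ψ))
    positivity
  LinearMap.mkContinuous
    { toFun := fun ψ => (⟨fun s => w s * ψ (e s), mem ψ⟩ : ConfigSpace)
      map_add' := by
        intro φ ψ
        ext s
        exact mul_add (w s) (φ (e s)) (ψ (e s))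
      map_smul' := by
        intro c ψ
        ext s
        exact mul_left_comm (w s) c (ψ (e s)) }
    1 (by
      intro ψ
      rw [one_mul]
      refine lp.norm_le_of_tsum_le (by norm_num) (norm_nonneg _) ?_
      rw [lp.norm_rpow_eq_tsum (by norm_num) ψ,
        ← e.tsum_eq (fun s => ‖ψ s‖ ^ (2 : ENNReal).toReal)]
      refine Summable.tsum_le_tsum (key ψ) ?_ (sum1 ψ)
      exact (sum1 ψ).of_nonneg_of_le (fun s => by positivity) (key ψ))

theorem monomialOp_apply (e : Config ≃ Config) (w : Config → ℂ) (hw : ∀ s, ‖w s‖ ≤ 1)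
    (ψ : ConfigSpace) (s : Config) : monomialOp e w hw ψ s = w s * ψ (e s) := rfl

/-- The Pauli matrix `σˣ` at the vertex `v`: it flips the bit at `v`. -/
def pauliXOp (v : Vertex) : ConfigSpace →L[ℂ] ConfigSpace :=
  monomialOp (Equiv.addRight (Pi.single v 1)) (fun _ => 1) (fun _ => by simp)

/-- The Pauli matrix `σᶻ` at the vertex `v`: the sign of the bit at `v`. -/
def pauliZOp (v : Vertex) : ConfigSpace →L[ℂ] ConfigSpace :=
  monomialOp (Equiv.refl _) (fun s => if s v = 0 then 1 else -1)
    (fun s => by split_ifs <;> simp)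

/-- The translation by `t`, as a unitary operator: `σ_v` is carried to `σ_{v + t}`. -/
def shiftOp (t : Vertex) : ConfigSpace →L[ℂ] ConfigSpace :=
  monomialOp ((Equiv.addRight (-t)).arrowCongr (Equiv.refl (ZMod 2))) (fun _ => 1)
    (fun _ => by simp)

/-- The algebra `𝒜(Λ)` of a set `Λ` of vertices. -/
def regionAlg (Λ : Set Vertex) : StarSubalgebra ℂ (ConfigSpace →L[ℂ] ConfigSpace) :=
  (StarAlgebra.adjoin ℂ
    {T | ∃ v ∈ Λ, T = pauliXOp v ∨ T = pauliZOp v}).topologicalClosure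

/-- The quasi-local algebra `𝒜`. -/
abbrev QuasiLocal : Type := regionAlg Set.univ

/-- The element `a` of `𝒜` is localized in `Λ`, that is, it lies in `𝒜(Λ)`. -/
def LocalizedIn (Λ : Set Vertex) (a : QuasiLocal) : Prop :=
  (a : ConfigSpace →L[ℂ] ConfigSpace) ∈ regionAlg Λ

def pauliX (v : Vertex) : QuasiLocal :=
  ⟨pauliXOp v, StarSubalgebra.le_topologicalClosure _
    (StarAlgebra.subset_adjoin ℂ _ ⟨v, Set.mem_univ v, Or.inl rfl⟩)⟩

def pauliZ (v : Vertex) : QuasiLocal :=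
  ⟨pauliZOp v, StarSubalgebra.le_topologicalClosure _
    (StarAlgebra.subset_adjoin ℂ _ ⟨v, Set.mem_univ v, Or.inr rfl⟩)⟩

/-! ## The ground state -/

/-- The stabilizer `K_f`, the product of the `σˣ` at the six vertices of `f`. -/
def stabK (f : Face) : QuasiLocal := (f.boundary.map pauliX).prod

/-- The stabilizer `J_f`, the product of the `σᶻ` at the six vertices of `f`. -/
def stabJ (f : Face) : QuasiLocal := (f.boundary.map pauliZ).prod

/-- The Hamiltonian of a finite set of faces. -/
def hamiltonian (F : Finset Face) : QuasiLocal := -∑ f ∈ F, stabK f - ∑ f ∈ F, stabJ f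

/-- A ground state: a state `ω` with `-i ω(a† δ(a)) ≥ 0` for all local `a`.  For `a` localized in
the finite set `Λ` the derivation is `δ(a) = i [H, a]`, where `H` may be the Hamiltonian of any
finite set of faces that contains all the faces meeting `Λ`. -/
structure IsGroundState (ω : QuasiLocal →ₗ[ℂ] ℂ) : Prop where
  pos : ∀ a : QuasiLocal, 0 ≤ ω (star a * a)
  unital : ω 1 = 1
  ground : ∀ (Λ : Finset Vertex) (a : QuasiLocal), LocalizedIn (Λ : Set Vertex) a →
    ∀ F : Finset Face, (∀ f : Face, (∃ v ∈ f.boundary, v ∈ Λ) → f ∈ F) →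
      0 ≤ -Complex.I *
        ω (star a * (Complex.I • (hamiltonian F * a - a * hamiltonian F)))

/-- Invariance under the translations of the lattice, the shifts by `t` with `t.1 + t.2` even:
`ω` takes equal values at `a` and at its translate `b`. -/
def IsTranslationInvariant (ω : QuasiLocal →ₗ[ℂ] ℂ) : Prop :=
  ∀ t : Vertex, Even (t.1 + t.2) → ∀ a b : QuasiLocal,
    (b : ConfigSpace →L[ℂ] ConfigSpace) * shiftOp t
      = shiftOp t * (a : ConfigSpace →L[ℂ] ConfigSpace) → ω b = ω a

section Representation

variable {H : Type*} [NormedAddCommGroup H] [InnerProductSpace ℂ H] [CompleteSpace H]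

/-- `(π₀, H, Ω)` is a GNS representation of `ω`. -/
structure IsGNS (ω : QuasiLocal →ₗ[ℂ] ℂ) (π₀ : QuasiLocal →⋆ₐ[ℂ] (H →L[ℂ] H)) (Ω : H) :
    Prop where
  eval : ∀ a, ω a = inner ℂ Ω (π₀ a Ω)
  cyclic : Dense (Set.range fun a => π₀ a Ω)

end Representation

/-! ## String operators and the endomorphisms that they define -/

/-- A half-infinite string `(f₀, v₀, v₁, f₁, v₂, v₃, f₂, …)` of colour `c`: the faces `fᵢ` have
colour `c`, and the edge from `v₂ᵢ` to `v₂ᵢ₊₁` joins the face `fᵢ` to the different face `fᵢ₊₁`.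
No vertex is used twice. -/
structure HalfString (c : Color) where
  face : ℕ → Face
  vert : ℕ → Vertex
  color_face : ∀ i, (face i).color = c
  face_ne : ∀ i, face i ≠ face (i + 1)
  start_mem : ∀ i, vert (2 * i) ∈ (face i).boundary
  end_mem : ∀ i, vert (2 * i + 1) ∈ (face (i + 1)).boundary
  adj : ∀ i, lattice.Adj (vert (2 * i)) (vert (2 * i + 1))
  vert_injective : Function.Injective vert

/-- The string operator of type `ck` of the finite string `(f₀, v₀, v₁, f₁, …, fₙ)` formed by the
first `n` edges of `γ`. -/
def stringOp {c : Color} (γ : HalfString c) (k : Pauli) (n : ℕ) : QuasiLocal :=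
  let Sx : QuasiLocal := ((List.range (2 * n)).map fun j => pauliX (γ.vert j)).prod
  let Sz : QuasiLocal := ((List.range (2 * n)).map fun j => pauliZ (γ.vert j)).prod
  match k with
  | Pauli.x => Sx
  | Pauli.z => Sz
  | Pauli.y => Sx * Sz

/-- The endomorphism `ρ_γ^{ck}(a) = lim_n (S_n)† a S_n` of `𝒜`, a limit in norm. -/
def stringEndo {c : Color} (γ : HalfString c) (k : Pauli) (a : QuasiLocal) : QuasiLocal :=
  limUnder atTop fun n => star (stringOp γ k n) * a * stringOp γ k n

/-! ## Cones -/

/-- A cone in the plane, given by its apex, the angle of its axis and its half-opening angle. -/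
structure Cone where
  apex : ℝ × ℝ
  axis : ℝ
  half : ℝ
  half_pos : 0 < half
  half_lt : half < Real.pi

/-- The points `p` with `(p - apex) · a > ‖p - apex‖ cos θ`, where `a` is the unit vector of the
axis, `θ` the half-opening angle and `‖·‖` the Euclidean norm. -/
def Cone.region (Λ : Cone) : Set (ℝ × ℝ) :=
  {p | Real.sqrt ((p.1 - Λ.apex.1) ^ 2 + (p.2 - Λ.apex.2) ^ 2) * Real.cos Λ.half
    < (p.1 - Λ.apex.1) * Real.cos Λ.axis + (p.2 - Λ.apex.2) * Real.sin Λ.axis}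

/-- The vertices in the cone. -/
def Cone.sites (Λ : Cone) : Set Vertex := {v | ((v.1 : ℝ), (v.2 : ℝ)) ∈ Λ.region}

def Cone.translate (Λ : Cone) (x : ℤ × ℤ) : Cone :=
  { Λ with apex := (Λ.apex.1 + x.1, Λ.apex.2 + x.2) }

/-- The cone turned counterclockwise around its apex by the angle `t`. -/
def Cone.rotate (Λ : Cone) (t : ℝ) : Cone := { Λ with axis := Λ.axis + t }

/-- `Λ` is to the left of `Λ'`, relative to the fixed cone `Λ₀`: the two are disjoint, they lie in
a common translate of `Λ₀`, and `Λ` can be turned counterclockwise around its apex until it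
meets the complement of that translate, without meeting `Λ'` on the way. -/
def LeftOf (Λ₀ Λ Λ' : Cone) : Prop :=
  Disjoint Λ.region Λ'.region ∧
  (∃ x, Λ.region ⊆ (Λ₀.translate x).region ∧ Λ'.region ⊆ (Λ₀.translate x).region) ∧
  ∀ x, Λ.region ⊆ (Λ₀.translate x).region → Λ'.region ⊆ (Λ₀.translate x).region →
    ∃ t, 0 ≤ t ∧ ¬ (Λ.rotate t).region ⊆ (Λ₀.translate x).region ∧
      ∀ s, 0 ≤ s → s ≤ t → Disjoint (Λ.rotate s).region Λ'.region

/-- The string (the set of its vertices) is contained in the cone. -/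
def HalfString.ContainedIn {c : Color} (γ : HalfString c) (Λ : Cone) : Prop :=
  ∀ j, γ.vert j ∈ Λ.sites

/-! ## The braiding -/

section Braiding

variable {H : Type*} [NormedAddCommGroup H] [InnerProductSpace ℂ H] [CompleteSpace H]

/-- The von Neumann algebra `π₀(𝒜(Λ))''`. -/
def coneVN (π₀ : QuasiLocal →⋆ₐ[ℂ] (H →L[ℂ] H)) (Λ : Cone) : StarSubalgebra ℂ (H →L[ℂ] H) :=
  StarSubalgebra.centralizer ℂ
    (StarSubalgebra.centralizer ℂ (π₀ '' {a | LocalizedIn Λ.sites a}) : Set (H →L[ℂ] H))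

/-- The auxiliary algebra: the norm closure of the directed union of the algebras
`π₀(𝒜(Λ₀ + x))''` over `x ∈ ℤ²`. -/
def auxAlg (π₀ : QuasiLocal →⋆ₐ[ℂ] (H →L[ℂ] H)) (Λ₀ : Cone) : StarSubalgebra ℂ (H →L[ℂ] H) :=
  (⨆ x : ℤ × ℤ, coneVN π₀ (Λ₀.translate x)).topologicalClosure

/-- The map `π` from `𝒜` to the bounded operators acts as `π₀` outside the cone `Λ`. -/
def IsLocalized (π₀ : QuasiLocal →⋆ₐ[ℂ] (H →L[ℂ] H)) (π : QuasiLocal → (H →L[ℂ] H))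
    (Λ : Cone) : Prop :=
  ∀ a, LocalizedIn Λ.sitesᶜ a → π a = π₀ a

/-- `ρbar` is the extension of `π₀ ∘ ρ` to the auxiliary algebra: a `*`-homomorphism that is
continuous for the weak operator topology on each `π₀(𝒜(Λ₀ + x))''`. -/
structure IsExtension (π₀ : QuasiLocal →⋆ₐ[ℂ] (H →L[ℂ] H)) (Λ₀ : Cone)
    (ρ : QuasiLocal → QuasiLocal) (ρbar : auxAlg π₀ Λ₀ →⋆ₐ[ℂ] (H →L[ℂ] H)) : Prop where
  extends_endo : ∀ (a : QuasiLocal) (h : π₀ a ∈ auxAlg π₀ Λ₀), ρbar ⟨π₀ a, h⟩ = π₀ (ρ a)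
  weak_continuous : ∀ (x : ℤ × ℤ) (l : Filter (auxAlg π₀ Λ₀)) (T : auxAlg π₀ Λ₀),
    (T : H →L[ℂ] H) ∈ coneVN π₀ (Λ₀.translate x) →
    (∀ᶠ S : auxAlg π₀ Λ₀ in l, (S : H →L[ℂ] H) ∈ coneVN π₀ (Λ₀.translate x)) →
    (∀ ξ η : H, Tendsto (fun S : auxAlg π₀ Λ₀ => inner ℂ ξ ((S : H →L[ℂ] H) η)) l
      (𝓝 (inner ℂ ξ ((T : H →L[ℂ] H) η)))) →
    ∀ ξ η : H, Tendsto (fun S : auxAlg π₀ Λ₀ => inner ℂ ξ (ρbar S η)) l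
      (𝓝 (inner ℂ ξ (ρbar T η)))

/-- `ε` is the braiding `ε_{ρ,ρ'} = U† ρbar(U)`: the endomorphism `ρ` is localized in a cone `Λ`,
the unitary `U` carries `ρ'` to the representation `U ρ'(·) U†`, which is localized in a cone
`Λt` to the left of `Λ`, and `ρbar` is the extension of `ρ` to the auxiliary algebra. -/
def IsBraiding (π₀ : QuasiLocal →⋆ₐ[ℂ] (H →L[ℂ] H)) (Λ₀ : Cone)
    (ρ ρ' : QuasiLocal → QuasiLocal) (ε : H →L[ℂ] H) : Prop :=
  ∃ (Λ Λt : Cone) (U : auxAlg π₀ Λ₀) (ρbar : auxAlg π₀ Λ₀ →⋆ₐ[ℂ] (H →L[ℂ] H)),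
    IsLocalized π₀ (fun a => π₀ (ρ a)) Λ ∧
    LeftOf Λ₀ Λt Λ ∧
    (U : H →L[ℂ] H) ∈ unitary (H →L[ℂ] H) ∧
    IsLocalized π₀ (fun a => (U : H →L[ℂ] H) * π₀ (ρ' a) * star (U : H →L[ℂ] H)) Λt ∧
    IsExtension π₀ Λ₀ ρ ρbar ∧
    ε = star (U : H →L[ℂ] H) * ρbar U

end Braiding

end ColorCode

end

open ColorCode

noncomputable section

namespace ColorCode

set_option linter.unusedSectionVars false

/-! ## Chains and Pauli operators -/

/-- Finite chains of vertices with coefficients modulo two. -/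
abbrev Chain : Type := Vertex →₀ ZMod 2

def sgn (a : ZMod 2) : ℂ := if a = 0 then 1 else -1

@[simp] theorem sgn_zero : sgn 0 = 1 := rfl

@[simp] theorem sgn_one : sgn 1 = -1 := by simp [sgn]

theorem zmod_two_cases (a : ZMod 2) : a = 0 ∨ a = 1 := by
  revert a; decide

theorem zmod_two_add_self (a : ZMod 2) : a + a = 0 := by
  revert a; decide

theorem sgn_add (a b : ZMod 2) : sgn (a + b) = sgn a * sgn b := by
  rcases zmod_two_cases a with rfl | rfl <;> rcases zmod_two_cases b with rfl | rfl <;>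
    simp [zmod_two_add_self]

theorem sgn_mul_self (a : ZMod 2) : sgn a * sgn a = 1 := by
  rw [← sgn_add, zmod_two_add_self, sgn_zero]

@[simp] theorem norm_sgn (a : ZMod 2) : ‖sgn a‖ = 1 := by
  rcases zmod_two_cases a with rfl | rfl <;> simp

@[simp] theorem star_sgn (a : ZMod 2) : star (sgn a) = sgn a := by
  rcases zmod_two_cases a with rfl | rfl <;> simp

theorem add_self_config (τ : Config) : τ + τ = 0 := by
  funext v; exact zmod_two_add_self _

theorem add_self_chain (t : Chain) : t + t = 0 := by
  ext v; exact zmod_two_add_self _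

/-- The pairing of a chain with a configuration. -/
def pair (τ : Config) : Chain →ₗ[ZMod 2] ZMod 2 := Finsupp.linearCombination (ZMod 2) τ

theorem pair_single (τ : Config) (v : Vertex) : pair τ (Finsupp.single v 1) = τ v := by
  simp [pair]

theorem pair_eq_sum (τ : Config) (t : Chain) : pair τ t = t.sum fun v x => x * τ v := rfl

theorem pair_add_left (τ τ' : Config) (t : Chain) : pair (τ + τ') t = pair τ t + pair τ' t := by
  simp [pair_eq_sum, Finsupp.sum, mul_add, Finset.sum_add_distrib]

theorem pair_smul_left (x : ZMod 2) (τ : Config) (t : Chain) :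
    pair (x • τ) t = x * pair τ t := by
  simp [pair_eq_sum, Finsupp.sum, Finset.mul_sum, mul_left_comm]

theorem pair_congr {τ τ' : Config} {t : Chain} (h : ∀ v ∈ t.support, τ v = τ' v) :
    pair τ t = pair τ' t :=
  Finset.sum_congr rfl fun v hv => by simp only; rw [h v hv]

theorem pair_eq_zero {τ : Config} {t : Chain} (h : ∀ v ∈ t.support, τ v = 0) :
    pair τ t = 0 :=
  Finset.sum_eq_zero fun v hv => by simp [h v hv]

theorem pair_comm (t t' : Chain) : pair t t' = pair t' t := by
  induction t using Finsupp.induction_linear with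
  | zero => rw [map_zero]; exact pair_eq_zero (fun _ _ => rfl)
  | add f g hf hg => rw [map_add, Finsupp.coe_add, pair_add_left, hf, hg]
  | single v x =>
    induction t' using Finsupp.induction_linear with
    | zero => rw [map_zero]; symm; exact pair_eq_zero (fun _ _ => rfl)
    | add f g hf hg => rw [map_add, Finsupp.coe_add, pair_add_left, hf, hg]
    | single w y =>
      simp only [pair, Finsupp.linearCombination_single, smul_eq_mul, Finsupp.single_apply]
      by_cases h : v = w
      · subst h; simp [mul_comm]
      · simp [h, Ne.symm h]

/-- The product of the `σˣ` over a set of vertices. -/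
def opX (a : Config) : ConfigSpace →L[ℂ] ConfigSpace :=
  monomialOp (Equiv.addRight a) (fun _ => 1) (fun _ => by simp)

/-- The product of the `σᶻ` over a finite set of vertices. -/
def opZ (b : Chain) : ConfigSpace →L[ℂ] ConfigSpace :=
  monomialOp (Equiv.refl _) (fun s => sgn (pair s b)) (fun _ => by simp)

theorem opX_apply (a : Config) (ψ : ConfigSpace) (s : Config) : opX a ψ s = ψ (s + a) := by
  simp [opX, monomialOp_apply]

theorem opZ_apply (b : Chain) (ψ : ConfigSpace) (s : Config) :
    opZ b ψ s = sgn (pair s b) * ψ s := by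
  simp [opZ, monomialOp_apply]

theorem op_ext {S T : ConfigSpace →L[ℂ] ConfigSpace} (h : ∀ ψ s, S ψ s = T ψ s) : S = T := by
  refine ContinuousLinearMap.ext fun ψ => ?_
  ext s; exact h ψ s

theorem pauliXOp_eq (v : Vertex) : pauliXOp v = opX (Finsupp.single v 1 : Chain) := by
  refine op_ext fun ψ s => ?_
  rw [opX_apply, Finsupp.single_eq_pi_single]
  simp [pauliXOp, monomialOp_apply]

theorem pauliZOp_eq (v : Vertex) : pauliZOp v = opZ (Finsupp.single v 1) := by
  refine op_ext fun ψ s => ?_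
  rw [opZ_apply, pair_single]
  simp [pauliZOp, monomialOp_apply, sgn]

theorem opX_add (a b : Config) : opX (a + b) = opX a * opX b := by
  refine op_ext fun ψ s => ?_
  rw [mul_apply_eq_comp, opX_apply, opX_apply, opX_apply, add_assoc]

theorem opX_zero : opX 0 = 1 := by
  refine op_ext fun ψ s => ?_
  rw [opX_apply, add_zero]; rfl

theorem opZ_add (a b : Chain) : opZ (a + b) = opZ a * opZ b := by
  refine op_ext fun ψ s => ?_
  rw [mul_apply_eq_comp, opZ_apply, opZ_apply, opZ_apply, map_add, sgn_add, mul_assoc]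

theorem opZ_zero : opZ 0 = 1 := by
  refine op_ext fun ψ s => ?_
  rw [opZ_apply, map_zero, sgn_zero, one_mul]; rfl

theorem opZ_mul_opX (a : Config) (b : Chain) :
    opZ b * opX a = sgn (pair a b) • (opX a * opZ b) := by
  refine op_ext fun ψ s => ?_
  rw [mul_apply_eq_comp, opZ_apply, opX_apply]
  change _ = sgn (pair a b) * (opX a (opZ b ψ) s)
  rw [opX_apply, opZ_apply, pair_add_left, sgn_add, ← mul_assoc, mul_left_comm, sgn_mul_self,
    mul_one]

theorem star_opX (a : Config) : star (opX a) = opX a := by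
  rw [ContinuousLinearMap.star_eq_adjoint]
  symm
  rw [ContinuousLinearMap.eq_adjoint_iff]
  intro φ ψ
  rw [lp.inner_eq_tsum, lp.inner_eq_tsum,
    ← (Equiv.addRight a).tsum_eq (fun s => inner ℂ (opX a φ s) (ψ s))]
  refine tsum_congr fun s => ?_
  rw [opX_apply, opX_apply]
  simp [add_assoc, add_self_config]

theorem star_opZ (b : Chain) : star (opZ b) = opZ b := by
  rw [ContinuousLinearMap.star_eq_adjoint]
  symm
  rw [ContinuousLinearMap.eq_adjoint_iff]
  intro φ ψ
  rw [lp.inner_eq_tsum, lp.inner_eq_tsum]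
  refine tsum_congr fun s => ?_
  rw [opZ_apply, opZ_apply, RCLike.inner_apply, RCLike.inner_apply, map_mul]
  have h : (starRingEnd ℂ) (sgn (pair s b)) = sgn (pair s b) := star_sgn _
  rw [h]; ring

/-- The generators of the algebra of a region. -/
def pauliGen (Λ : Set Vertex) : Set (ConfigSpace →L[ℂ] ConfigSpace) :=
  {T | ∃ v ∈ Λ, T = pauliXOp v ∨ T = pauliZOp v}

theorem adjoin_le_regionAlg (Λ : Set Vertex) :
    StarAlgebra.adjoin ℂ (pauliGen Λ) ≤ regionAlg Λ :=
  StarSubalgebra.le_topologicalClosure _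

theorem regionAlg_mono {Λ Λ' : Set Vertex} (h : Λ ⊆ Λ') : regionAlg Λ ≤ regionAlg Λ' :=
  StarSubalgebra.topologicalClosure_mono
    (StarAlgebra.adjoin_mono fun _ ⟨v, hv, hT⟩ => ⟨v, h hv, hT⟩)

theorem opX_mem_adjoin {Λ : Set Vertex} (t : Chain) (h : ∀ v ∈ t.support, v ∈ Λ) :
    opX t ∈ StarAlgebra.adjoin ℂ (pauliGen Λ) := by
  induction t using Finsupp.induction with
  | zero => rw [Finsupp.coe_zero, opX_zero]; exact one_mem _
  | single_add v x t hv hx ih =>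
    obtain rfl : x = 1 := (zmod_two_cases x).resolve_left hx
    have hs := Finsupp.support_single_add hv hx
    rw [hs] at h
    rw [Finsupp.coe_add, opX_add, ← pauliXOp_eq]
    exact mul_mem (StarAlgebra.subset_adjoin ℂ _ ⟨v, h v (by simp), Or.inl rfl⟩)
      (ih fun w hw => h w (by simp [hw]))

theorem opZ_mem_adjoin {Λ : Set Vertex} (t : Chain) (h : ∀ v ∈ t.support, v ∈ Λ) :
    opZ t ∈ StarAlgebra.adjoin ℂ (pauliGen Λ) := by
  induction t using Finsupp.induction with
  | zero => rw [opZ_zero]; exact one_mem _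
  | single_add v x t hv hx ih =>
    obtain rfl : x = 1 := (zmod_two_cases x).resolve_left hx
    have hs := Finsupp.support_single_add hv hx
    rw [hs] at h
    rw [opZ_add, ← pauliZOp_eq]
    exact mul_mem (StarAlgebra.subset_adjoin ℂ _ ⟨v, h v (by simp), Or.inr rfl⟩)
      (ih fun w hw => h w (by simp [hw]))

def X (t : Chain) : QuasiLocal :=
  ⟨opX t, adjoin_le_regionAlg _ (opX_mem_adjoin t fun _ _ => Set.mem_univ _)⟩

def Z (t : Chain) : QuasiLocal :=
  ⟨opZ t, adjoin_le_regionAlg _ (opZ_mem_adjoin t fun _ _ => Set.mem_univ _)⟩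

theorem X_localized {Λ : Set Vertex} (t : Chain) (h : ∀ v ∈ t.support, v ∈ Λ) :
    LocalizedIn Λ (X t) := adjoin_le_regionAlg _ (opX_mem_adjoin t h)

theorem Z_localized {Λ : Set Vertex} (t : Chain) (h : ∀ v ∈ t.support, v ∈ Λ) :
    LocalizedIn Λ (Z t) := adjoin_le_regionAlg _ (opZ_mem_adjoin t h)

theorem pauliX_eq (v : Vertex) : pauliX v = X (Finsupp.single v 1) :=
  Subtype.ext (pauliXOp_eq v)

theorem pauliZ_eq (v : Vertex) : pauliZ v = Z (Finsupp.single v 1) :=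
  Subtype.ext (pauliZOp_eq v)

theorem X_zero : X 0 = 1 := Subtype.ext opX_zero
theorem Z_zero : Z 0 = 1 := Subtype.ext opZ_zero
theorem X_add (a b : Chain) : X (a + b) = X a * X b := Subtype.ext (opX_add a b)
theorem Z_add (a b : Chain) : Z (a + b) = Z a * Z b := Subtype.ext (opZ_add a b)
theorem Z_mul_X (a b : Chain) : Z b * X a = sgn (pair a b) • (X a * Z b) :=
  Subtype.ext (opZ_mul_opX a b)
theorem star_X (a : Chain) : star (X a) = X a := Subtype.ext (star_opX a)
theorem star_Z (a : Chain) : star (Z a) = Z a := Subtype.ext (star_opZ a)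

theorem X_mul_self (a : Chain) : X a * X a = 1 := by
  rw [← X_add, add_self_chain, X_zero]

theorem Z_mul_self (a : Chain) : Z a * Z a = 1 := by
  rw [← Z_add, add_self_chain, Z_zero]

theorem X_comm (a b : Chain) : X a * X b = X b * X a := by
  rw [← X_add, add_comm, X_add]

theorem Z_comm (a b : Chain) : Z a * Z b = Z b * Z a := by
  rw [← Z_add, add_comm, Z_add]

theorem X_mul_Z (a b : Chain) : X a * Z b = sgn (pair a b) • (Z b * X a) := by
  rw [Z_mul_X, smul_smul, sgn_mul_self, one_smul]

/-! ## The string operators of the three types -/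

def Pauli.cx : Pauli → ZMod 2
  | .x => 1
  | .y => 1
  | .z => 0

def Pauli.cz : Pauli → ZMod 2
  | .x => 0
  | .y => 1
  | .z => 1

/-- The exponent of the commutation sign of two Pauli types. -/
def kap (k k' : Pauli) : ZMod 2 := k'.cx * k.cz + k.cx * k'.cz

theorem kap_self (k : Pauli) : kap k k = 0 := by
  cases k <;> decide

theorem kap_of_ne {k k' : Pauli} (h : k ≠ k') : kap k k' = 1 := by
  cases k <;> cases k' <;> first | decide | exact absurd rfl h

theorem kap_comm (k k' : Pauli) : kap k k' = kap k' k := by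
  cases k <;> cases k' <;> decide

/-- The product over the chain `t` of the Pauli matrices of type `k`. -/
def E (k : Pauli) (t : Chain) : QuasiLocal := X (k.cx • t) * Z (k.cz • t)

theorem E_zero (k : Pauli) : E k 0 = 1 := by
  simp [E, X_zero, Z_zero]

theorem E_add (k : Pauli) (t t' : Chain) :
    E k (t + t') = sgn (k.cx * k.cz * pair t t') • (E k t * E k t') := by
  have h : Z (k.cz • t) * X (k.cx • t') =
      sgn (k.cx * k.cz * pair t t') • (X (k.cx • t') * Z (k.cz • t)) := by
    rw [Z_mul_X, Finsupp.coe_smul, pair_smul_left, map_smul, pair_comm, smul_eq_mul, ← mul_assoc]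
  calc E k (t + t') = X (k.cx • t) * (X (k.cx • t') * Z (k.cz • t)) * Z (k.cz • t') := by
        rw [E, smul_add, smul_add, X_add, Z_add]; simp only [mul_assoc]
    _ = _ := by
        have : X (k.cx • t') * Z (k.cz • t) =
            sgn (k.cx * k.cz * pair t t') • (Z (k.cz • t) * X (k.cx • t')) := by
          rw [h, smul_smul, sgn_mul_self, one_smul]
        rw [this, mul_smul_comm, smul_mul_assoc]
        simp only [E, mul_assoc]

theorem E_comm (k k' : Pauli) (t t' : Chain) :
    E k t * E k' t' = sgn (kap k k' * pair t t') • (E k' t' * E k t) := by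
  have h1 : Z (k.cz • t) * X (k'.cx • t') =
      sgn (k'.cx * k.cz * pair t t') • (X (k'.cx • t') * Z (k.cz • t)) := by
    rw [Z_mul_X, Finsupp.coe_smul, pair_smul_left, map_smul, pair_comm, smul_eq_mul, ← mul_assoc]
  have h2 : X (k.cx • t) * Z (k'.cz • t') =
      sgn (k.cx * k'.cz * pair t t') • (Z (k'.cz • t') * X (k.cx • t)) := by
    rw [X_mul_Z, Finsupp.coe_smul, pair_smul_left, map_smul, smul_eq_mul, ← mul_assoc]
  calc E k t * E k' t'
      = X (k.cx • t) * (Z (k.cz • t) * X (k'.cx • t')) * Z (k'.cz • t') := by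
        simp only [E, mul_assoc]
    _ = sgn (k'.cx * k.cz * pair t t') •
          ((X (k.cx • t) * X (k'.cx • t')) * (Z (k.cz • t) * Z (k'.cz • t'))) := by
        rw [h1, mul_smul_comm, smul_mul_assoc]; simp only [mul_assoc]
    _ = sgn (k'.cx * k.cz * pair t t') •
          (X (k'.cx • t') * (X (k.cx • t) * Z (k'.cz • t')) * Z (k.cz • t)) := by
        rw [X_comm, Z_comm]; simp only [mul_assoc]
    _ = _ := by
        rw [h2, mul_smul_comm, smul_mul_assoc, smul_smul, ← sgn_add, ← add_mul]
        simp only [E, kap, mul_assoc]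

theorem E_mul_self (k : Pauli) (t : Chain) :
    E k t * E k t = sgn (k.cx * k.cz * pair t t) • 1 := by
  have h := E_add k t t
  rw [add_self_chain, E_zero] at h
  rw [h, smul_smul, sgn_mul_self, one_smul]

theorem star_E (k : Pauli) (t : Chain) :
    star (E k t) = sgn (k.cx * k.cz * pair t t) • E k t := by
  have : star (E k t) * E k t = 1 := by
    rw [E, star_mul, star_X, star_Z]
    calc Z (k.cz • t) * X (k.cx • t) * (X (k.cx • t) * Z (k.cz • t))
        = Z (k.cz • t) * (X (k.cx • t) * X (k.cx • t)) * Z (k.cz • t) := by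
          simp only [mul_assoc]
      _ = 1 := by rw [X_mul_self, mul_one, Z_mul_self]
  calc star (E k t) = star (E k t) * (E k t * (sgn (k.cx * k.cz * pair t t) • E k t)) := by
        rw [mul_smul_comm, E_mul_self, smul_smul, sgn_mul_self, one_smul, mul_one]
    _ = _ := by rw [← mul_assoc, this, one_mul]

theorem star_E_mul (k : Pauli) (t : Chain) : star (E k t) * E k t = 1 := by
  rw [star_E, smul_mul_assoc, E_mul_self, smul_smul, sgn_mul_self, one_smul]

theorem E_mul_star (k : Pauli) (t : Chain) : E k t * star (E k t) = 1 := by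
  rw [star_E, mul_smul_comm, E_mul_self, smul_smul, sgn_mul_self, one_smul]

theorem E_localized {Λ : Set Vertex} (k : Pauli) (t : Chain) (h : ∀ v ∈ t.support, v ∈ Λ) :
    LocalizedIn Λ (E k t) :=
  mul_mem (X_localized _ fun v hv => h v (Finsupp.support_smul hv))
    (Z_localized _ fun v hv => h v (Finsupp.support_smul hv))

theorem pauliX_eq_E (v : Vertex) : pauliX v = E .x (Finsupp.single v 1) := by
  rw [pauliX_eq]; simp [E, Pauli.cx, Pauli.cz, Z_zero]

theorem pauliZ_eq_E (v : Vertex) : pauliZ v = E .z (Finsupp.single v 1) := by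
  rw [pauliZ_eq]; simp [E, Pauli.cx, Pauli.cz, X_zero]

theorem E_x (t : Chain) : E .x t = X t := by simp [E, Pauli.cx, Pauli.cz, Z_zero]
theorem E_z (t : Chain) : E .z t = Z t := by simp [E, Pauli.cx, Pauli.cz, X_zero]

/-- The chain of the first `n` edges of a string. -/
def HalfString.chain {c : Color} (γ : HalfString c) (n : ℕ) : Chain :=
  ((List.range (2 * n)).map fun j => Finsupp.single (γ.vert j) (1 : ZMod 2)).sum

theorem prod_map_X {ι : Type*} (l : List ι) (f : ι → Chain) :
    (l.map fun j => X (f j)).prod = X (l.map f).sum := by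
  induction l with
  | nil => simp [X_zero]
  | cons a l ih => simp [ih, X_add]

theorem prod_map_Z {ι : Type*} (l : List ι) (f : ι → Chain) :
    (l.map fun j => Z (f j)).prod = Z (l.map f).sum := by
  induction l with
  | nil => simp [Z_zero]
  | cons a l ih => simp [ih, Z_add]

theorem stringOp_eq {c : Color} (γ : HalfString c) (k : Pauli) (n : ℕ) :
    stringOp γ k n = E k (γ.chain n) := by
  have hx : ((List.range (2 * n)).map fun j => pauliX (γ.vert j)).prod = X (γ.chain n) := by
    simp only [pauliX_eq]; exact prod_map_X _ _
  have hz : ((List.range (2 * n)).map fun j => pauliZ (γ.vert j)).prod = Z (γ.chain n) := by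
    simp only [pauliZ_eq]; exact prod_map_Z _ _
  cases k <;> simp [stringOp, hx, hz, E, Pauli.cx, Pauli.cz, X_zero, Z_zero]

/-! ## Locality -/

theorem isClosed_regionAlg (Λ : Set Vertex) :
    IsClosed (regionAlg Λ : Set (ConfigSpace →L[ℂ] ConfigSpace)) :=
  StarSubalgebra.isClosed_topologicalClosure _

theorem E_comm_of_disjoint {Λ : Set Vertex} (k : Pauli) (t : Chain) (h : ∀ v ∈ t.support, v ∉ Λ)
    (a : QuasiLocal) (ha : LocalizedIn Λ a) : E k t * a = a * E k t := by
  have hgen : pauliGen Λ ⊆ (StarSubalgebra.centralizer ℂ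
      ({(E k t : ConfigSpace →L[ℂ] ConfigSpace)} : Set _) : Set _) := by
    have hcomm : ∀ v ∈ Λ, ∀ k', E k t * E k' (Finsupp.single v 1)
        = E k' (Finsupp.single v 1) * E k t := by
      intro v hv k'
      have h0 : t v = 0 := by
        by_contra hne
        exact h v (Finsupp.mem_support_iff.mpr hne) hv
      rw [E_comm, pair_single, h0, mul_zero, sgn_zero, one_smul]
    have hstar : star (E k t : ConfigSpace →L[ℂ] ConfigSpace)
        = sgn (k.cx * k.cz * pair t t) • (E k t : ConfigSpace →L[ℂ] ConfigSpace) :=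
      congrArg Subtype.val (star_E k t)
    rintro T ⟨v, hv, rfl | rfl⟩
    · rw [SetLike.mem_coe, StarSubalgebra.mem_centralizer_iff]
      have h1 : (E k t : ConfigSpace →L[ℂ] ConfigSpace) * pauliXOp v = pauliXOp v * E k t := by
        have := congrArg Subtype.val (hcomm v hv .x)
        rw [← pauliX_eq_E] at this; exact this
      rintro g rfl
      exact ⟨h1, by rw [hstar, smul_mul_assoc, mul_smul_comm, h1]⟩
    · rw [SetLike.mem_coe, StarSubalgebra.mem_centralizer_iff]
      have h1 : (E k t : ConfigSpace →L[ℂ] ConfigSpace) * pauliZOp v = pauliZOp v * E k t := by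
        have := congrArg Subtype.val (hcomm v hv .z)
        rw [← pauliZ_eq_E] at this; exact this
      rintro g rfl
      exact ⟨h1, by rw [hstar, smul_mul_assoc, mul_smul_comm, h1]⟩
  have hle : regionAlg Λ ≤ StarSubalgebra.centralizer ℂ
      ({(E k t : ConfigSpace →L[ℂ] ConfigSpace)} : Set _) := by
    refine StarSubalgebra.topologicalClosure_minimal (StarAlgebra.adjoin_le hgen) ?_
    rw [StarSubalgebra.coe_centralizer]
    exact Set.isClosed_centralizer _
  have := (StarSubalgebra.mem_centralizer_iff ℂ).mp (hle ha) _ rfl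
  exact Subtype.ext this.1

/-- Conjugation by a string operator. -/
def conjE (k : Pauli) (t : Chain) (a : QuasiLocal) : QuasiLocal := star (E k t) * a * E k t

theorem conjE_sub (k : Pauli) (t : Chain) (a b : QuasiLocal) :
    conjE k t (a - b) = conjE k t a - conjE k t b := by
  simp [conjE, mul_sub, sub_mul]

theorem norm_conjE_le (k : Pauli) (t : Chain) (a : QuasiLocal) : ‖conjE k t a‖ ≤ ‖a‖ := by
  have hu : E k t ∈ unitary QuasiLocal := ⟨star_E_mul k t, E_mul_star k t⟩
  have := CStarRing.norm_mem_unitary_mul a (Unitary.star_mem hu)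
  rw [conjE, CStarRing.norm_mul_mem_unitary _ hu, this]

theorem conjE_congr {Λ : Set Vertex} (k : Pauli) {t t' : Chain} (h : ∀ v ∈ Λ, t v = t' v)
    {a : QuasiLocal} (ha : LocalizedIn Λ a) : conjE k t a = conjE k t' a := by
  have hs : ∀ v ∈ (t + t').support, v ∉ Λ := by
    intro v hv hΛ
    rw [Finsupp.mem_support_iff, Finsupp.add_apply, h v hΛ, zmod_two_add_self] at hv
    exact hv rfl
  have hc := E_comm_of_disjoint k (t + t') hs a ha
  have ht : E k t = sgn (k.cx * k.cz * pair ((t + t' : Chain)) t') • (E k (t + t') * E k t') := by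
    rw [← E_add, add_assoc, add_self_chain, add_zero]
  have e : conjE k t a = star (E k t') * (star (E k (t + t')) * (a * E k (t + t'))) * E k t' := by
    rw [conjE, ht, star_smul, star_sgn, star_mul, smul_mul_assoc, smul_mul_assoc, mul_smul_comm,
      smul_smul, sgn_mul_self, one_smul]
    simp only [mul_assoc]
  rw [e, ← hc, ← mul_assoc (star (E k (t + t'))), star_E_mul, one_mul, conjE]

/-- The elements localized in finite sets are dense. -/
theorem exists_local_near (a : QuasiLocal) {ε : ℝ} (hε : 0 < ε) :
    ∃ (F : Finset Vertex) (b : QuasiLocal), LocalizedIn (F : Set Vertex) b ∧ ‖a - b‖ < ε := by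
  have hfin : ∀ T ∈ StarAlgebra.adjoin ℂ (pauliGen Set.univ),
      ∃ F : Finset Vertex, T ∈ regionAlg (F : Set Vertex) := by
    intro T hT
    refine StarAlgebra.adjoin_induction (R := ℂ)
      (p := fun T _ => ∃ F : Finset Vertex, T ∈ regionAlg (F : Set Vertex)) ?_ ?_ ?_ ?_ ?_ hT
    · rintro T ⟨v, -, h⟩
      exact ⟨{v}, adjoin_le_regionAlg _ (StarAlgebra.subset_adjoin ℂ _ ⟨v, by simp, h⟩)⟩
    · exact fun r => ⟨∅, algebraMap_mem _ r⟩
    · rintro x y - - ⟨F, hF⟩ ⟨G, hG⟩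
      exact ⟨F ∪ G, add_mem (regionAlg_mono (by simp) hF) (regionAlg_mono (by simp) hG)⟩
    · rintro x y - - ⟨F, hF⟩ ⟨G, hG⟩
      exact ⟨F ∪ G, mul_mem (regionAlg_mono (by simp) hF) (regionAlg_mono (by simp) hG)⟩
    · rintro x - ⟨F, hF⟩
      exact ⟨F, star_mem hF⟩
  have ha : (a : ConfigSpace →L[ℂ] ConfigSpace) ∈
      closure (StarAlgebra.adjoin ℂ (pauliGen Set.univ) : Set _) := a.2
  obtain ⟨T, hT, hd⟩ := Metric.mem_closure_iff.mp ha ε hε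
  obtain ⟨F, hF⟩ := hfin T hT
  refine ⟨F, ⟨T, regionAlg_mono (Set.subset_univ _) hF⟩, hF, ?_⟩
  rw [dist_eq_norm] at hd
  exact hd

/-- The sequence of chains is eventually constant at every vertex, with the given limit. -/
def LocTendsto {ι : Type*} (t : ι → Chain) (l : Filter ι) (τ : Config) : Prop :=
  ∀ v, ∀ᶠ i in l, t i v = τ v

theorem LocTendsto.finset {ι : Type*} {t : ι → Chain} {l : Filter ι} {τ : Config}
    (h : LocTendsto t l τ) (F : Finset Vertex) : ∀ᶠ i in l, ∀ v ∈ F, t i v = τ v :=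
  (Filter.eventually_all_finset F).mpr fun v _ => h v

theorem LocTendsto.add {ι : Type*} {t t' : ι → Chain} {l : Filter ι} {τ τ' : Config}
    (h : LocTendsto t l τ) (h' : LocTendsto t' l τ') :
    LocTendsto (fun i => t i + t' i) l (τ + τ') := by
  intro v
  filter_upwards [h v, h' v] with i h1 h2
  simp [h1, h2]

/-- The restriction of a configuration to a finite set. -/
def restrict (τ : Config) (F : Finset Vertex) : Chain :=
  Finsupp.onFinset F (fun v => if v ∈ F then τ v else 0)
    (by intro v; by_cases h : v ∈ F <;> simp [h])

theorem restrict_apply (τ : Config) {F : Finset Vertex} {v : Vertex} (h : v ∈ F) :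
    restrict τ F v = τ v := by simp [restrict, h]

/-- The automorphism of the quasi-local algebra given by conjugation with the formal product of
the Pauli matrices of type `k` over a possibly infinite set of vertices. -/
def autE (k : Pauli) (τ : Config) (a : QuasiLocal) : QuasiLocal :=
  limUnder atTop fun F => conjE k (restrict τ F) a

theorem conjE_near (k : Pauli) (τ : Config) (a : QuasiLocal) {ε : ℝ} (hε : 0 < ε) :
    ∃ F : Finset Vertex, ∀ t t' : Chain, (∀ v ∈ F, t v = τ v) → (∀ v ∈ F, t' v = τ v) →
      dist (conjE k t a) (conjE k t' a) < ε := by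
  obtain ⟨F, b, hb, hab⟩ := exists_local_near a (half_pos hε)
  refine ⟨F, fun t t' h h' => ?_⟩
  have e : conjE k t b = conjE k t' b :=
    conjE_congr k (Λ := (F : Set Vertex)) (fun v hv => (h v hv).trans (h' v hv).symm) hb
  have e2 : conjE k t a - conjE k t' a = conjE k t (a - b) - conjE k t' (a - b) := by
    rw [conjE_sub, conjE_sub, e]; abel
  rw [dist_eq_norm, e2]
  calc _ ≤ ‖conjE k t (a - b)‖ + ‖conjE k t' (a - b)‖ := norm_sub_le _ _
    _ ≤ ‖a - b‖ + ‖a - b‖ := add_le_add (norm_conjE_le _ _ _) (norm_conjE_le _ _ _)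
    _ < ε := by linarith

theorem completeSpace_quasiLocal : CompleteSpace QuasiLocal :=
  (isClosed_regionAlg Set.univ).completeSpace_coe

theorem tendsto_autE_restrict (k : Pauli) (τ : Config) (a : QuasiLocal) :
    Tendsto (fun F => conjE k (restrict τ F) a) atTop (𝓝 (autE k τ a)) := by
  have := completeSpace_quasiLocal
  refine CauchySeq.tendsto_limUnder ?_
  rw [Metric.cauchySeq_iff]
  intro ε hε
  obtain ⟨F, hF⟩ := conjE_near k τ a hε
  exact ⟨F, fun m hm n hn => hF _ _ (fun v hv => restrict_apply τ (hm hv))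
    (fun v hv => restrict_apply τ (hn hv))⟩

theorem tendsto_autE {ι : Type*} {l : Filter ι} {t : ι → Chain} {τ : Config}
    (h : LocTendsto t l τ) (k : Pauli) (a : QuasiLocal) :
    Tendsto (fun i => conjE k (t i) a) l (𝓝 (autE k τ a)) := by
  rw [Metric.tendsto_nhds]
  intro ε hε
  obtain ⟨F, hF⟩ := conjE_near k τ a (half_pos hε)
  have h1 := (tendsto_autE_restrict k τ a).eventually (Metric.ball_mem_nhds _ (half_pos hε))
  obtain ⟨G, hG, hFG⟩ := (h1.and (Filter.eventually_ge_atTop F)).exists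
  filter_upwards [h.finset F] with i hi
  calc dist (conjE k (t i) a) (autE k τ a)
      ≤ dist (conjE k (t i) a) (conjE k (restrict τ G) a)
        + dist (conjE k (restrict τ G) a) (autE k τ a) := dist_triangle _ _ _
    _ < ε / 2 + ε / 2 := add_lt_add
        (hF _ _ hi fun v hv => restrict_apply τ (hFG hv)) hG
    _ = ε := add_halves ε

theorem autE_congr {Λ : Set Vertex} (k : Pauli) {τ τ' : Config} (h : ∀ v ∈ Λ, τ v = τ' v)
    {a : QuasiLocal} (ha : LocalizedIn Λ a) : autE k τ a = autE k τ' a := by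
  refine tendsto_nhds_unique (tendsto_autE_restrict k τ a) ?_
  refine (tendsto_autE_restrict k τ' a).congr fun F => ?_
  refine conjE_congr k (fun v hv => ?_) ha
  by_cases hF : v ∈ F <;> simp [restrict, hF, h v hv]

theorem autE_zero (k : Pauli) (a : QuasiLocal) : autE k 0 a = a := by
  have h : LocTendsto (fun _ : ℕ => (0 : Chain)) atTop 0 := fun v => by simp
  refine tendsto_nhds_unique (tendsto_autE h k a) ?_
  simp [conjE, E_zero]

theorem autE_of_disjoint {Λ : Set Vertex} (k : Pauli) {τ : Config} (h : ∀ v ∈ Λ, τ v = 0)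
    {a : QuasiLocal} (ha : LocalizedIn Λ a) : autE k τ a = a := by
  rw [autE_congr k (τ' := 0) h ha, autE_zero]

theorem conjE_E (k k' : Pauli) (t s : Chain) :
    conjE k t (E k' s) = sgn (kap k k' * pair t s) • E k' s := by
  rw [conjE, mul_assoc, E_comm k' k, mul_smul_comm, ← mul_assoc, kap_comm, pair_comm s t,
    show star (E k t) * E k t = 1 from star_E_mul k t, one_mul]

theorem autE_E (k k' : Pauli) (τ : Config) (s : Chain) :
    autE k τ (E k' s) = sgn (kap k k' * pair τ s) • E k' s := by
  refine tendsto_nhds_unique (tendsto_autE_restrict k τ _) ?_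
  refine tendsto_const_nhds.congr' ?_
  filter_upwards [Filter.eventually_ge_atTop s.support] with F hF
  rw [conjE_E, pair_congr (τ := restrict τ F) (τ' := τ) fun v hv => restrict_apply τ (hF hv)]

/-! ## Combinatorics of the lattice -/

@[ext] theorem Face.ext' {f g : Face} (hx : f.x = g.x) (hy : f.y = g.y) : f = g := by
  cases f; cases g; simp_all

theorem mem_boundary {v : Vertex} {f : Face} :
    v ∈ f.boundary ↔ f.x ≤ v.1 ∧ v.1 ≤ f.x + 2 ∧ f.y ≤ v.2 ∧ v.2 ≤ f.y + 1 := by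
  obtain ⟨a, b⟩ := v
  simp only [Face.boundary, List.mem_cons, Prod.mk.injEq, List.not_mem_nil, or_false]
  omega

theorem Face.odd_mod (f : Face) : (f.x + f.y) % 2 = 1 := Int.odd_iff.mp f.odd

theorem color_eq_iff {f g : Face} : f.color = g.color ↔ f.x % 3 = g.x % 3 := by
  unfold Face.color
  constructor
  · intro h
    split_ifs at h <;> omega
  · intro h
    rw [h]

theorem adj_iff {v w : Vertex} : lattice.Adj v w ↔
    (w.1 = v.1 + 1 ∧ w.2 = v.2) ∨ (v.1 = w.1 + 1 ∧ v.2 = w.2) ∨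
    ((v.1 + v.2) % 2 = 1 ∧ w.1 = v.1 ∧ w.2 = v.2 + 1) ∨
    ((w.1 + w.2) % 2 = 1 ∧ v.1 = w.1 ∧ v.2 = w.2 + 1) := by
  obtain ⟨a, b⟩ := v
  obtain ⟨c, d⟩ := w
  simp only [lattice, SimpleGraph.fromRel_adj, Int.odd_iff, Prod.mk.injEq, ne_eq]
  omega

theorem face_unique {v : Vertex} {f g : Face} (hf : v ∈ f.boundary) (hg : v ∈ g.boundary)
    (h : f.color = g.color) : f = g := by
  rw [color_eq_iff] at h
  rw [mem_boundary] at hf hg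
  have := f.odd_mod
  have := g.odd_mod
  have hx : f.x = g.x := by omega
  exact Face.ext' hx (by omega)

/-- The edge from `v` to `w` joins two different faces of the colour `c`. -/
structure CEdge (f g : Face) (v w : Vertex) : Prop where
  color : f.color = g.color
  ne : f ≠ g
  left : v ∈ f.boundary
  right : w ∈ g.boundary
  adj : lattice.Adj v w

theorem CEdge.symm {f g : Face} {v w : Vertex} (h : CEdge f g v w) : CEdge g f w v :=
  ⟨h.color.symm, h.ne.symm, h.right, h.left, h.adj.symm⟩

/-- The six possible positions of an edge that leaves the face `f`. -/
theorem CEdge.cases {f g : Face} {v w : Vertex} (h : CEdge f g v w) :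
    ((v.1 = f.x ∧ w.1 = f.x - 1 ∧ w.2 = v.2 ∧ g.x = f.x - 3) ∧
      (v.2 = f.y ∧ g.y = f.y - 1 ∨ v.2 = f.y + 1 ∧ g.y = f.y + 1)) ∨
    ((v.1 = f.x + 2 ∧ w.1 = f.x + 3 ∧ w.2 = v.2 ∧ g.x = f.x + 3) ∧
      (v.2 = f.y ∧ g.y = f.y - 1 ∨ v.2 = f.y + 1 ∧ g.y = f.y + 1)) ∨
    ((v.1 = f.x + 1 ∧ w.1 = f.x + 1 ∧ g.x = f.x) ∧
      (v.2 = f.y ∧ w.2 = f.y - 1 ∧ g.y = f.y - 2 ∨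
        v.2 = f.y + 1 ∧ w.2 = f.y + 2 ∧ g.y = f.y + 2)) := by
  have hw : w ∉ f.boundary := fun hw => h.ne (face_unique hw h.right h.color)
  obtain ⟨hc, -, hl, hr, ha⟩ := h
  rw [adj_iff] at ha
  rw [mem_boundary] at hl hr hw
  rw [color_eq_iff] at hc
  have hf := f.odd_mod
  have hg := g.odd_mod
  obtain ⟨h1, h2, h3, h4⟩ := hl
  have hv2 : v.2 = f.y ∨ v.2 = f.y + 1 := by omega
  have hpos : (v.1 = f.x ∧ w.1 = f.x - 1 ∧ w.2 = v.2) ∨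
      (v.1 = f.x + 2 ∧ w.1 = f.x + 3 ∧ w.2 = v.2) ∨
      (v.1 = f.x + 1 ∧ w.1 = f.x + 1 ∧ v.2 = f.y ∧ w.2 = f.y - 1) ∨
      (v.1 = f.x + 1 ∧ w.1 = f.x + 1 ∧ v.2 = f.y + 1 ∧ w.2 = f.y + 2) := by
    rcases ha with ha | ha | ha | ha
    · have : v.1 = f.x + 2 := by omega
      exact Or.inr (Or.inl ⟨this, by omega, ha.2⟩)
    · have : v.1 = f.x := by omega
      exact Or.inl ⟨this, by omega, ha.2.symm⟩
    · have e : v.2 = f.y + 1 := by omega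
      have : v.1 = f.x + 1 := by omega
      exact Or.inr (Or.inr (Or.inr ⟨this, by omega, e, by omega⟩))
    · have e : v.2 = f.y := by omega
      have : v.1 = f.x + 1 := by omega
      exact Or.inr (Or.inr (Or.inl ⟨this, by omega, e, by omega⟩))
  clear ha hw
  rcases hpos with ⟨p1, p2, p3⟩ | ⟨p1, p2, p3⟩ | ⟨p1, p2, p3, p4⟩ | ⟨p1, p2, p3, p4⟩
  · have hgx : g.x = f.x - 3 := by omega
    refine Or.inl ⟨⟨p1, p2, p3, hgx⟩, ?_⟩
    rcases hv2 with hv2 | hv2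
    · exact Or.inl ⟨hv2, by omega⟩
    · exact Or.inr ⟨hv2, by omega⟩
  · have hgx : g.x = f.x + 3 := by omega
    refine Or.inr (Or.inl ⟨⟨p1, p2, p3, hgx⟩, ?_⟩)
    rcases hv2 with hv2 | hv2
    · exact Or.inl ⟨hv2, by omega⟩
    · exact Or.inr ⟨hv2, by omega⟩
  · have hgx : g.x = f.x := by omega
    exact Or.inr (Or.inr ⟨⟨p1, p2, hgx⟩, Or.inl ⟨p3, p4, by omega⟩⟩)
  · have hgx : g.x = f.x := by omega
    exact Or.inr (Or.inr ⟨⟨p1, p2, hgx⟩, Or.inr ⟨p3, p4, by omega⟩⟩)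

theorem CEdge.mem_iff {f g : Face} {v w : Vertex} (h : CEdge f g v w) {k : Face}
    (hk : k ≠ f) (hk' : k ≠ g) : v ∈ k.boundary ↔ w ∈ k.boundary := by
  have hk1 : ¬ (k.x = f.x ∧ k.y = f.y) := fun hh => hk (Face.ext' hh.1 hh.2)
  have hk1' : ¬ (k.x = g.x ∧ k.y = g.y) := fun hh => hk' (Face.ext' hh.1 hh.2)
  rw [mem_boundary, mem_boundary]
  have := f.odd_mod
  have := k.odd_mod
  rcases h.cases with ⟨h1, h2 | h2⟩ | ⟨h1, h2 | h2⟩ | ⟨h1, h2 | h2⟩ <;>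
    constructor <;> intro hm <;> omega

theorem CEdge.partner_unique {f g g' : Face} {v w w' : Vertex} (h : CEdge f g v w)
    (h' : CEdge f g' v w') : w = w' := by
  have h1 := h.cases
  have h2 := h'.cases
  have : w.1 = w'.1 ∧ w.2 = w'.2 := by omega
  exact Prod.ext this.1 this.2

/-- The syndrome of a chain: its parity on every face. -/
def bdry (τ : Config) (f : Face) : ZMod 2 := (f.boundary.map τ).sum

theorem bdry_eq (τ : Config) (f : Face) : bdry τ f =
    τ (f.x, f.y) + (τ (f.x + 1, f.y) + (τ (f.x + 2, f.y) + (τ (f.x, f.y + 1) +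
      (τ (f.x + 1, f.y + 1) + τ (f.x + 2, f.y + 1))))) := by
  simp [bdry, Face.boundary]

theorem bdry_add (τ τ' : Config) (f : Face) : bdry (τ + τ') f = bdry τ f + bdry τ' f := by
  simp only [bdry_eq, Pi.add_apply]; ring

theorem bdry_chain_add (s t : Chain) (f : Face) :
    bdry (s + t : Chain) f = bdry s f + bdry t f := by
  rw [Finsupp.coe_add, bdry_add]

theorem bdry_zero (f : Face) : bdry (0 : Chain) f = 0 := by simp [bdry_eq]

theorem bdry_single (v : Vertex) (f : Face) :
    bdry (Finsupp.single v 1 : Chain) f = if v ∈ f.boundary then 1 else 0 := by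
  have hn : f.boundary.Nodup := by
    simp [Face.boundary]
  rw [bdry, Finsupp.single_eq_pi_single]
  have : ∀ l : List Vertex, l.Nodup →
      (l.map (Pi.single v 1 : Config)).sum = if v ∈ l then 1 else 0 := by
    intro l hl
    induction l with
    | nil => simp
    | cons a l ih =>
      rw [List.nodup_cons] at hl
      rw [List.map_cons, List.sum_cons, ih hl.2]
      by_cases h : v = a
      · subst h; simp [hl.1]
      · simp [h, Ne.symm h]
  exact this _ hn

open Classical in
/-- The indicator of a face. -/
def ind (f : Face) (h : Face) : ZMod 2 := if h = f then 1 else 0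

theorem ind_add_self (f h : Face) : ind f h + ind f h = 0 := zmod_two_add_self _

/-- The chain of the two ends of an edge. -/
def edge (v w : Vertex) : Chain := Finsupp.single v 1 + Finsupp.single w 1

theorem CEdge.bdry {f g : Face} {v w : Vertex} (h : CEdge f g v w) (k : Face) :
    bdry (edge v w) k = ind f k + ind g k := by
  rw [edge, bdry_chain_add, bdry_single, bdry_single]
  by_cases hf : k = f
  · subst hf
    have h1 : w ∉ k.boundary := fun hw => h.ne (face_unique hw h.right h.color)
    simp [ind, h.ne, h.left, h1]
  · by_cases hg : k = g
    · subst hg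
      have h1 : v ∉ k.boundary := fun hw => h.ne (face_unique h.left hw h.color)
      simp [ind, hf, h.right, h1]
    · have := h.mem_iff hf hg
      by_cases hv : v ∈ k.boundary
      · simp [hv, this.mp hv, ind, hf, hg, zmod_two_add_self]
      · simp [hv, mt this.mpr hv, ind, hf, hg]

/-- The configuration is constant on the edges that join two faces of the colour `c`. -/
def IsType (c : Color) (τ : Config) : Prop :=
  ∀ f g v w, f.color = c → CEdge f g v w → τ v = τ w

/-- The chain is orthogonal to the configurations of type `c`. -/
def Orth (c : Color) (t : Chain) : Prop := ∀ τ, IsType c τ → pair τ t = 0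

theorem Orth.add {c : Color} {s t : Chain} (hs : Orth c s) (ht : Orth c t) : Orth c (s + t) :=
  fun τ hτ => by rw [map_add, hs τ hτ, ht τ hτ, add_zero]

theorem Orth.zero (c : Color) : Orth c 0 := fun _ _ => map_zero _

theorem CEdge.orth {f g : Face} {v w : Vertex} (h : CEdge f g v w) : Orth f.color (edge v w) := by
  intro τ hτ
  rw [edge, map_add, pair_single, pair_single, hτ f g v w rfl h, zmod_two_add_self]

theorem support_edge {v w u : Vertex} (h : u ∈ (edge v w).support) : u = v ∨ u = w := by
  by_contra! hn
  rw [Finsupp.mem_support_iff, edge, Finsupp.add_apply, Finsupp.single_eq_of_ne hn.1,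
    Finsupp.single_eq_of_ne hn.2] at h
  exact h (add_zero 0)

/-! ### Strings -/

variable {c c' : Color}

theorem HalfString.cedge (γ : HalfString c) (i : ℕ) :
    CEdge (γ.face i) (γ.face (i + 1)) (γ.vert (2 * i)) (γ.vert (2 * i + 1)) :=
  ⟨by rw [γ.color_face, γ.color_face], γ.face_ne i, γ.start_mem i, γ.end_mem i, γ.adj i⟩

theorem HalfString.chain_zero (γ : HalfString c) : γ.chain 0 = 0 := by simp [HalfString.chain]

theorem HalfString.chain_succ (γ : HalfString c) (n : ℕ) :
    γ.chain (n + 1) = γ.chain n + edge (γ.vert (2 * n)) (γ.vert (2 * n + 1)) := by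
  simp only [HalfString.chain, edge, Nat.mul_add, mul_one, List.range_succ, List.map_append,
    List.sum_append, List.map_cons, List.map_nil, List.sum_cons, List.sum_nil, add_zero, add_assoc]

theorem HalfString.bdry_chain (γ : HalfString c) (n : ℕ) (k : Face) :
    bdry (γ.chain n) k = ind (γ.face 0) k + ind (γ.face n) k := by
  induction n with
  | zero => rw [γ.chain_zero, bdry_zero, ind_add_self]
  | succ n ih =>
    rw [γ.chain_succ, bdry_chain_add, ih, (γ.cedge n).bdry]
    have := ind_add_self (γ.face n) k
    linear_combination this

theorem HalfString.orth_chain (γ : HalfString c) (n : ℕ) : Orth c (γ.chain n) := by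
  induction n with
  | zero => rw [γ.chain_zero]; exact Orth.zero c
  | succ n ih =>
    rw [γ.chain_succ]
    have := (γ.cedge n).orth
    rw [γ.color_face] at this
    exact ih.add this

open Classical in
/-- The vertices of a string, as a configuration. -/
def HalfString.config (γ : HalfString c) : Config := fun v => if v ∈ Set.range γ.vert then 1 else 0

theorem HalfString.config_vert (γ : HalfString c) (j : ℕ) : γ.config (γ.vert j) = 1 := by
  simp [HalfString.config]

theorem HalfString.config_eq_zero (γ : HalfString c) {v : Vertex} (h : ∀ j, γ.vert j ≠ v) :
    γ.config v = 0 := by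
  simp [HalfString.config, h]

theorem HalfString.chain_apply_vert (γ : HalfString c) (n j : ℕ) :
    γ.chain n (γ.vert j) = if j < 2 * n then 1 else 0 := by
  have : ∀ m, ((List.range m).map fun i => Finsupp.single (γ.vert i) (1 : ZMod 2)).sum (γ.vert j)
      = if j < m then 1 else 0 := by
    intro m
    induction m with
    | zero => simp
    | succ m ih =>
      rw [List.range_succ, List.map_append, List.sum_append, Finsupp.add_apply, ih]
      simp only [List.map_cons, List.map_nil, List.sum_cons, List.sum_nil, add_zero]
      rw [Finsupp.single_apply]
      have hi : γ.vert m = γ.vert j ↔ m = j := γ.vert_injective.eq_iff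
      rw [if_congr hi rfl rfl]
      rcases lt_trichotomy j m with h | h | h
      · rw [if_pos h, if_neg (by omega), if_pos (by omega), add_zero]
      · rw [if_neg (by omega), if_pos h.symm, if_pos (by omega), zero_add]
      · rw [if_neg (by omega), if_neg (by omega), if_neg (by omega), zero_add]
  exact this _

theorem HalfString.chain_apply_of_ne (γ : HalfString c) (n : ℕ) {v : Vertex}
    (h : ∀ j, γ.vert j ≠ v) : γ.chain n v = 0 := by
  induction n with
  | zero => rw [γ.chain_zero]; rfl
  | succ n ih =>
    rw [γ.chain_succ, Finsupp.add_apply, ih, edge, Finsupp.add_apply,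
      Finsupp.single_eq_of_ne (h _).symm, Finsupp.single_eq_of_ne (h _).symm]
    rfl

theorem HalfString.mem_support_chain (γ : HalfString c) {n : ℕ} {v : Vertex}
    (h : v ∈ (γ.chain n).support) : ∃ j, γ.vert j = v := by
  by_contra! hn
  exact (Finsupp.mem_support_iff.mp h) (γ.chain_apply_of_ne n hn)

theorem HalfString.locTendsto_chain (γ : HalfString c) : LocTendsto γ.chain atTop γ.config := by
  intro v
  by_cases h : ∃ j, γ.vert j = v
  · obtain ⟨j, rfl⟩ := h
    filter_upwards [eventually_ge_atTop (j + 1)] with n hn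
    rw [γ.chain_apply_vert, γ.config_vert, if_pos (by omega)]
  · push Not at h
    exact Eventually.of_forall fun n => by rw [γ.chain_apply_of_ne n h, γ.config_eq_zero h]

theorem HalfString.vert_odd_of_cedge (γ : HalfString c) {g : Face} {i : ℕ} {w : Vertex} {f : Face}
    (h : CEdge f g (γ.vert (2 * i)) w) (hf : f.color = c) : w = γ.vert (2 * i + 1) := by
  have e : f = γ.face i :=
    face_unique h.left (γ.start_mem i) (by rw [hf, γ.color_face])
  subst e
  exact h.partner_unique (γ.cedge i)

theorem HalfString.vert_even_of_cedge (γ : HalfString c) {g : Face} {i : ℕ} {w : Vertex} {f : Face}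
    (h : CEdge f g (γ.vert (2 * i + 1)) w) (hf : f.color = c) : w = γ.vert (2 * i) := by
  have e : f = γ.face (i + 1) :=
    face_unique h.left (γ.end_mem i) (by rw [hf, γ.color_face])
  subst e
  exact h.partner_unique (γ.cedge i).symm

theorem HalfString.exists_vert_of_cedge (γ : HalfString c) {f g : Face} {v w : Vertex}
    (h : CEdge f g v w) (hf : f.color = c) (hv : ∃ j, γ.vert j = v) : ∃ j, γ.vert j = w := by
  obtain ⟨j, rfl⟩ := hv
  rcases Nat.even_or_odd' j with ⟨i, rfl | rfl⟩
  · exact ⟨_, (γ.vert_odd_of_cedge h hf).symm⟩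
  · exact ⟨_, (γ.vert_even_of_cedge h hf).symm⟩

theorem HalfString.isType_config (γ : HalfString c) : IsType c γ.config := by
  intro f g v w hf h
  by_cases hv : ∃ j, γ.vert j = v
  · obtain ⟨j', rfl⟩ := γ.exists_vert_of_cedge h hf hv
    obtain ⟨j, rfl⟩ := hv
    rw [γ.config_vert, γ.config_vert]
  · have hw : ¬ ∃ j, γ.vert j = w := fun hw =>
      hv (γ.exists_vert_of_cedge h.symm (h.color ▸ hf) hw)
    push Not at hv hw
    rw [γ.config_eq_zero hv, γ.config_eq_zero hw]

theorem HalfString.bdry_config (γ : HalfString c) (k : Face) :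
    bdry γ.config k = ind (γ.face 0) k := by
  have h1 : ∀ᶠ n in atTop, γ.face n ≠ k := by
    have hfin : {j | γ.vert j ∈ k.boundary}.Finite :=
      Set.Finite.preimage γ.vert_injective.injOn (List.finite_toSet k.boundary)
    have h2 : {n | γ.face n = k}.Finite := by
      refine (Set.Finite.preimage (f := fun n : ℕ => 2 * n)
        (fun a _ b _ hab => by simpa using hab) hfin).subset ?_
      rintro n rfl
      exact γ.start_mem n
    have := h2.compl_mem_cofinite
    rw [Nat.cofinite_eq_atTop] at this
    exact this
  have h2 := γ.locTendsto_chain.finset k.boundary.toFinset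
  obtain ⟨n, hn1, hn2⟩ := (h1.and h2).exists
  have h3 : bdry γ.config k = bdry (γ.chain n) k := by
    refine congrArg List.sum (List.map_congr_left fun v hv => ?_)
    exact (hn2 v (by simpa using hv)).symm
  rw [h3, γ.bdry_chain, ind, ind, if_neg (Ne.symm hn1), add_zero]

theorem stringEndo_eq (γ : HalfString c) (k : Pauli) (a : QuasiLocal) :
    stringEndo γ k a = autE k γ.config a := by
  refine Tendsto.limUnder_eq ?_
  simp only [stringOp_eq]
  exact tendsto_autE γ.locTendsto_chain k a

/-! ### Closed chains are products of face operators -/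

/-- The chain of the vertices of a face. -/
def faceChain (f : Face) : Chain := (f.boundary.map fun v => Finsupp.single v (1 : ZMod 2)).sum

theorem pair_faceChain (τ : Config) (f : Face) : pair τ (faceChain f) = bdry τ f := by
  rw [faceChain, bdry, map_list_sum, List.map_map]
  congr 2
  funext v
  exact pair_single τ v

theorem stabK_eq (f : Face) : stabK f = X (faceChain f) := by
  simp only [stabK, funext pauliX_eq]
  exact prod_map_X _ _

theorem stabJ_eq (f : Face) : stabJ f = Z (faceChain f) := by
  simp only [stabJ, funext pauliZ_eq]
  exact prod_map_Z _ _

theorem bdry_faceChain (f h : Face) : bdry (faceChain f) h = 0 := by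
  have h1 : bdry (faceChain f) h = (f.boundary.map fun v =>
      if v ∈ h.boundary then (1 : ZMod 2) else 0).sum := by
    rw [← pair_faceChain, pair_comm, pair_faceChain]
    rw [bdry]
    congr 1
    refine List.map_congr_left fun v _ => ?_
    rw [← bdry_single, ← pair_faceChain, pair_comm, pair_single]
  rw [h1]
  have hdec : ∀ a ∈ Finset.Icc (-2 : ℤ) 2, ∀ b ∈ Finset.Icc (-1 : ℤ) 1, (a + b) % 2 = 0 →
      ∀ q : ℤ → ℤ → ZMod 2,
      (q = fun i j => if a ≤ i ∧ i ≤ a + 2 ∧ b ≤ j ∧ j ≤ b + 1 then 1 else 0) →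
      q 0 0 + (q 1 0 + (q 2 0 + (q 0 1 + (q 1 1 + q 2 1)))) = 0 := by
    rintro a ha b hb hab q rfl
    revert a b
    decide
  have hif : ∀ i j : ℤ, (if (f.x + i, f.y + j) ∈ h.boundary then (1 : ZMod 2) else 0) =
      if h.x - f.x ≤ i ∧ i ≤ h.x - f.x + 2 ∧ h.y - f.y ≤ j ∧ j ≤ h.y - f.y + 1 then 1 else 0 := by
    intro i j
    refine if_congr ?_ rfl rfl
    rw [mem_boundary]
    simp only
    omega
  have hsum : (f.boundary.map fun v => if v ∈ h.boundary then (1 : ZMod 2) else 0).sum =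
      (fun q : ℤ → ℤ → ZMod 2 => q 0 0 + (q 1 0 + (q 2 0 + (q 0 1 + (q 1 1 + q 2 1)))))
        (fun i j => if (f.x + i, f.y + j) ∈ h.boundary then 1 else 0) := by
    simp only [add_zero]
    simp only [Face.boundary, List.map_cons, List.map_nil, List.sum_cons, List.sum_nil, add_zero]
  rw [hsum]
  simp only [hif]
  have := f.odd_mod
  have := h.odd_mod
  by_cases hx : (-2 ≤ h.x - f.x ∧ h.x - f.x ≤ 2) ∧ -1 ≤ h.y - f.y ∧ h.y - f.y ≤ 1
  · exact hdec _ (Finset.mem_Icc.mpr hx.1) _ (Finset.mem_Icc.mpr hx.2) (by omega) _ rfl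
  · repeat rw [if_neg (by omega)]
    decide

theorem mem_span_of_closed (t : Chain) (ht : ∀ f, bdry t f = 0) :
    t ∈ Submodule.span (ZMod 2) (Set.range faceChain) := by
  have key : ∀ (n : ℕ) (B : ℤ) (t : Chain), (∀ f, bdry t f = 0) →
      (∀ v, t v ≠ 0 → B ≤ v.2 ∧ v.2 < B + n) →
      t ∈ Submodule.span (ZMod 2) (Set.range faceChain) := by
    intro n
    induction n with
    | zero =>
      intro B t _ hs
      have : t = 0 := by
        ext v
        by_contra hv
        have := hs v hv
        simp at this
        omega
      rw [this]; exact zero_mem _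
    | succ n ihn =>
      intro B t ht hs
      have inner : ∀ (m : ℕ) (L : ℤ) (t : Chain), (∀ f, bdry t f = 0) →
          (∀ v, t v ≠ 0 → B ≤ v.2 ∧ v.2 < B + (n + 1 : ℕ)) →
          (∀ x, t (x, B + n) ≠ 0 → L ≤ x ∧ x < L + m) →
          t ∈ Submodule.span (ZMod 2) (Set.range faceChain) := by
        intro m
        induction m with
        | zero =>
          intro L t ht hs hm
          refine ihn B t ht fun v hv => ⟨(hs v hv).1, ?_⟩
          have h1 := hs v hv
          by_contra hlt
          have e : v = (v.1, B + n) := Prod.ext rfl (by push_cast at *; omega)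
          rw [e] at hv
          have := hm _ hv
          push_cast at this
          omega
        | succ m ihm =>
          intro L t ht hs hm
          have out : ∀ x y, (y < B ∨ B + n < y) → t (x, y) = 0 := by
            intro x y hy
            by_contra hne
            have := hs _ hne
            push_cast at this
            omega
          have outx : ∀ x, (x < L ∨ L + m < x) → t (x, B + n) = 0 := by
            intro x hy
            by_contra hne
            have := hm _ hne
            push_cast at this
            omega
          by_cases h0 : t (L, B + n) = 0
          · refine ihm (L + 1) t ht hs fun x hx => ?_
            have h1 := hm x hx
            have h2 : x ≠ L := by rintro rfl; exact hx h0
            push_cast at *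
            omega
          · have h1 : t (L, B + n) = 1 := (zmod_two_cases _).resolve_left h0
            have z1 := outx (L - 2) (by omega)
            have z2 := outx (L - 1) (by omega)
            have upper : ∀ x, Odd (x + (B + n)) →
                t (x, B + n) + (t (x + 1, B + n) + t (x + 2, B + n)) = 0 := by
              intro x hx
              have := ht ⟨x, B + n, hx⟩
              rw [bdry_eq] at this
              simp only at this
              rw [out x (B + n + 1) (Or.inr (by omega)),
                out (x + 1) (B + n + 1) (Or.inr (by omega)),
                out (x + 2) (B + n + 1) (Or.inr (by omega))] at this
              simpa using this
            have heven : (L + (B + n)) % 2 = 0 := by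
              by_contra hodd
              have := upper (L - 2) (Int.odd_iff.mpr (by omega))
              rw [z1, show L - 2 + 1 = L - 1 by ring, z2, show L - 2 + 2 = L by ring, h1] at this
              revert this; decide
            have hn1 : 1 ≤ n := by
              by_contra hn0
              obtain rfl : n = 0 := by omega
              have := ht ⟨L - 2, B - 1, Int.odd_iff.mpr (by push_cast at heven; omega)⟩
              rw [bdry_eq] at this
              simp only at this
              rw [out _ (B - 1) (Or.inl (by omega)), out _ (B - 1) (Or.inl (by omega)),
                out _ (B - 1) (Or.inl (by omega))] at this
              simp only [Nat.cast_zero, add_zero] at *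
              rw [show B - 1 + 1 = B by ring, z1, show L - 2 + 1 = L - 1 by ring, z2,
                show L - 2 + 2 = L by ring, h1] at this
              revert this; decide
            have hm2 : 2 ≤ m := by
              by_contra hm2
              have u1 := upper (L - 1) (Int.odd_iff.mpr (by omega))
              rw [z2, show L - 1 + 1 = L by ring, h1, show L - 1 + 2 = L + 1 by ring] at u1
              have u2 := upper (L + 1) (Int.odd_iff.mpr (by omega))
              rw [show L + 1 + 1 = L + 2 by ring, outx (L + 2) (by omega),
                outx (L + 1 + 2) (by omega)] at u2
              simp only [add_zero] at u2
              rw [u2] at u1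
              revert u1; decide
            have hodd : Odd (L + (B + n - 1)) := Int.odd_iff.mpr (by omega)
            let f : Face := ⟨L, B + n - 1, hodd⟩
            have hfv : ∀ v, faceChain f v = if v ∈ f.boundary then 1 else 0 := by
              intro v
              rw [← pair_single (faceChain f) v, pair_comm, pair_faceChain, bdry_single]
            have hmem : t + faceChain f ∈ Submodule.span (ZMod 2) (Set.range faceChain) := by
              refine ihm (L + 1) (t + faceChain f) (fun g => ?_) (fun v hv => ?_) (fun x hx => ?_)
              · rw [bdry_chain_add, ht, bdry_faceChain, add_zero]
              · by_cases hb : v ∈ f.boundary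
                · rw [mem_boundary] at hb
                  simp only [f] at hb
                  push_cast
                  omega
                · rw [Finsupp.add_apply, hfv, if_neg hb, add_zero] at hv
                  exact hs v hv
              · rw [Finsupp.add_apply, hfv] at hx
                by_cases hb : (x, B + (n : ℤ)) ∈ f.boundary
                · rw [if_pos hb] at hx
                  have hxL : x ≠ L := by
                    rintro rfl
                    rw [h1] at hx
                    exact hx (by decide)
                  rw [mem_boundary] at hb
                  simp only [f] at hb
                  omega
                · rw [if_neg hb, add_zero] at hx
                  have h3 := hm x hx
                  have hxL : x ≠ L := by
                    rintro rfl
                    exact hb (mem_boundary.mpr (by simp only [f]; omega))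
                  push_cast at *
                  omega
            have e : t = (t + faceChain f) + faceChain f := by
              rw [add_assoc, add_self_chain, add_zero]
            rw [e]
            exact add_mem hmem (Submodule.subset_span ⟨f, rfl⟩)
      obtain ⟨a, ha⟩ := (t.support.image Prod.fst).bddBelow
      obtain ⟨b, hb⟩ := (t.support.image Prod.fst).bddAbove
      refine inner (b - a + 1).toNat a t ht hs fun x hx => ?_
      have hx' : x ∈ ((t.support.image Prod.fst : Finset ℤ) : Set ℤ) := by
        rw [Finset.mem_coe, Finset.mem_image]
        exact ⟨_, Finsupp.mem_support_iff.mpr hx, rfl⟩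
      have h1 := ha hx'
      have h2 := hb hx'
      omega
  obtain ⟨a, ha⟩ := (t.support.image Prod.snd).bddBelow
  obtain ⟨b, hb⟩ := (t.support.image Prod.snd).bddAbove
  refine key (b - a + 1).toNat a t ht fun v hv => ?_
  have hx' : v.2 ∈ ((t.support.image Prod.snd : Finset ℤ) : Set ℤ) := by
    rw [Finset.mem_coe, Finset.mem_image]
    exact ⟨_, Finsupp.mem_support_iff.mpr hv, rfl⟩
  have h1 := ha hx'
  have h2 := hb hx'
  omega

theorem pair_of_closed {τ : Config} {t : Chain} (hτ : ∀ f, bdry τ f = 0)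
    (ht : ∀ f, bdry t f = 0) : pair τ t = 0 := by
  have h := mem_span_of_closed t ht
  have hle : Submodule.span (ZMod 2) (Set.range faceChain) ≤ LinearMap.ker (pair τ) := by
    rw [Submodule.span_le]
    rintro _ ⟨f, rfl⟩
    exact (pair_faceChain τ f).trans (hτ f)
  exact hle h

/-! ## The ground state -/

/-- The face obtained from `f` by `a` steps along `(3, 1)` and `b` steps along `(3, -1)`. -/
def Face.shift (f : Face) (a b : ℤ) : Face :=
  ⟨f.x + 3 * (a + b), f.y + (a - b), by
    have := f.odd_mod
    exact Int.odd_iff.mpr (by omega)⟩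

theorem Face.shift_color (f : Face) (a b : ℤ) : (f.shift a b).color = f.color := by
  rw [color_eq_iff]; simp only [Face.shift]; omega

theorem Face.shift_shift (f : Face) (a b a' b' : ℤ) :
    (f.shift a b).shift a' b' = f.shift (a + a') (b + b') := by
  apply Face.ext' <;> simp only [Face.shift] <;> ring

theorem Face.shift_zero (f : Face) : f.shift 0 0 = f := by
  apply Face.ext' <;> simp [Face.shift]

theorem cedge_up (f : Face) :
    CEdge f (f.shift 1 0) (f.x + 2, f.y + 1) (f.x + 3, f.y + 1) := by
  refine ⟨(f.shift_color 1 0).symm, fun h => ?_, ?_, ?_, ?_⟩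
  · have := congrArg Face.x h
    simp only [Face.shift] at this; omega
  · rw [mem_boundary]; simp only; omega
  · rw [mem_boundary]; simp only [Face.shift]; omega
  · rw [adj_iff]; exact Or.inl ⟨by ring, rfl⟩

theorem cedge_down (f : Face) :
    CEdge f (f.shift 0 1) (f.x + 2, f.y) (f.x + 3, f.y) := by
  refine ⟨(f.shift_color 0 1).symm, fun h => ?_, ?_, ?_, ?_⟩
  · have := congrArg Face.x h
    simp only [Face.shift] at this; omega
  · rw [mem_boundary]; simp only; omega
  · rw [mem_boundary]; simp only [Face.shift]; omega
  · rw [adj_iff]; exact Or.inl ⟨by ring, rfl⟩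

theorem faceChain_apply (f : Face) (v : Vertex) :
    faceChain f v = if v ∈ f.boundary then 1 else 0 := by
  rw [← pair_single (faceChain f) v, pair_comm, pair_faceChain, bdry_single]

theorem exists_chain_diag (f : Face) (n : ℕ) :
    ∃ t : Chain, ∀ h, bdry t h = ind f h + ind (f.shift n 0) h := by
  induction n with
  | zero => exact ⟨0, fun h => by rw [bdry_zero, Nat.cast_zero, Face.shift_zero, ind_add_self]⟩
  | succ n ih =>
    obtain ⟨t, ht⟩ := ih
    refine ⟨t + edge ((f.shift n 0).x + 2, (f.shift n 0).y + 1)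
      ((f.shift n 0).x + 3, (f.shift n 0).y + 1), fun h => ?_⟩
    · rw [bdry_chain_add, ht, (cedge_up (f.shift n 0)).bdry, Face.shift_shift]
      have := ind_add_self (f.shift n 0) h
      push_cast
      linear_combination this

theorem finite_faces_meeting (Λ : Finset Vertex) :
    ∃ F : Finset Face, ∀ f : Face, (∃ v ∈ f.boundary, v ∈ Λ) → f ∈ F := by
  have hinj : Function.Injective fun f : Face => (f.x, f.y) := fun f g h => by
    simp only [Prod.mk.injEq] at h
    exact Face.ext' h.1 h.2
  have hfin : (⋃ v ∈ Λ, Set.Icc (v.1 - 2) v.1 ×ˢ Set.Icc (v.2 - 1) v.2 : Set (ℤ × ℤ)).Finite :=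
    Set.Finite.biUnion Λ.finite_toSet fun v _ => (Set.finite_Icc _ _).prod (Set.finite_Icc _ _)
  have h2 := hfin.preimage (f := fun f : Face => (f.x, f.y)) hinj.injOn
  refine ⟨h2.toFinset, fun f ⟨v, hv, hΛ⟩ => ?_⟩
  rw [Set.Finite.mem_toFinset]
  simp only [Set.mem_preimage, Set.mem_iUnion]
  rw [mem_boundary] at hv
  exact ⟨v, hΛ, ⟨by simp only [Set.mem_Icc]; omega, by simp only [Set.mem_Icc]; omega⟩⟩

/-- Two different Pauli types, one of them `x` and the other `z`. -/
def IsXZ (p q : Pauli) : Prop := (p = .x ∧ q = .z) ∨ (p = .z ∧ q = .x)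

theorem hamiltonian_eq {p q : Pauli} (h : IsXZ p q) (F : Finset Face) :
    hamiltonian F = -∑ f ∈ F, E p (faceChain f) - ∑ f ∈ F, E q (faceChain f) := by
  rcases h with ⟨rfl, rfl⟩ | ⟨rfl, rfl⟩
  · simp only [hamiltonian, stabK_eq, stabJ_eq, E_x, E_z]
  · simp only [hamiltonian, stabK_eq, stabJ_eq, E_x, E_z]; abel

theorem IsXZ.mul_self {p q : Pauli} (h : IsXZ p q) (t : Chain) : E p t * E p t = 1 := by
  rcases h with ⟨rfl, rfl⟩ | ⟨rfl, rfl⟩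
  · rw [E_x, X_mul_self]
  · rw [E_z, Z_mul_self]

theorem IsXZ.star {p q : Pauli} (h : IsXZ p q) (t : Chain) : star (E p t) = E p t := by
  rcases h with ⟨rfl, rfl⟩ | ⟨rfl, rfl⟩
  · rw [E_x, star_X]
  · rw [E_z, star_Z]

theorem IsXZ.ne {p q : Pauli} (h : IsXZ p q) : p ≠ q := by
  rcases h with ⟨rfl, rfl⟩ | ⟨rfl, rfl⟩ <;> decide

theorem E_faceChain_comm (p q : Pauli) (f g : Face) :
    E p (faceChain f) * E q (faceChain g) = E q (faceChain g) * E p (faceChain f) := by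
  rw [E_comm, pair_faceChain, bdry_faceChain, mul_zero, sgn_zero, one_smul]

/-- The projection onto the states with an excitation at the face `f`. -/
def excite (p : Pauli) (f : Face) : QuasiLocal := (2⁻¹ : ℂ) • (1 - E p (faceChain f))

section Excite

variable {p q : Pauli}

theorem E_mul_excite (hpq : IsXZ p q) (f : Face) :
    E p (faceChain f) * excite p f = -excite p f := by
  rw [excite, mul_smul_comm, mul_sub, mul_one, hpq.mul_self, ← smul_neg, neg_sub]

theorem E_faceChain_comm_excite (p q : Pauli) (f g : Face) :
    E q (faceChain g) * excite p f = excite p f * E q (faceChain g) := by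
  rw [excite, mul_smul_comm, smul_mul_assoc, mul_sub, sub_mul, mul_one, one_mul,
    E_faceChain_comm]

theorem E_faceChain_eq (f : Face) : E p (faceChain f) = 1 - (2 : ℂ) • excite p f := by
  rw [excite, smul_smul]; norm_num

theorem excite_comm (f g : Face) : excite p f * excite p g = excite p g * excite p f := by
  conv_lhs => rw [excite]
  conv_rhs => rw [excite.eq_def p f]
  rw [mul_smul_comm, smul_mul_assoc, mul_sub, sub_mul, mul_one, one_mul,
    E_faceChain_comm_excite p p g f]

theorem excite_mul_self (hpq : IsXZ p q) (f : Face) : excite p f * excite p f = excite p f := by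
  have h := E_mul_excite hpq f
  rw [E_faceChain_eq, sub_mul, one_mul, smul_mul_assoc] at h
  have h2 : (2 : ℂ) • (excite p f * excite p f) = (2 : ℂ) • excite p f := by
    rw [sub_eq_iff_eq_add] at h
    rw [two_smul ℂ (excite p f)]
    rw [neg_add_eq_sub] at h
    exact (eq_sub_iff_add_eq.mp h).symm
  exact smul_right_injective _ (two_ne_zero) h2

theorem star_excite (hpq : IsXZ p q) (f : Face) : star (excite p f) = excite p f := by
  rw [excite, star_smul, star_sub, star_one, hpq.star]
  simp

variable {ω : QuasiLocal →ₗ[ℂ] ℂ}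

theorem energy_change (hpq : IsXZ p q) {f g : Face} (hfg : f ≠ g) {t : Chain}
    (ht : ∀ h, bdry t h = ind f h + ind g h) {F : Finset Face} (hf : f ∈ F) (hg : g ∈ F) :
    star (E q t * excite p f) * (hamiltonian F * (E q t * excite p f)
      - (E q t * excite p f) * hamiltonian F) = (-4 : ℂ) • (excite p g * excite p f) := by
  have hK : ∀ h, E p (faceChain h) * (E q t * excite p f) - (E q t * excite p f) * E p (faceChain h)
      = (sgn (bdry t h) - 1) • (E q t * (E p (faceChain h) * excite p f)) := by
    intro h
    rw [← mul_assoc, E_comm p q, kap_of_ne hpq.ne, one_mul, pair_comm, pair_faceChain,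
      smul_mul_assoc, mul_assoc, mul_assoc, ← E_faceChain_comm_excite, sub_smul, one_smul]
  have hJ : ∀ h, E q (faceChain h) * (E q t * excite p f)
      = (E q t * excite p f) * E q (faceChain h) := by
    intro h
    rw [← mul_assoc, E_comm q q, kap_self, zero_mul, sgn_zero, one_smul, mul_assoc, mul_assoc,
      E_faceChain_comm_excite]
  have hH : hamiltonian F * (E q t * excite p f) - (E q t * excite p f) * hamiltonian F
      = -∑ h ∈ F, (sgn (bdry t h) - 1) • (E q t * (E p (faceChain h) * excite p f)) := by
    rw [hamiltonian_eq hpq, sub_mul, mul_sub, neg_mul, mul_neg, Finset.sum_mul, Finset.mul_sum,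
      Finset.sum_mul, Finset.mul_sum, Finset.sum_congr rfl fun h _ => hJ h,
      ← Finset.sum_congr rfl fun h _ => hK h, Finset.sum_sub_distrib]
    abel
  classical
  have hsum : ∑ h ∈ F, (sgn (bdry t h) - 1) • (E q t * (E p (faceChain h) * excite p f))
      = ∑ h ∈ {f, g}, (sgn (bdry t h) - 1) • (E q t * (E p (faceChain h) * excite p f)) := by
    symm
    refine Finset.sum_subset (fun h => ?_) fun h _ hh => ?_
    · simp only [Finset.mem_insert, Finset.mem_singleton]
      rintro (rfl | rfl) <;> assumption
    simp only [Finset.mem_insert, Finset.mem_singleton, not_or] at hh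
    rw [ht, ind, ind, if_neg hh.1, if_neg hh.2, add_zero, sgn_zero, sub_self, zero_smul]
  have e1 : sgn (bdry t f) - 1 = -2 := by
    rw [ht, ind, ind, if_pos rfl, if_neg hfg, add_zero, sgn_one]; norm_num
  have e2 : sgn (bdry t g) - 1 = -2 := by
    rw [ht, ind, ind, if_pos rfl, if_neg hfg.symm, zero_add, sgn_one]; norm_num
  rw [hH, hsum, Finset.sum_pair hfg, e1, e2, star_mul, star_excite hpq, E_mul_excite hpq,
    E_faceChain_eq g, sub_mul, one_mul, smul_mul_assoc]
  have e3 : -((-2 : ℂ) • (E q t * -excite p f)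
      + (-2 : ℂ) • (E q t * (excite p f - (2 : ℂ) • (excite p g * excite p f))))
      = E q t * ((-4 : ℂ) • (excite p g * excite p f)) := by
    rw [mul_sub, mul_neg, mul_smul_comm, mul_smul_comm]; module
  rw [e3, mul_assoc, ← mul_assoc (star (E q t)), star_E_mul, one_mul, mul_smul_comm, ← mul_assoc,
    excite_comm, mul_assoc, excite_mul_self hpq]

theorem excite_pair (hω : IsGroundState ω) (hpq : IsXZ p q) {f g : Face} (hfg : f ≠ g) {t : Chain}
    (ht : ∀ h, bdry t h = ind f h + ind g h) : ω (excite p g * excite p f) = 0 := by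
  have hpos : 0 ≤ ω (excite p g * excite p f) := by
    have := hω.pos (excite p g * excite p f)
    rwa [star_mul, star_excite hpq, star_excite hpq, ← excite_comm g f, mul_assoc,
      ← mul_assoc (excite p f), excite_comm f g, mul_assoc, excite_mul_self hpq, ← mul_assoc,
      excite_mul_self hpq] at this
  obtain ⟨F, hF⟩ := finite_faces_meeting (t.support ∪ f.boundary.toFinset ∪ g.boundary.toFinset)
  have hmem : ∀ h : Face, (h = f ∨ h = g) → h ∈ F := by
    rintro h (rfl | rfl)
    · exact hF _ ⟨(h.x, h.y), by simp [Face.boundary], by simp [Face.boundary]⟩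
    · exact hF _ ⟨(h.x, h.y), by simp [Face.boundary], by simp [Face.boundary]⟩
  have hloc : ∀ v ∈ (faceChain f).support, v ∈ f.boundary := by
    intro v hv
    rw [Finsupp.mem_support_iff, faceChain_apply] at hv
    by_contra hn
    exact hv (if_neg hn)
  have h := hω.ground (t.support ∪ f.boundary.toFinset ∪ g.boundary.toFinset)
    (E q t * excite p f) (by
      refine mul_mem (E_localized q t fun v hv => by simp [Finsupp.mem_support_iff.mp hv]) ?_
      refine SMulMemClass.smul_mem _ (sub_mem (one_mem _) (E_localized p _ fun v hv => ?_))
      have := hloc v hv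
      simp [this]) F hF
  rw [mul_smul_comm, energy_change hpq hfg ht (hmem f (Or.inl rfl)) (hmem g (Or.inr rfl)),
    map_smul, map_smul, smul_eq_mul, smul_eq_mul, ← mul_assoc, neg_mul, Complex.I_mul_I, neg_neg,
    one_mul] at h
  refine le_antisymm ?_ hpos
  have h4 : (0 : ℂ) ≤ 4⁻¹ := by norm_num [Complex.le_def]
  have := mul_nonneg h4 h
  rw [← mul_assoc] at this
  norm_num at this
  exact this

theorem shiftOp_apply (t : Vertex) (ψ : ConfigSpace) (s : Config) :
    shiftOp t ψ s = ψ (fun v => s (v + t)) := by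
  rw [shiftOp, monomialOp_apply, one_mul]
  refine congrArg (ψ : Config → ℂ) (funext fun v => ?_)
  simp [Equiv.arrowCongr]

theorem ground_shift (hinv : IsTranslationInvariant ω) (hpq : IsXZ p q) (f : Face) (n : ℤ) :
    ω (E p (faceChain (f.shift n 0))) = ω (E p (faceChain f)) := by
  refine hinv (3 * n, n) (by
    rw [Int.even_iff]; simp only; omega) _ _ ?_
  have hmem : ∀ v : Vertex, v + (3 * n, n) ∈ (f.shift n 0).boundary ↔ v ∈ f.boundary := by
    intro v
    rw [mem_boundary, mem_boundary]
    simp only [Face.shift, Prod.fst_add, Prod.snd_add]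
    omega
  rcases hpq with ⟨rfl, rfl⟩ | ⟨rfl, rfl⟩
  · rw [E_x, E_x]
    refine op_ext fun ψ s => ?_
    rw [mul_apply_eq_comp, mul_apply_eq_comp]
    change opX _ _ s = shiftOp _ (opX _ ψ) s
    rw [opX_apply, shiftOp_apply, shiftOp_apply, opX_apply]
    refine congrArg (ψ : Config → ℂ) (funext fun v => ?_)
    simp only [Pi.add_apply, faceChain_apply, hmem]
  · rw [E_z, E_z]
    refine op_ext fun ψ s => ?_
    rw [mul_apply_eq_comp, mul_apply_eq_comp]
    change opZ _ _ s = shiftOp _ (opZ _ ψ) s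
    rw [opZ_apply, shiftOp_apply, shiftOp_apply, opZ_apply, pair_faceChain, pair_faceChain]
    congr 2
    rw [bdry_eq, bdry_eq]
    refine congrArg₂ _ (congrArg s (Prod.ext ?_ ?_)) (congrArg₂ _ (congrArg s (Prod.ext ?_ ?_))
      (congrArg₂ _ (congrArg s (Prod.ext ?_ ?_)) (congrArg₂ _ (congrArg s (Prod.ext ?_ ?_))
      (congrArg₂ _ (congrArg s (Prod.ext ?_ ?_)) (congrArg s (Prod.ext ?_ ?_))))))
    all_goals simp only [Face.shift, Prod.mk_add_mk]; ring

theorem excite_eq_zero (hω : IsGroundState ω) (hinv : IsTranslationInvariant ω) (hpq : IsXZ p q)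
    (f : Face) : ω (excite p f) = 0 := by
  have hsame : ∀ n : ℕ, ω (excite p (f.shift n 0)) = ω (excite p f) := by
    intro n
    rw [excite, excite, map_smul, map_smul, map_sub, map_sub, ground_shift hinv hpq]
  have horth : ∀ m n : ℕ, m ≠ n →
      ω (excite p (f.shift m 0) * excite p (f.shift n 0)) = 0 := by
    intro m n hmn
    obtain ⟨s, hs⟩ := exists_chain_diag f m
    obtain ⟨t, ht⟩ := exists_chain_diag f n
    refine excite_pair hω hpq (t := s + t) (fun h => hmn ?_) (fun h => ?_)
    · have := congrArg Face.x h
      simp only [Face.shift] at this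
      omega
    · rw [bdry_chain_add, hs, ht]
      have := ind_add_self f h
      linear_combination this
  have hpos : 0 ≤ ω (excite p f) := by
    have := hω.pos (excite p f)
    rwa [star_excite hpq, excite_mul_self hpq] at this
  have key : ∀ n : ℕ, 0 ≤ (4 : ℂ) - 3 * n * ω (excite p f) := by
    intro n
    set N : QuasiLocal := ∑ j ∈ Finset.range n, excite p (f.shift j 0) with hN
    have h1 : ω N = n * ω (excite p f) := by
      rw [hN, map_sum, Finset.sum_congr rfl fun j _ => hsame j, Finset.sum_const,
        Finset.card_range, nsmul_eq_mul]
    have h2 : ω (N * N) = n * ω (excite p f) := by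
      rw [hN, Finset.sum_mul_sum, map_sum]
      have : ∀ i ∈ Finset.range n, ω (∑ j ∈ Finset.range n,
          excite p (f.shift i 0) * excite p (f.shift j 0)) = ω (excite p f) := by
        intro i hi
        rw [map_sum, Finset.sum_eq_single_of_mem i hi fun j _ hj => horth i j hj.symm,
          excite_mul_self hpq, hsame]
      rw [Finset.sum_congr rfl this, Finset.sum_const, Finset.card_range, nsmul_eq_mul]
    have h3 : star N = N := by
      rw [hN, star_sum]
      exact Finset.sum_congr rfl fun j _ => star_excite hpq _
    have h4 := hω.pos (N - (2 : ℂ) • 1)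
    have e : star (N - (2 : ℂ) • (1 : QuasiLocal)) * (N - (2 : ℂ) • 1)
        = N * N - (4 : ℂ) • N + (4 : ℂ) • 1 := by
      rw [star_sub, h3, star_smul, star_one, sub_mul, mul_sub, mul_sub, mul_smul_comm,
        smul_mul_assoc, smul_mul_assoc, mul_smul_comm, mul_one, one_mul, mul_one]
      have : star (2 : ℂ) = 2 := by simp
      rw [this]
      module
    rw [e, map_add, map_sub, map_smul, map_smul, hω.unital, h1, h2] at h4
    convert h4 using 1
    simp only [smul_eq_mul]
    ring
  rw [Complex.le_def] at hpos
  refine Complex.ext ?_ hpos.2.symm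
  refine le_antisymm ?_ hpos.1
  by_contra! hlt
  obtain ⟨n, hn⟩ := exists_nat_gt (2 / (ω (excite p f)).re)
  have h5 := (Complex.le_def.mp (key n)).1
  rw [div_lt_iff₀ hlt] at hn
  simp at h5
  nlinarith

theorem ground_face (hω : IsGroundState ω) (hinv : IsTranslationInvariant ω) (hpq : IsXZ p q)
    (f : Face) : ω (E p (faceChain f)) = 1 := by
  rw [E_faceChain_eq, map_sub, map_smul, excite_eq_zero hω hinv hpq, smul_zero, sub_zero, hω.unital]

end Excite

section Vacuum

variable {H : Type*} [NormedAddCommGroup H] [InnerProductSpace ℂ H] [CompleteSpace H]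
  {ω : QuasiLocal →ₗ[ℂ] ℂ} {π₀ : QuasiLocal →⋆ₐ[ℂ] (H →L[ℂ] H)} {Ω : H}

theorem norm_vacuum (hω : IsGroundState ω) (hG : IsGNS ω π₀ Ω) : ‖Ω‖ = 1 := by
  have h := hG.eval 1
  rw [hω.unital, map_one, one_apply_eq_self, inner_self_eq_norm_sq_to_K] at h
  have h2 : ‖Ω‖ ^ 2 = 1 := by
    have : (‖Ω‖ : ℂ) ^ 2 = 1 := by simpa using h.symm
    exact_mod_cast this
  nlinarith [norm_nonneg Ω]

theorem vacuum_face {p q : Pauli} (hω : IsGroundState ω) (hinv : IsTranslationInvariant ω)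
    (hG : IsGNS ω π₀ Ω) (hpq : IsXZ p q) (f : Face) : π₀ (E p (faceChain f)) Ω = Ω := by
  have h1 := ground_face hω hinv hpq f
  rw [hG.eval] at h1
  have hn := norm_vacuum hω hG
  have h2 : ‖π₀ (E p (faceChain f)) Ω‖ = 1 := by
    have h3 : inner ℂ (π₀ (E p (faceChain f)) Ω) (π₀ (E p (faceChain f)) Ω) = inner ℂ Ω Ω := by
      rw [← ContinuousLinearMap.adjoint_inner_right, ← ContinuousLinearMap.star_eq_adjoint,
        ← map_star, hpq.star, ← mul_apply_eq_comp, ← map_mul, hpq.mul_self, map_one,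
        one_apply_eq_self]
    rw [inner_self_eq_norm_sq_to_K, inner_self_eq_norm_sq_to_K, hn] at h3
    have h4 : ‖π₀ (E p (faceChain f)) Ω‖ ^ 2 = 1 := by
      have : (‖π₀ (E p (faceChain f)) Ω‖ : ℂ) ^ 2 = 1 := by simpa using h3
      exact_mod_cast this
    nlinarith [norm_nonneg (π₀ (E p (faceChain f)) Ω)]
  exact ((inner_eq_one_iff_of_norm_eq_one hn h2).mp h1).symm

theorem vacuum_closed {p q : Pauli} (hω : IsGroundState ω) (hinv : IsTranslationInvariant ω)
    (hG : IsGNS ω π₀ Ω) (hpq : IsXZ p q) {t : Chain} (ht : ∀ f, bdry t f = 0) :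
    π₀ (E p t) Ω = Ω := by
  have hadd : ∀ s t, E p (s + t) = E p s * E p t := by
    intro s t
    rcases hpq with ⟨rfl, rfl⟩ | ⟨rfl, rfl⟩
    · simp only [E_x, X_add]
    · simp only [E_z, Z_add]
  refine Submodule.span_induction (p := fun t _ => π₀ (E p t) Ω = Ω) ?_ ?_ ?_ ?_
    (mem_span_of_closed t ht)
  · rintro _ ⟨f, rfl⟩
    exact vacuum_face hω hinv hG hpq f
  · rw [E_zero, map_one, one_apply_eq_self]
  · intro s t _ _ hs ht
    rw [hadd, map_mul, mul_apply_eq_comp, ht, hs]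
  · intro a t _ ht
    rcases zmod_two_cases a with rfl | rfl
    · rw [zero_smul, E_zero, map_one, one_apply_eq_self]
    · rwa [one_smul]

end Vacuum

/-! ## Strong limits and charge transporters -/

section Transport

variable {H : Type*} [NormedAddCommGroup H] [InnerProductSpace ℂ H] [CompleteSpace H]

/-- Convergence in the strong operator topology. -/
def StrongLim {ι : Type*} (T : ι → H →L[ℂ] H) (l : Filter ι) (S : H →L[ℂ] H) : Prop :=
  ∀ ξ, Tendsto (fun i => T i ξ) l (𝓝 (S ξ))

theorem StrongLim.unique {ι : Type*} {T : ι → H →L[ℂ] H} {l : Filter ι} [l.NeBot]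
    {S S' : H →L[ℂ] H} (h : StrongLim T l S) (h' : StrongLim T l S') : S = S' :=
  ContinuousLinearMap.ext fun ξ => tendsto_nhds_unique (h ξ) (h' ξ)

theorem StrongLim.const {ι : Type*} (l : Filter ι) (S : H →L[ℂ] H) :
    StrongLim (fun _ : ι => S) l S := fun _ => tendsto_const_nhds

theorem tendsto_apply_of_bounded {ι : Type*} {T : ι → H →L[ℂ] H} {l : Filter ι} {u : ι → H}
    {ξ η : H} (hb : ∀ i, ‖T i‖ ≤ 1) (hu : Tendsto u l (𝓝 ξ))
    (h : Tendsto (fun i => T i ξ) l (𝓝 η)) : Tendsto (fun i => T i (u i)) l (𝓝 η) := by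
  have h1 : Tendsto (fun i => T i (u i - ξ)) l (𝓝 0) := by
    refine squeeze_zero_norm (a := fun i => ‖u i - ξ‖) (fun i => ?_) ?_
    · calc ‖T i (u i - ξ)‖ ≤ ‖T i‖ * ‖u i - ξ‖ := (T i).le_opNorm _
        _ ≤ 1 * ‖u i - ξ‖ := by gcongr; exact hb i
        _ = ‖u i - ξ‖ := one_mul _
    · have := (hu.sub_const ξ).norm
      simpa using this
  have h2 := h1.add h
  rw [zero_add] at h2
  refine h2.congr fun i => ?_
  rw [map_sub, sub_add_cancel]

theorem StrongLim.mul {ι : Type*} {T T' : ι → H →L[ℂ] H} {l : Filter ι} {S S' : H →L[ℂ] H}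
    (hb : ∀ i, ‖T i‖ ≤ 1) (h : StrongLim T l S) (h' : StrongLim T' l S') :
    StrongLim (fun i => T i * T' i) l (S * S') := fun ξ => by
  simp only [mul_apply_eq_comp]
  exact tendsto_apply_of_bounded hb (h' ξ) (h _)

theorem StrongLim.const_mul {ι : Type*} {T : ι → H →L[ℂ] H} {l : Filter ι} {S : H →L[ℂ] H}
    (g : H →L[ℂ] H) (h : StrongLim T l S) : StrongLim (fun i => g * T i) l (g * S) := fun ξ =>
  (g.continuous.tendsto _).comp (h ξ)

theorem StrongLim.mul_const {ι : Type*} {T : ι → H →L[ℂ] H} {l : Filter ι} {S : H →L[ℂ] H}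
    (g : H →L[ℂ] H) (h : StrongLim T l S) : StrongLim (fun i => T i * g) l (S * g) := fun ξ =>
  h (g ξ)

theorem StrongLim.commute {ι : Type*} {T : ι → H →L[ℂ] H} {l : Filter ι} [l.NeBot]
    {S : H →L[ℂ] H} (h : StrongLim T l S) {g : H →L[ℂ] H} (hg : ∀ᶠ i in l, g * T i = T i * g) :
    g * S = S * g := by
  refine ContinuousLinearMap.ext fun ξ => tendsto_nhds_unique (h.const_mul g ξ) ?_
  refine (h.mul_const g ξ).congr' ?_
  filter_upwards [hg] with i hi
  rw [hi]

theorem cauchySeq_of_dense {T : ℕ → H →L[ℂ] H} (hb : ∀ i, ‖T i‖ ≤ 1) {D : Set H} (hD : Dense D)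
    (h : ∀ ξ ∈ D, CauchySeq fun i => T i ξ) (ξ : H) : CauchySeq fun i => T i ξ := by
  rw [Metric.cauchySeq_iff]
  intro ε hε
  obtain ⟨η, hη, hd⟩ := hD.exists_dist_lt ξ (show 0 < ε / 3 by positivity)
  obtain ⟨N, hN⟩ := Metric.cauchySeq_iff.mp (h η hη) (ε / 3) (by positivity)
  have hc : ∀ i, dist (T i ξ) (T i η) ≤ dist ξ η := by
    intro i
    rw [dist_eq_norm, dist_eq_norm, ← map_sub]
    calc ‖T i (ξ - η)‖ ≤ ‖T i‖ * ‖ξ - η‖ := (T i).le_opNorm _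
      _ ≤ 1 * ‖ξ - η‖ := by gcongr; exact hb i
      _ = ‖ξ - η‖ := one_mul _
  refine ⟨N, fun m hm n hn => ?_⟩
  have h1 := hN m hm n hn
  have h2 := hc m
  have h3 := hc n
  have h4 := dist_triangle4 (T m ξ) (T m η) (T n η) (T n ξ)
  rw [dist_comm (T n η)] at h4
  linarith

theorem exists_strongLim {T : ℕ → H →L[ℂ] H} (h : ∀ ξ, CauchySeq fun i => T i ξ) :
    ∃ S, StrongLim T atTop S := by
  choose f hf using fun ξ => cauchySeq_tendsto_of_complete (h ξ)
  exact ⟨continuousLinearMapOfTendsto T (tendsto_pi_nhds.mpr hf), hf⟩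

/-- The vector `Ω` is cyclic and fixed by the closed strings. -/
structure IsVacuum (π₀ : QuasiLocal →⋆ₐ[ℂ] (H →L[ℂ] H)) (Ω : H) : Prop where
  cyclic : Dense (Set.range fun a => π₀ a Ω)
  fixed : ∀ p q, IsXZ p q → ∀ t : Chain, (∀ f, bdry t f = 0) → π₀ (E p t) Ω = Ω
  ne_zero : Ω ≠ 0

theorem isVacuum {ω : QuasiLocal →ₗ[ℂ] ℂ} {π₀ : QuasiLocal →⋆ₐ[ℂ] (H →L[ℂ] H)} {Ω : H}
    (hω : IsGroundState ω) (hinv : IsTranslationInvariant ω) (hG : IsGNS ω π₀ Ω) :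
    IsVacuum π₀ Ω :=
  ⟨hG.cyclic, fun _ _ hpq _ ht => vacuum_closed hω hinv hG hpq ht, fun h => by
    have := norm_vacuum hω hG
    rw [h, norm_zero] at this
    exact zero_ne_one this⟩

variable {π₀ : QuasiLocal →⋆ₐ[ℂ] (H →L[ℂ] H)} {Ω : H}

theorem norm_rep_le (a : QuasiLocal) : ‖π₀ a‖ ≤ ‖a‖ :=
  have := isClosed_regionAlg Set.univ
  NonUnitalStarAlgHom.norm_apply_le π₀ a

theorem continuous_rep : Continuous π₀ := by
  refine AddMonoidHomClass.continuous_of_bound π₀ 1 fun a => ?_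
  rw [one_mul]; exact norm_rep_le a

theorem norm_E_le (k : Pauli) (t : Chain) : ‖E k t‖ ≤ 1 := by
  have h1 : ‖(1 : QuasiLocal)‖ ≤ 1 := ContinuousLinearMap.norm_id_le
  have h2 := CStarRing.norm_star_mul_self (x := E k t)
  rw [star_E_mul] at h2
  nlinarith [norm_nonneg (E k t)]

theorem norm_rep_E_le (k : Pauli) (t : Chain) : ‖π₀ (E k t)‖ ≤ 1 :=
  (norm_rep_le _).trans (norm_E_le k t)

theorem norm_rep_star_E_le (k : Pauli) (t : Chain) : ‖π₀ (star (E k t))‖ ≤ 1 := by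
  rw [map_star, norm_star]; exact norm_rep_E_le k t

theorem cauchySeq_E (hv : IsVacuum π₀ Ω) {p q : Pauli} (hpq : IsXZ p q) {t : ℕ → Chain}
    {τ : Config} (hτ : LocTendsto t atTop τ) (hc : ∀ m n f, bdry (t m) f = bdry (t n) f) (ξ : H) :
    CauchySeq fun m => π₀ (E p (t m)) ξ := by
  have hadd : ∀ s t, E p (s + t) = E p s * E p t := by
    intro s t
    rcases hpq with ⟨rfl, rfl⟩ | ⟨rfl, rfl⟩
    · simp only [E_x, X_add]
    · simp only [E_z, Z_add]
  have h0 : ∀ m, π₀ (E p (t m)) Ω = π₀ (E p (t 0)) Ω := by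
    intro m
    have e : E p (t m) = E p (t 0) * E p (t 0 + t m) := by
      rw [hadd, ← mul_assoc, hpq.mul_self, one_mul]
    rw [e, map_mul, mul_apply_eq_comp, hv.fixed p q hpq]
    intro f
    rw [bdry_chain_add, hc 0 m, zmod_two_add_self]
  refine cauchySeq_of_dense (fun m => norm_rep_E_le _ _) hv.cyclic ?_ ξ
  rintro _ ⟨a, rfl⟩
  have h1 : Tendsto (fun m => π₀ (conjE p (t m) a) (π₀ (E p (t 0)) Ω)) atTop
      (𝓝 (π₀ (autE p τ a) (π₀ (E p (t 0)) Ω))) := by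
    have := (continuous_rep (π₀ := π₀)).tendsto _ |>.comp (tendsto_autE hτ p a)
    exact ((ContinuousLinearMap.apply ℂ H (π₀ (E p (t 0)) Ω)).continuous.tendsto _).comp this
  refine (h1.congr fun m => ?_).cauchySeq
  rw [← h0 m, ← mul_apply_eq_comp, ← map_mul, ← mul_apply_eq_comp, ← map_mul, conjE, mul_assoc,
    hpq.mul_self, mul_one, hpq.star]

/-- The unitary `U` is the strong limit of the string operators of type `k` of the chains `t m`. -/
structure IsTransporter (π₀ : QuasiLocal →⋆ₐ[ℂ] (H →L[ℂ] H)) (k : Pauli) (t : ℕ → Chain)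
    (U : H →L[ℂ] H) : Prop where
  unitary : U ∈ unitary (H →L[ℂ] H)
  lim : StrongLim (fun m => π₀ (E k (t m))) atTop U
  lim_star : StrongLim (fun m => π₀ (star (E k (t m)))) atTop (star U)

theorem star_eq_of_strongLim {T : ℕ → H →L[ℂ] H} {U V : H →L[ℂ] H} (hU : StrongLim T atTop U)
    (hV : StrongLim (fun m => star (T m)) atTop V) : V = star U := by
  rw [ContinuousLinearMap.star_eq_adjoint, ContinuousLinearMap.eq_adjoint_iff]
  intro ξ η
  have h1 := (hV ξ).inner (𝕜 := ℂ) (tendsto_const_nhds (x := η))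
  have h2 := (tendsto_const_nhds (x := ξ)).inner (𝕜 := ℂ) (hU η)
  refine tendsto_nhds_unique h1 (h2.congr fun m => ?_)
  simp only [ContinuousLinearMap.star_eq_adjoint, ContinuousLinearMap.adjoint_inner_left]

theorem exists_transporter (hv : IsVacuum π₀ Ω) (k : Pauli) {t : ℕ → Chain} {τ : Config}
    (hτ : LocTendsto t atTop τ) (hc : ∀ m n f, bdry (t m) f = bdry (t n) f) :
    ∃ U, IsTransporter π₀ k t U := by
  have hsm : ∀ x : ZMod 2, LocTendsto (fun m => x • t m) atTop (x • τ) := by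
    intro x v
    filter_upwards [hτ v] with m hm
    simp [hm]
  have hcs : ∀ x : ZMod 2, ∀ m n f, bdry (x • t m : Chain) f = bdry (x • t n : Chain) f := by
    intro x m n f
    rcases zmod_two_cases x with rfl | rfl
    · simp
    · simpa using hc m n f
  have hX := cauchySeq_E hv (p := .x) (q := .z) (Or.inl ⟨rfl, rfl⟩) (hsm k.cx) (hcs k.cx)
  have hZ := cauchySeq_E hv (p := .z) (q := .x) (Or.inr ⟨rfl, rfl⟩) (hsm k.cz) (hcs k.cz)
  obtain ⟨Ux, hUx⟩ := exists_strongLim hX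
  obtain ⟨Uz, hUz⟩ := exists_strongLim hZ
  have h1 : StrongLim (fun m => π₀ (E k (t m))) atTop (Ux * Uz) := by
    have := hUx.mul (fun m => norm_rep_E_le _ _) hUz
    simp only [← map_mul, E_x, E_z] at this
    exact this
  have h2 : StrongLim (fun m => π₀ (star (E k (t m)))) atTop (Uz * Ux) := by
    have := hUz.mul (fun m => norm_rep_E_le _ _) hUx
    simp only [← map_mul, E_x, E_z] at this
    simp only [E, star_mul, star_X, star_Z]
    exact this
  have h3 : Uz * Ux = star (Ux * Uz) := by
    refine star_eq_of_strongLim h1 ?_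
    simpa only [map_star] using h2
  rw [h3] at h2
  refine ⟨Ux * Uz, ⟨?_, h1, h2⟩⟩
  rw [Unitary.mem_iff]
  constructor
  · refine StrongLim.unique (h2.mul (fun m => norm_rep_star_E_le _ _) h1) ?_
    simp only [← map_mul, star_E_mul, map_one]
    exact StrongLim.const _ _
  · refine StrongLim.unique (h1.mul (fun m => norm_rep_E_le _ _) h2) ?_
    simp only [← map_mul, E_mul_star, map_one]
    exact StrongLim.const _ _

variable {k k' : Pauli} {t s : ℕ → Chain} {U V : H →L[ℂ] H}

theorem IsTransporter.conj (hU : IsTransporter π₀ k t U) {τ : Config} (hτ : LocTendsto t atTop τ)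
    (a : QuasiLocal) : star U * π₀ a * U = π₀ (autE k τ a) := by
  have h1 := hU.lim_star.mul (fun m => norm_rep_star_E_le _ _) (hU.lim.const_mul (π₀ a))
  simp only [← map_mul, ← mul_assoc] at h1
  refine h1.unique fun ξ => ?_
  have := (continuous_rep (π₀ := π₀)).tendsto _ |>.comp (tendsto_autE hτ k a)
  exact ((ContinuousLinearMap.apply ℂ H ξ).continuous.tendsto _).comp this

theorem IsTransporter.commute (hU : IsTransporter π₀ k t U) {g : H →L[ℂ] H}
    (hg : ∀ᶠ m in atTop, g * π₀ (E k (t m)) = π₀ (E k (t m)) * g) : g * U = U * g :=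
  hU.lim.commute hg

theorem mem_coneVN_iff {Λ : Cone} {T : H →L[ℂ] H} : T ∈ coneVN π₀ Λ ↔
    ∀ g : H →L[ℂ] H, (∀ a, LocalizedIn Λ.sites a → g * π₀ a = π₀ a * g) → g * T = T * g := by
  have hstar : ∀ g : H →L[ℂ] H, (∀ a, LocalizedIn Λ.sites a → g * π₀ a = π₀ a * g) →
      ∀ a, LocalizedIn Λ.sites a → star g * π₀ a = π₀ a * star g := by
    intro g hg a ha
    have h1 := hg (star a) (star_mem ha)
    have h2 := congrArg star h1
    rw [star_mul, star_mul, ← map_star, star_star] at h2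
    exact h2.symm
  have hmem : ∀ g : H →L[ℂ] H,
      g ∈ StarSubalgebra.centralizer ℂ (π₀ '' {a | LocalizedIn Λ.sites a}) ↔
      ∀ a, LocalizedIn Λ.sites a → g * π₀ a = π₀ a * g := by
    intro g
    rw [StarSubalgebra.mem_centralizer_iff]
    constructor
    · intro h a ha
      exact (h _ ⟨a, ha, rfl⟩).1.symm
    · rintro h _ ⟨a, ha, rfl⟩
      refine ⟨(h a ha).symm, ?_⟩
      rw [← map_star]
      exact (h _ (star_mem ha)).symm
  rw [coneVN, StarSubalgebra.mem_centralizer_iff]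
  constructor
  · intro h g hg
    exact (h g ((hmem g).mpr hg)).1
  · intro h g hg
    have hg' := (hmem g).mp hg
    exact ⟨h g hg', h _ (hstar g hg')⟩

theorem rep_mem_coneVN {Λ : Cone} {a : QuasiLocal} (ha : LocalizedIn Λ.sites a) :
    π₀ a ∈ coneVN π₀ Λ := mem_coneVN_iff.mpr fun _ hg => hg a ha

theorem IsTransporter.mem_coneVN (hU : IsTransporter π₀ k t U) {Λ : Cone}
    (h : ∀ m, ∀ v ∈ (t m).support, v ∈ Λ.sites) : U ∈ coneVN π₀ Λ :=
  mem_coneVN_iff.mpr fun _ hg =>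
    hU.commute (Eventually.of_forall fun m => hg _ (E_localized k _ (h m)))

theorem IsTransporter.mul_star_self (hU : IsTransporter π₀ k t U) : U * star U = 1 :=
  (Unitary.mem_iff.mp hU.unitary).2

theorem IsTransporter.star_mul_self (hU : IsTransporter π₀ k t U) : star U * U = 1 :=
  (Unitary.mem_iff.mp hU.unitary).1

theorem eventually_sgn_const {ι : Type*} {l : Filter ι} [l.NeBot] {e : ι → ZMod 2} {z : ℂ}
    (h : Tendsto (fun i => sgn (e i)) l (𝓝 z)) : ∃ x, ∀ᶠ i in l, e i = x := by
  have h1 := h.eventually (Metric.ball_mem_nhds z one_pos)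
  obtain ⟨j, hj⟩ := h1.exists
  refine ⟨e j, ?_⟩
  filter_upwards [h1] with i hi
  by_contra hne
  have hd : dist (sgn (e i)) (sgn (e j)) = 2 := by
    rcases zmod_two_cases (e i) with h1 | h1 <;> rcases zmod_two_cases (e j) with h2 | h2 <;>
      rw [h1, h2] at hne ⊢ <;> first | exact absurd rfl hne | (rw [dist_eq_norm]; norm_num)
  have := dist_triangle_right (sgn (e i)) (sgn (e j)) z
  linarith

theorem norm_unitary_apply (hU : U ∈ unitary (H →L[ℂ] H)) (ξ : H) : ‖U ξ‖ = ‖ξ‖ := by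
  have h : inner ℂ (U ξ) (U ξ) = inner ℂ ξ ξ := by
    rw [← ContinuousLinearMap.adjoint_inner_right, ← ContinuousLinearMap.star_eq_adjoint,
      ← mul_apply_eq_comp, (Unitary.mem_iff.mp hU).1, one_apply_eq_self]
  rw [inner_self_eq_norm_sq_to_K, inner_self_eq_norm_sq_to_K] at h
  have h2 : ‖U ξ‖ ^ 2 = ‖ξ‖ ^ 2 := by exact_mod_cast h
  exact (sq_eq_sq₀ (norm_nonneg _) (norm_nonneg _)).mp h2

/-- The commutation signs of two convergent sequences of string operators converge jointly. -/
theorem IsTransporter.joint_sign (hv : IsVacuum π₀ Ω) (hU : IsTransporter π₀ k t U)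
    (hV : IsTransporter π₀ k' s V) :
    ∃ x, ∀ᶠ p : ℕ × ℕ in atTop ×ˢ atTop, kap k k' * pair (t p.1) (s p.2) = x := by
  set ξ : H := U (V Ω) with hξ
  have h1 : Tendsto (fun p : ℕ × ℕ => inner ℂ (π₀ (star (E k (t p.1))) ξ) (π₀ (E k' (s p.2)) Ω))
      (atTop ×ˢ atTop) (𝓝 (inner ℂ (star U ξ) (V Ω))) :=
    ((hU.lim_star ξ).comp tendsto_fst).inner ((hV.lim Ω).comp tendsto_snd)
  have h2 : Tendsto (fun p : ℕ × ℕ => inner ℂ (π₀ (star (E k' (s p.2))) ξ) (π₀ (E k (t p.1)) Ω))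
      (atTop ×ˢ atTop) (𝓝 (inner ℂ (star V ξ) (U Ω))) :=
    ((hV.lim_star ξ).comp tendsto_snd).inner ((hU.lim Ω).comp tendsto_fst)
  have hadj : ∀ (a b : QuasiLocal), inner ℂ (π₀ (star a) ξ) (π₀ b Ω)
      = inner ℂ ξ (π₀ (a * b) Ω) := by
    intro a b
    rw [map_star, ContinuousLinearMap.star_eq_adjoint, ContinuousLinearMap.adjoint_inner_left,
      map_mul, mul_apply_eq_comp]
  simp only [hadj] at h1 h2
  have h3 : ∀ p : ℕ × ℕ, inner ℂ ξ (π₀ (E k (t p.1) * E k' (s p.2)) Ω)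
      = sgn (kap k k' * pair (t p.1) (s p.2)) * inner ℂ ξ (π₀ (E k' (s p.2) * E k (t p.1)) Ω) := by
    intro p
    rw [E_comm, map_smul, smul_apply, inner_smul_right]
  have hlim1 : inner ℂ (star U ξ) (V Ω) ≠ 0 := by
    rw [hξ, ← mul_apply_eq_comp (star U), hU.star_mul_self, one_apply_eq_self, inner_self_ne_zero]
    intro h0
    have := norm_unitary_apply hV.unitary Ω
    rw [h0, norm_zero] at this
    exact hv.ne_zero (norm_eq_zero.mp this.symm)
  have hlim2 : inner ℂ (star V ξ) (U Ω) ≠ 0 := by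
    have e : ‖(inner ℂ (star V ξ) (U Ω) : ℂ)‖ = ‖(inner ℂ (star U ξ) (V Ω) : ℂ)‖ := by
      refine tendsto_nhds_unique h2.norm (h1.norm.congr fun p => ?_)
      rw [h3, norm_mul, norm_sgn, one_mul]
    intro h0
    rw [h0, norm_zero] at e
    exact hlim1 (norm_eq_zero.mp e.symm)
  have h4 := h1.div h2 hlim2
  refine eventually_sgn_const (h4.congr' ?_)
  filter_upwards [h2.eventually_ne hlim2] with p hp
  rw [Pi.div_apply, h3, mul_div_assoc, div_self hp, mul_one]

end Transport

/-! ## The density theorem for bicommutants -/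

section Density

variable {H : Type*} [NormedAddCommGroup H] [InnerProductSpace ℂ H] [CompleteSpace H]

/-- The diagonal action of an operator on a finite power of the Hilbert space. -/
def ampl (n : ℕ) (a : H →L[ℂ] H) :
    PiLp 2 (fun _ : Fin n => H) →L[ℂ] PiLp 2 (fun _ : Fin n => H) :=
  ((PiLp.continuousLinearEquiv 2 ℂ (fun _ : Fin n => H)).symm :
      (Fin n → H) →L[ℂ] PiLp 2 (fun _ : Fin n => H)) ∘L
    ContinuousLinearMap.pi fun i => a ∘L PiLp.proj 2 (fun _ : Fin n => H) i

theorem ampl_apply (n : ℕ) (a : H →L[ℂ] H) (x : PiLp 2 (fun _ : Fin n => H)) (i : Fin n) :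
    ampl n a x i = a (x i) := rfl

theorem inner_ampl (n : ℕ) (a : H →L[ℂ] H) (x y : PiLp 2 (fun _ : Fin n => H)) :
    inner ℂ (ampl n a x) y = inner ℂ x (ampl n (star a) y) := by
  simp only [PiLp.inner_apply, ampl_apply]
  refine Finset.sum_congr rfl fun i _ => ?_
  rw [ContinuousLinearMap.star_eq_adjoint, ContinuousLinearMap.adjoint_inner_right]

/-- The inclusion of a summand into a finite power of the Hilbert space. -/
def amplIncl (n : ℕ) (j : Fin n) : H →L[ℂ] PiLp 2 (fun _ : Fin n => H) :=
  ((PiLp.continuousLinearEquiv 2 ℂ (fun _ : Fin n => H)).symm :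
      (Fin n → H) →L[ℂ] PiLp 2 (fun _ : Fin n => H)) ∘L ContinuousLinearMap.single ℂ (fun _ => H) j

theorem ampl_incl (n : ℕ) (a : H →L[ℂ] H) (j : Fin n) (ξ : H) :
    ampl n a (amplIncl n j ξ) = amplIncl n j (a ξ) := by
  refine PiLp.ext fun i => ?_
  rw [ampl_apply]
  change a ((Pi.single j ξ : Fin n → H) i) = (Pi.single j (a ξ) : Fin n → H) i
  by_cases h : i = j
  · subst h; simp
  · simp [h]

theorem sum_incl (n : ℕ) (x : PiLp 2 (fun _ : Fin n => H)) : ∑ j, amplIncl n j (x j) = x := by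
  refine PiLp.ext fun i => ?_
  rw [WithLp.ofLp_sum, Finset.sum_apply, Finset.sum_eq_single i]
  · change (Pi.single i (x i) : Fin n → H) i = x i
    simp
  · intro j _ hj
    change (Pi.single j (x j) : Fin n → H) i = 0
    simp [hj.symm]
  · simp

theorem exists_near_of_bicommutant (M : StarSubalgebra ℂ (H →L[ℂ] H)) {T : H →L[ℂ] H}
    (hT : ∀ g : H →L[ℂ] H, (∀ a ∈ M, g * a = a * g) → g * T = T * g) (n : ℕ) (ξ : Fin n → H)
    {ε : ℝ} (hε : 0 < ε) : ∃ a ∈ M, ∀ i, ‖a (ξ i) - T (ξ i)‖ < ε := by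
  set x : PiLp 2 (fun _ : Fin n => H) := WithLp.toLp 2 ξ with hx
  let L : (H →L[ℂ] H) →ₗ[ℂ] PiLp 2 (fun _ : Fin n => H) :=
    { toFun := fun a => ampl n a x
      map_add' := fun a b => PiLp.ext fun i => rfl
      map_smul' := fun r a => PiLp.ext fun i => rfl }
  set S : Submodule ℂ (PiLp 2 (fun _ : Fin n => H)) :=
    (M.toSubalgebra.toSubmodule.map L).topologicalClosure with hS
  have hinv : ∀ a ∈ M, ∀ y ∈ S, ampl n a y ∈ S := by
    intro a ha y hy
    have hmaps : Set.MapsTo (ampl n a) (M.toSubalgebra.toSubmodule.map L : Set _)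
        (M.toSubalgebra.toSubmodule.map L : Set _) := by
      rintro _ ⟨b, hb, rfl⟩
      exact ⟨a * b, mul_mem (S := StarSubalgebra ℂ (H →L[ℂ] H)) ha hb, rfl⟩
    exact hmaps.closure (ampl n a).continuous hy
  have : CompleteSpace S := (Submodule.isClosed_topologicalClosure _).completeSpace_coe
  have hperp : ∀ a ∈ M, ∀ y ∈ Sᗮ, ampl n a y ∈ Sᗮ := by
    intro a ha y hy
    rw [Submodule.mem_orthogonal] at hy ⊢
    intro u hu
    have := hy (ampl n (star a) u) (hinv _ (star_mem ha) u hu)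
    rwa [inner_ampl, star_star] at this
  have hcomm : ∀ a ∈ M, ∀ y, S.starProjection (ampl n a y) = ampl n a (S.starProjection y) := by
    intro a ha y
    have h1 : y = S.starProjection y + (y - S.starProjection y) := by abel
    have h2 : y - S.starProjection y ∈ Sᗮ := Submodule.sub_starProjection_mem_orthogonal y
    have h3 : ampl n a y = ampl n a (S.starProjection y) + ampl n a (y - S.starProjection y) := by
      rw [← map_add, ← h1]
    rw [h3, map_add, (Submodule.starProjection_apply_eq_zero_iff S).mpr (hperp a ha _ h2), add_zero]
    exact Submodule.starProjection_eq_self_iff.mpr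
      (hinv a ha _ (Submodule.starProjection_apply_mem S y))
  let P : Fin n → Fin n → (H →L[ℂ] H) := fun i j =>
    PiLp.proj 2 (fun _ : Fin n => H) i ∘L S.starProjection ∘L amplIncl n j
  have hP : ∀ i j η, P i j η = S.starProjection (amplIncl n j η) i := fun i j η => rfl
  have hPM : ∀ i j, ∀ a ∈ M, P i j * a = a * P i j := by
    intro i j a ha
    refine ContinuousLinearMap.ext fun η => ?_
    rw [mul_apply_eq_comp, mul_apply_eq_comp, hP, hP, ← ampl_incl, hcomm a ha, ampl_apply]
  have hTP : ∀ y, S.starProjection (ampl n T y) = ampl n T (S.starProjection y) := by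
    intro y
    refine PiLp.ext fun i => ?_
    rw [ampl_apply]
    conv_lhs => rw [← sum_incl n y]
    conv_rhs => rw [← sum_incl n y]
    rw [map_sum, map_sum, map_sum, WithLp.ofLp_sum, WithLp.ofLp_sum, Finset.sum_apply,
      Finset.sum_apply, map_sum]
    refine Finset.sum_congr rfl fun j _ => ?_
    rw [ampl_incl, ← hP, ← hP, ← mul_apply_eq_comp, ← mul_apply_eq_comp, hT _ (hPM i j)]
  have hxS : x ∈ S := Submodule.le_topologicalClosure _ ⟨1, one_mem M.toSubalgebra, rfl⟩
  have hTx : ampl n T x ∈ S := by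
    rw [← Submodule.starProjection_eq_self_iff.mpr hxS, ← hTP]
    exact Submodule.starProjection_apply_mem S _
  obtain ⟨_, ⟨a, ha, rfl⟩, hd⟩ := Metric.mem_closure_iff.mp hTx ε hε
  refine ⟨a, ha, fun i => ?_⟩
  rw [dist_comm, dist_eq_norm] at hd
  exact (PiLp.norm_apply_le (L a - ampl n T x) i).trans_lt hd

end Density

/-! ## Limits of sequences of homomorphisms -/

section LimHom

variable {A B : Type*} [NormedRing A] [NormedAlgebra ℂ A] [StarRing A] [StarModule ℂ A]
  [NormedRing B] [NormedAlgebra ℂ B] [StarRing B] [StarModule ℂ B]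
  [ContinuousStar B] [ContinuousStar A]

/-- The elements on which a sequence of homomorphisms converges. -/
def convAlg (φ : ℕ → A →⋆ₐ[ℂ] B) : StarSubalgebra ℂ A where
  carrier := {a | ∃ b, Tendsto (fun n => φ n a) atTop (𝓝 b)}
  mul_mem' := fun ⟨b, hb⟩ ⟨b', hb'⟩ => ⟨b * b', by simpa using hb.mul hb'⟩
  add_mem' := fun ⟨b, hb⟩ ⟨b', hb'⟩ => ⟨b + b', by simpa using hb.add hb'⟩
  algebraMap_mem' := fun r => ⟨algebraMap ℂ B r, by simp [AlgHomClass.commutes]⟩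
  star_mem' := fun ⟨b, hb⟩ => ⟨star b, by simpa [map_star] using hb.star⟩

theorem isClosed_convAlg [CompleteSpace B] {φ : ℕ → A →⋆ₐ[ℂ] B} (hφ : ∀ n a, ‖φ n a‖ ≤ ‖a‖) :
    IsClosed (convAlg φ : Set A) := by
  refine isClosed_of_closure_subset fun a ha => ?_
  refine cauchySeq_tendsto_of_complete ?_
  rw [Metric.cauchySeq_iff]
  intro ε hε
  obtain ⟨b, ⟨c, hc⟩, hab⟩ := Metric.mem_closure_iff.mp ha (ε / 3) (by positivity)
  obtain ⟨N, hN⟩ := Metric.cauchySeq_iff.mp hc.cauchySeq (ε / 3) (by positivity)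
  have hd : ∀ n, dist (φ n a) (φ n b) ≤ dist a b := fun n => by
    rw [dist_eq_norm, dist_eq_norm, ← map_sub]; exact hφ n _
  refine ⟨N, fun m hm n hn => ?_⟩
  have h1 := hN m hm n hn
  have h2 := hd m
  have h3 := hd n
  have h4 := dist_triangle4 (φ m a) (φ m b) (φ n b) (φ n a)
  rw [dist_comm (φ n b)] at h4
  linarith

/-- The limit of a sequence of homomorphisms. -/
def limHom (φ : ℕ → A →⋆ₐ[ℂ] B) : convAlg φ →⋆ₐ[ℂ] B :=
  have key : ∀ a : convAlg φ, Tendsto (fun n => φ n a) atTop (𝓝 (limUnder atTop fun n => φ n a)) :=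
    fun a => tendsto_nhds_limUnder a.2
  { toFun := fun a => limUnder atTop fun n => φ n a
    map_one' := by simpa using tendsto_nhds_unique (key 1) (by simp)
    map_mul' := fun a b => tendsto_nhds_unique (key (a * b)) (by simpa using (key a).mul (key b))
    map_zero' := tendsto_nhds_unique (key 0) (by simp)
    map_add' := fun a b => tendsto_nhds_unique (key (a + b)) (by simpa using (key a).add (key b))
    commutes' := fun r => tendsto_nhds_unique (key (algebraMap ℂ _ r)) (by
      simp [AlgHomClass.commutes])
    map_star' := fun a => tendsto_nhds_unique (key (star a)) (by
      simpa [map_star] using (key a).star) }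

theorem tendsto_limHom (φ : ℕ → A →⋆ₐ[ℂ] B) (a : convAlg φ) :
    Tendsto (fun n => φ n a) atTop (𝓝 (limHom φ a)) := tendsto_nhds_limUnder a.2

end LimHom

/-! ## Extension of an endomorphism to the auxiliary algebra -/

section Extension

variable {H : Type*} [NormedAddCommGroup H] [InnerProductSpace ℂ H] [CompleteSpace H]
  {π₀ : QuasiLocal →⋆ₐ[ℂ] (H →L[ℂ] H)} {Λ₀ : Cone}

theorem coneVN_le_auxAlg (x : ℤ × ℤ) : coneVN π₀ (Λ₀.translate x) ≤ auxAlg π₀ Λ₀ :=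
  (le_iSup (fun x => coneVN π₀ (Λ₀.translate x)) x).trans (StarSubalgebra.le_topologicalClosure _)

/-- The image of the algebra of a cone in a representation. -/
def repAlg (π₀ : QuasiLocal →⋆ₐ[ℂ] (H →L[ℂ] H)) (Λ : Cone) : StarSubalgebra ℂ (H →L[ℂ] H) :=
  ((regionAlg Λ.sites).comap (regionAlg Set.univ).subtype).map π₀

theorem mem_repAlg {Λ : Cone} {T : H →L[ℂ] H} :
    T ∈ repAlg π₀ Λ ↔ ∃ a, LocalizedIn Λ.sites a ∧ π₀ a = T := Iff.rfl

theorem IsExtension.eq_conj {ρ : QuasiLocal → QuasiLocal} {ρbar : auxAlg π₀ Λ₀ →⋆ₐ[ℂ] (H →L[ℂ] H)}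
    (h : IsExtension π₀ Λ₀ ρ ρbar) {x : ℤ × ℤ} {V : H →L[ℂ] H}
    (hV : ∀ a, LocalizedIn (Λ₀.translate x).sites a → star V * π₀ a * V = π₀ (ρ a))
    (T : auxAlg π₀ Λ₀) (hT : (T : H →L[ℂ] H) ∈ coneVN π₀ (Λ₀.translate x)) :
    ρbar T = star V * T * V := by
  classical
  have happ : ∀ p : Finset H × ℕ, ∃ a, LocalizedIn (Λ₀.translate x).sites a ∧
      ∀ ξ ∈ p.1, ‖π₀ a ξ - (T : H →L[ℂ] H) ξ‖ < 1 / ((p.2 : ℝ) + 1) := by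
    rintro ⟨F, n⟩
    obtain ⟨_, ⟨a, ha, rfl⟩, hb⟩ := exists_near_of_bicommutant (repAlg π₀ (Λ₀.translate x))
      (T := (T : H →L[ℂ] H))
      (fun g hg => mem_coneVN_iff.mp hT g fun a ha => hg _ (mem_repAlg.mpr ⟨a, ha, rfl⟩)) F.card
      (fun i => (F.equivFin.symm i : H)) (Nat.one_div_pos_of_nat (n := n) (α := ℝ))
    refine ⟨a, ha, fun ξ hξ => ?_⟩
    have := hb (F.equivFin ⟨ξ, hξ⟩)
    simpa using this
  choose a ha hnear using happ
  let S : Finset H × ℕ → auxAlg π₀ Λ₀ := fun p =>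
    ⟨π₀ (a p), coneVN_le_auxAlg x (rep_mem_coneVN (ha p))⟩
  have hlim : ∀ ξ : H, Tendsto (fun p => π₀ (a p) ξ) atTop (𝓝 ((T : H →L[ℂ] H) ξ)) := by
    intro ξ
    rw [Metric.tendsto_atTop]
    intro ε hε
    obtain ⟨n, hn⟩ := exists_nat_one_div_lt hε
    refine ⟨({ξ}, n), fun p hp => ?_⟩
    rw [dist_eq_norm]
    refine (hnear p ξ (hp.1 (by simp))).trans (lt_of_le_of_lt ?_ hn)
    have : (n : ℝ) ≤ p.2 := by exact_mod_cast hp.2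
    exact one_div_le_one_div_of_le (by positivity) (by linarith)
  refine ContinuousLinearMap.ext fun η => ext_inner_left ℂ fun ξ => ?_
  have h1 := h.weak_continuous x (map S atTop) T hT
    (by rw [eventually_map]; exact Eventually.of_forall fun p => rep_mem_coneVN (ha p))
    (fun ξ η => by
      rw [tendsto_map'_iff]
      exact tendsto_const_nhds.inner (hlim η)) ξ η
  rw [tendsto_map'_iff] at h1
  refine tendsto_nhds_unique h1 ?_
  have h2 : ∀ p, ρbar (S p) = star V * π₀ (a p) * V := fun p => by
    rw [hV _ (ha p)]; exact h.extends_endo _ _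
  have h3 : Tendsto (fun p => inner ℂ (V ξ) (π₀ (a p) (V η))) atTop
      (𝓝 (inner ℂ (V ξ) ((T : H →L[ℂ] H) (V η)))) := tendsto_const_nhds.inner (hlim (V η))
  have h4 : ∀ Q : H →L[ℂ] H, inner ℂ ξ ((star V * Q * V) η) = inner ℂ (V ξ) (Q (V η)) := by
    intro Q
    rw [mul_apply_eq_comp, mul_apply_eq_comp, ContinuousLinearMap.star_eq_adjoint,
      ContinuousLinearMap.adjoint_inner_right]
  rw [h4]
  refine h3.congr fun p => ?_
  rw [Function.comp_apply, h2, h4]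

theorem exists_extension {ρ : QuasiLocal → QuasiLocal}
    {y : ℕ → ℤ × ℤ} {V : ℕ → H →L[ℂ] H}
    (hρ : ∀ a b, ‖ρ a - ρ b‖ ≤ ‖a - b‖)
    (hy : ∀ x, ∀ᶠ n in atTop, (Λ₀.translate x).sites ⊆ (Λ₀.translate (y n)).sites)
    (hfin : ∀ F : Finset Vertex, ∀ᶠ n in atTop, (F : Set Vertex) ⊆ (Λ₀.translate (y n)).sites)
    (hu : ∀ n, V n ∈ unitary (H →L[ℂ] H))
    (hV : ∀ n a, LocalizedIn (Λ₀.translate (y n)).sites a → star (V n) * π₀ a * V n = π₀ (ρ a)) :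
    ∃ ρbar, IsExtension π₀ Λ₀ ρ ρbar := by
  let φ : ℕ → (H →L[ℂ] H) →⋆ₐ[ℂ] (H →L[ℂ] H) := fun n =>
    { toFun := fun T => star (V n) * T * V n
      map_one' := by rw [mul_one]; exact (Unitary.mem_iff.mp (hu n)).1
      map_mul' := fun S T => by
        have : star (V n) * (S * T) * V n = star (V n) * S * (V n * star (V n)) * T * V n := by
          rw [(Unitary.mem_iff.mp (hu n)).2]; simp only [mul_assoc, one_mul]
        rw [this]; simp only [mul_assoc]
      map_zero' := by simp
      map_add' := fun S T => by rw [mul_add, add_mul]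
      commutes' := fun r => by
        rw [Algebra.algebraMap_eq_smul_one, mul_smul_comm, smul_mul_assoc, mul_one,
          (Unitary.mem_iff.mp (hu n)).1]
      map_star' := fun T => by simp only [star_mul, star_star, mul_assoc] }
  have hφ : ∀ n T, φ n T = star (V n) * T * V n := fun _ _ => rfl
  have hn : ∀ n T, ‖φ n T‖ ≤ ‖T‖ := fun n T => by
    rw [hφ, CStarRing.norm_mul_mem_unitary _ (hu n),
      CStarRing.norm_mem_unitary_mul _ (Unitary.star_mem (hu n))]
  have hconst : ∀ x, ∃ N, ∀ n ≥ N, ∀ T ∈ coneVN π₀ (Λ₀.translate x), φ n T = φ N T := by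
    intro x
    obtain ⟨N, hN⟩ := eventually_atTop.mp (hy x)
    refine ⟨N, fun n hnN T hT => ?_⟩
    have hun := Unitary.mem_iff.mp (hu n)
    have huN := Unitary.mem_iff.mp (hu N)
    have hg : (V n * star (V N)) * T = T * (V n * star (V N)) := by
      refine mem_coneVN_iff.mp hT _ fun a ha => ?_
      have h1 := hV n a (regionAlg_mono (hN n hnN) ha)
      have h2 := hV N a (regionAlg_mono (hN N le_rfl) ha)
      calc V n * star (V N) * π₀ a = V n * (star (V N) * π₀ a * V N) * star (V N) := by
            simp only [mul_assoc, huN.2, mul_one]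
        _ = V n * (star (V n) * π₀ a * V n) * star (V N) := by rw [h1, h2]
        _ = (V n * star (V n)) * π₀ a * (V n * star (V N)) := by simp only [mul_assoc]
        _ = _ := by rw [hun.2, one_mul]
    calc φ n T = star (V n) * (T * (V n * star (V N))) * V N := by
          rw [hφ]; simp only [mul_assoc, huN.1, mul_one]
      _ = star (V n) * ((V n * star (V N)) * T) * V N := by rw [hg]
      _ = (star (V n) * V n) * (star (V N) * T * V N) := by simp only [mul_assoc]
      _ = φ N T := by rw [hun.1, one_mul, hφ]
  have hle : auxAlg π₀ Λ₀ ≤ convAlg φ := by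
    refine StarSubalgebra.topologicalClosure_minimal (iSup_le fun x T hT => ?_)
      (isClosed_convAlg hn)
    obtain ⟨N, hN⟩ := hconst x
    exact ⟨φ N T, tendsto_const_nhds.congr' (by
      filter_upwards [eventually_ge_atTop N] with n hnN
      rw [hN n hnN T hT])⟩
  refine ⟨(limHom φ).comp (StarSubalgebra.inclusion hle), ?_, ?_⟩
  · intro a h
    have h1 : Tendsto (fun n => φ n (π₀ a)) atTop (𝓝 (limHom φ ⟨π₀ a, hle h⟩)) :=
      tendsto_limHom φ ⟨π₀ a, hle h⟩
    refine tendsto_nhds_unique h1 ?_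
    rw [Metric.tendsto_nhds]
    intro ε hε
    obtain ⟨F, b, hb, hab⟩ := exists_local_near a (half_pos hε)
    filter_upwards [hfin F] with n hnF
    have e1 := hV n b (regionAlg_mono hnF hb)
    have e2 : φ n (π₀ a) - π₀ (ρ a) = φ n (π₀ (a - b)) + π₀ (ρ b - ρ a) := by
      rw [map_sub π₀, map_sub (φ n), map_sub π₀, hφ n (π₀ b), e1]; abel
    rw [dist_eq_norm, e2]
    calc _ ≤ ‖φ n (π₀ (a - b))‖ + ‖π₀ (ρ b - ρ a)‖ := norm_add_le _ _
      _ ≤ ‖a - b‖ + ‖a - b‖ := by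
        refine add_le_add ((hn n _).trans (norm_rep_le _)) ((norm_rep_le _).trans ?_)
        rw [norm_sub_rev a b]; exact hρ b a
      _ < ε := by linarith
  · intro x l T hT hl hw ξ η
    obtain ⟨N, hN⟩ := hconst x
    have hval : ∀ S : auxAlg π₀ Λ₀, (S : H →L[ℂ] H) ∈ coneVN π₀ (Λ₀.translate x) →
        ((limHom φ).comp (StarSubalgebra.inclusion hle)) S = star (V N) * S * V N := by
      intro S hS
      refine tendsto_nhds_unique (tendsto_limHom φ ⟨S, hle S.2⟩) ?_
      refine tendsto_const_nhds.congr' ?_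
      filter_upwards [eventually_ge_atTop N] with n hnN
      exact (hN n hnN S hS).symm
    have h4 : ∀ Q : H →L[ℂ] H, inner ℂ ξ ((star (V N) * Q * V N) η)
        = inner ℂ (V N ξ) (Q (V N η)) := by
      intro Q
      rw [mul_apply_eq_comp, mul_apply_eq_comp, ContinuousLinearMap.star_eq_adjoint,
        ContinuousLinearMap.adjoint_inner_right]
    rw [hval T hT, h4]
    refine (hw (V N ξ) (V N η)).congr' ?_
    filter_upwards [hl] with S hS
    rw [hval S hS, h4]

/-- The extension acts on a charge transporter by the limit of the commutation signs. -/
theorem IsExtension.transporter {k k' : Pauli} {τ : Config}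
    {ρbar : auxAlg π₀ Λ₀ →⋆ₐ[ℂ] (H →L[ℂ] H)}
    (h : IsExtension π₀ Λ₀ (autE k τ) ρbar) {t : ℕ → Chain} {U : auxAlg π₀ Λ₀}
    (hU : IsTransporter π₀ k' t U) {x : ℤ × ℤ}
    (ht : ∀ m, ∀ v ∈ (t m).support, v ∈ (Λ₀.translate x).sites) {e : ZMod 2}
    (he : ∀ᶠ m in atTop, kap k k' * pair τ (t m) = e) : ρbar U = sgn e • (U : H →L[ℂ] H) := by
  let S : ℕ → auxAlg π₀ Λ₀ := fun m =>
    ⟨π₀ (E k' (t m)), coneVN_le_auxAlg x (rep_mem_coneVN (E_localized k' _ (ht m)))⟩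
  refine ContinuousLinearMap.ext fun η => ext_inner_left ℂ fun ξ => ?_
  have h1 := h.weak_continuous x (map S atTop) U (hU.mem_coneVN ht)
    (by
      rw [eventually_map]
      exact Eventually.of_forall fun m => rep_mem_coneVN (E_localized k' _ (ht m)))
    (fun ξ η => by
      rw [tendsto_map'_iff]
      exact tendsto_const_nhds.inner (hU.lim η)) ξ η
  rw [tendsto_map'_iff] at h1
  refine tendsto_nhds_unique h1 ?_
  have h2 : Tendsto (fun m => sgn e * inner ℂ ξ (π₀ (E k' (t m)) η)) atTop
      (𝓝 (sgn e * inner ℂ ξ ((U : H →L[ℂ] H) η))) :=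
    (tendsto_const_nhds.inner (hU.lim η)).const_mul _
  rw [smul_apply, inner_smul_right]
  refine h2.congr' ?_
  filter_upwards [he] with m hm
  have h3 : ρbar (S m) = sgn e • π₀ (E k' (t m)) := by
    rw [← hm, ← map_smul, ← autE_E]
    exact h.extends_endo _ _
  rw [Function.comp_apply, h3, smul_apply, inner_smul_right]

end Extension

theorem norm_autE_sub_le (k : Pauli) (τ : Config) (a b : QuasiLocal) :
    ‖autE k τ a - autE k τ b‖ ≤ ‖a - b‖ := by
  have h := ((tendsto_autE_restrict k τ a).sub (tendsto_autE_restrict k τ b)).norm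
  refine le_of_tendsto h (Eventually.of_forall fun F => ?_)
  rw [← conjE_sub]
  exact norm_conjE_le _ _ _

/-! ## Plane geometry of cones -/

/-- The cone with apex `q`, direction `φ` and half-opening angle `h`, in the complex plane. -/
def cone (q : ℂ) (φ h : ℝ) : Set ℂ :=
  {z | ‖z - q‖ * Real.cos h < ((z - q) * Complex.exp (-φ * Complex.I)).re}

/-- Polar coordinates around `b`. -/
def pol (b : ℂ) (r A : ℝ) : ℂ := b + r * Complex.exp (A * Complex.I)

def toC (p : ℝ × ℝ) : ℂ := ⟨p.1, p.2⟩

def pos (v : Vertex) : ℂ := ⟨v.1, v.2⟩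

def Face.center (f : Face) : ℂ := ⟨f.x + 1, f.y + 1 / 2⟩

theorem exp_neg_I (φ : ℝ) :
    Complex.exp (-φ * Complex.I) = ⟨Real.cos φ, -Real.sin φ⟩ := by
  apply Complex.ext
  · rw [← Complex.ofReal_neg, Complex.exp_ofReal_mul_I_re, Real.cos_neg]
  · rw [← Complex.ofReal_neg, Complex.exp_ofReal_mul_I_im, Real.sin_neg]

theorem mem_region_iff (Λ : Cone) (p : ℝ × ℝ) :
    p ∈ Λ.region ↔ toC p ∈ cone (toC Λ.apex) Λ.axis Λ.half := by
  have h1 : Real.sqrt ((p.1 - Λ.apex.1) ^ 2 + (p.2 - Λ.apex.2) ^ 2) = ‖toC p - toC Λ.apex‖ := by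
    rw [Complex.norm_def, Complex.normSq_apply]
    simp [toC, sq]
  rw [Cone.region, cone, Set.mem_ofPred_eq, Set.mem_ofPred_eq, h1, exp_neg_I, Complex.mul_re]
  simp [toC]

theorem mem_sites_iff (Λ : Cone) (v : Vertex) :
    v ∈ Λ.sites ↔ pos v ∈ cone (toC Λ.apex) Λ.axis Λ.half := mem_region_iff Λ _

theorem region_subset_iff (Λ Λ' : Cone) : Λ.region ⊆ Λ'.region ↔
    cone (toC Λ.apex) Λ.axis Λ.half ⊆ cone (toC Λ'.apex) Λ'.axis Λ'.half := by
  constructor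
  · intro h z hz
    exact (mem_region_iff Λ' (z.re, z.im)).mp (h ((mem_region_iff Λ (z.re, z.im)).mpr hz))
  · intro h p hp
    exact (mem_region_iff Λ' p).mpr (h ((mem_region_iff Λ p).mp hp))

theorem region_disjoint_iff (Λ Λ' : Cone) : Disjoint Λ.region Λ'.region ↔
    Disjoint (cone (toC Λ.apex) Λ.axis Λ.half) (cone (toC Λ'.apex) Λ'.axis Λ'.half) := by
  rw [Set.disjoint_left, Set.disjoint_left]
  constructor
  · intro h z hz hz'
    exact h ((mem_region_iff Λ (z.re, z.im)).mpr hz) ((mem_region_iff Λ' (z.re, z.im)).mpr hz')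
  · intro h p hp hp'
    exact h ((mem_region_iff Λ p).mp hp) ((mem_region_iff Λ' p).mp hp')

theorem sites_subset {Λ Λ' : Cone} (h : Λ.region ⊆ Λ'.region) : Λ.sites ⊆ Λ'.sites :=
  fun _ hv => h hv

theorem cone_add_two_pi (q : ℂ) (φ h : ℝ) (k : ℤ) :
    cone q (φ + 2 * Real.pi * k) h = cone q φ h := by
  have : Complex.exp (-((φ + 2 * Real.pi * k : ℝ) : ℂ) * Complex.I)
      = Complex.exp (-φ * Complex.I) := by
    rw [exp_neg_I, exp_neg_I, mul_comm (2 * Real.pi) (k : ℝ), Real.cos_add_int_mul_two_pi,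
      Real.sin_add_int_mul_two_pi]
  rw [cone, cone, this]

theorem norm_pol_sub (b : ℂ) {r : ℝ} (hr : 0 ≤ r) (A : ℝ) : ‖pol b r A - b‖ = r := by
  rw [pol, add_sub_cancel_left, norm_mul, Complex.norm_exp_ofReal_mul_I, mul_one,
    Complex.norm_real, Real.norm_of_nonneg hr]

theorem pol_sub_mul (b : ℂ) (r A φ : ℝ) : ((pol b r A - b) * Complex.exp (-φ * Complex.I)).re
    = r * Real.cos (A - φ) := by
  have h : (pol b r A - b) * Complex.exp (-φ * Complex.I)
      = (r : ℂ) * Complex.exp (((A - φ : ℝ) : ℂ) * Complex.I) := by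
    rw [pol, add_sub_cancel_left, mul_assoc, ← Complex.exp_add]
    congr 2
    push_cast; ring
  rw [h, Complex.re_ofReal_mul, Complex.exp_ofReal_mul_I_re]

theorem pol_mem_cone {q : ℂ} {φ h r A : ℝ} (hr : 0 < r) :
    pol q r A ∈ cone q φ h ↔ Real.cos h < Real.cos (A - φ) := by
  rw [cone, Set.mem_ofPred_eq, norm_pol_sub q hr.le, pol_sub_mul, mul_lt_mul_iff_right₀ hr]

theorem exists_pol (q z : ℂ) : ∃ A, z = pol q ‖z - q‖ A :=
  ⟨Complex.arg (z - q), by rw [pol, Complex.norm_mul_exp_arg_mul_I]; ring⟩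

theorem pol_add_two_pi (b : ℂ) (r A : ℝ) (k : ℤ) : pol b r (A + 2 * Real.pi * k) = pol b r A := by
  rw [pol, pol]
  congr 2
  rw [Complex.exp_eq_exp_iff_exists_int]
  exact ⟨k, by push_cast; ring⟩

theorem exists_near_lift (B : ℝ) : ∃ k : ℤ, |B + 2 * Real.pi * k| ≤ Real.pi := by
  have hp := Real.pi_pos
  refine ⟨-round (B / (2 * Real.pi)), ?_⟩
  have h := abs_sub_round (B / (2 * Real.pi))
  have e : B + 2 * Real.pi * ((-round (B / (2 * Real.pi)) : ℤ) : ℝ)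
      = (2 * Real.pi) * (B / (2 * Real.pi) - round (B / (2 * Real.pi))) := by
    push_cast; field_simp; ring
  rw [e, abs_mul, abs_of_pos (by positivity)]
  nlinarith

theorem abs_lt_of_cos_lt {B h : ℝ} (hB : |B| ≤ Real.pi) (h0 : 0 ≤ h)
    (hc : Real.cos h < Real.cos B) : |B| < h := by
  by_contra! hle
  rw [← Real.cos_abs B] at hc
  exact absurd (Real.cos_le_cos_of_nonneg_of_le_pi h0 hB hle) (not_le.mpr hc)

theorem cos_lt_of_abs_lt {B h : ℝ} (hB : |B| < h) (h1 : h ≤ Real.pi) :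
    Real.cos h < Real.cos B := by
  rw [← Real.cos_abs B]
  exact Real.cos_lt_cos_of_nonneg_of_le_pi (abs_nonneg B) h1 hB

theorem exists_lift_of_cos_lt {B h : ℝ} (h0 : 0 ≤ h) (hc : Real.cos h < Real.cos B) :
    ∃ k : ℤ, |B + 2 * Real.pi * k| < h := by
  obtain ⟨k, hk⟩ := exists_near_lift B
  refine ⟨k, abs_lt_of_cos_lt hk h0 ?_⟩
  rwa [mul_comm (2 * Real.pi) (k : ℝ), Real.cos_add_int_mul_two_pi]

theorem cos_lt_of_between {B h : ℝ} (h0 : 0 ≤ h) (h1 : h < B)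
    (h2 : B < 2 * Real.pi - h) : Real.cos B < Real.cos h := by
  rcases le_total B Real.pi with hB | hB
  · exact Real.cos_lt_cos_of_nonneg_of_le_pi h0 hB h1
  · rw [← Real.cos_two_pi_sub B]
    exact Real.cos_lt_cos_of_nonneg_of_le_pi h0 (by linarith) (by linarith)

/-- The points of a cone are the points in polar coordinates with angle close to the axis. -/
theorem mem_cone_iff {q z : ℂ} {φ h : ℝ} (h0 : 0 < h) (h1 : h < Real.pi) :
    z ∈ cone q φ h ↔ ∃ r A, 0 < r ∧ |A - φ| < h ∧ z = pol q r A := by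
  constructor
  · intro hz
    obtain ⟨A, hA⟩ := exists_pol q z
    have hr : 0 < ‖z - q‖ := by
      rcases (norm_nonneg (z - q)).lt_or_eq with hr | hr
      · exact hr
      · have : z - q = 0 := norm_eq_zero.mp hr.symm
        rw [cone, Set.mem_ofPred_eq, this] at hz
        simp at hz
    have hc : Real.cos h < Real.cos (A - φ) := by
      rw [← pol_mem_cone hr, ← hA]; exact hz
    obtain ⟨k, hk⟩ := exists_lift_of_cos_lt h0.le hc
    refine ⟨‖z - q‖, A + 2 * Real.pi * k, hr, by rwa [add_sub_right_comm], ?_⟩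
    rw [pol_add_two_pi, ← hA]
  · rintro ⟨r, A, hr, hA, rfl⟩
    rw [pol_mem_cone hr]
    exact cos_lt_of_abs_lt hA h1.le

theorem cone_subset_cone {q : ℂ} {φ h κ θ : ℝ} (h0 : 0 < h) (hθ : θ < Real.pi)
    (hle : |φ - κ| + h ≤ θ) : cone q φ h ⊆ cone q κ θ := by
  have h1 : h ≤ θ := by linarith [abs_nonneg (φ - κ)]
  intro z hz
  obtain ⟨r, A, hr, hA, rfl⟩ := (mem_cone_iff h0 (h1.trans_lt hθ)).mp hz
  rw [mem_cone_iff (h0.trans_le h1) hθ]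
  refine ⟨r, A, hr, ?_, rfl⟩
  have := abs_add_le (A - φ) (φ - κ)
  rw [sub_add_sub_cancel] at this
  linarith

/-! ### Asymptotics -/

theorem norm_exp_neg (φ : ℝ) : ‖Complex.exp (-φ * Complex.I)‖ = 1 := by
  rw [← Complex.ofReal_neg, Complex.norm_exp_ofReal_mul_I]

theorem abs_re_mul_exp_le (z : ℂ) (φ : ℝ) : |(z * Complex.exp (-φ * Complex.I)).re| ≤ ‖z‖ := by
  refine (Complex.abs_re_le_norm _).trans ?_
  rw [norm_mul, norm_exp_neg, mul_one]

theorem near_pol_bounds {b q w : ℂ} {r A D : ℝ} (φ : ℝ) (hr : 0 ≤ r) (hw : ‖w - pol b r A‖ ≤ D) :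
    |((w - q) * Complex.exp (-φ * Complex.I)).re - r * Real.cos (A - φ)| ≤ D + ‖b - q‖ ∧
    |‖w - q‖ - r| ≤ D + ‖b - q‖ := by
  have e : w - q = (pol b r A - b) + ((w - pol b r A) + (b - q)) := by ring
  have hn : ‖(w - pol b r A) + (b - q)‖ ≤ D + ‖b - q‖ :=
    (norm_add_le _ _).trans (by gcongr)
  constructor
  · rw [e, add_mul, Complex.add_re, pol_sub_mul, add_sub_cancel_left]
    exact (abs_re_mul_exp_le _ _).trans hn
  · have h1 := abs_norm_sub_norm_le (w - q) (pol b r A - b)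
    rw [norm_pol_sub b hr] at h1
    refine h1.trans ?_
    have : w - q - (pol b r A - b) = (w - pol b r A) + (b - q) := by ring
    rw [this]; exact hn

theorem near_pol_mem {b q w : ℂ} {r A D φ h : ℝ} (hr : 0 ≤ r) (hw : ‖w - pol b r A‖ ≤ D)
    (hc : r * Real.cos h + 2 * (D + ‖b - q‖) < r * Real.cos (A - φ)) : w ∈ cone q φ h := by
  obtain ⟨h1, h2⟩ := near_pol_bounds (q := q) φ hr hw
  rw [abs_le] at h1 h2
  have hD : 0 ≤ D + ‖b - q‖ := add_nonneg ((norm_nonneg _).trans hw) (norm_nonneg _)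
  have h3 : ‖w - q‖ * Real.cos h ≤ r * Real.cos h + (D + ‖b - q‖) := by
    nlinarith [Real.cos_le_one h, Real.neg_one_le_cos h]
  rw [cone, Set.mem_ofPred_eq]
  linarith

theorem near_pol_of_mem {b q w : ℂ} {r A D φ h : ℝ} (hr : 0 ≤ r) (hw : ‖w - pol b r A‖ ≤ D)
    (hm : w ∈ cone q φ h) : r * Real.cos h < r * Real.cos (A - φ) + 2 * (D + ‖b - q‖) := by
  obtain ⟨h1, h2⟩ := near_pol_bounds (q := q) φ hr hw
  rw [abs_le] at h1 h2
  have hD : 0 ≤ D + ‖b - q‖ := add_nonneg ((norm_nonneg _).trans hw) (norm_nonneg _)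
  have h3 : r * Real.cos h - (D + ‖b - q‖) ≤ ‖w - q‖ * Real.cos h := by
    nlinarith [Real.cos_le_one h, Real.neg_one_le_cos h]
  rw [cone, Set.mem_ofPred_eq] at hm
  linarith

theorem exists_gap {f : ℝ → ℝ} (hf : Continuous f) {a₁ a₂ : ℝ}
    (h : ∀ A, a₁ ≤ A → A ≤ a₂ → 0 < f A) : ∃ g > 0, ∀ A, a₁ ≤ A → A ≤ a₂ → g ≤ f A := by
  rcases le_or_gt a₁ a₂ with hle | hlt
  · obtain ⟨A₀, hA₀, hmin⟩ := isCompact_Icc.exists_isMinOn (Set.nonempty_Icc.mpr hle)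
      hf.continuousOn
    exact ⟨f A₀, h A₀ hA₀.1 hA₀.2, fun A h1 h2 => hmin ⟨h1, h2⟩⟩
  · exact ⟨1, one_pos, fun A h1 h2 => absurd (h1.trans h2) (not_le.mpr hlt)⟩

theorem far_sector_subset {φ h a₁ a₂ : ℝ} (b q : ℂ) (D : ℝ)
    (hc : ∀ A, a₁ ≤ A → A ≤ a₂ → Real.cos h < Real.cos (A - φ)) :
    ∃ R, 0 ≤ R ∧ ∀ r A w, R < r → a₁ ≤ A → A ≤ a₂ → ‖w - pol b r A‖ ≤ D → w ∈ cone q φ h := by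
  obtain ⟨g, hg, hgap⟩ := exists_gap (f := fun A => Real.cos (A - φ) - Real.cos h) (by fun_prop)
    (fun A h1 h2 => sub_pos.mpr (hc A h1 h2))
  refine ⟨max 0 (2 * (D + ‖b - q‖) / g), le_max_left _ _, fun r A w hr h1 h2 hw => ?_⟩
  have hr0 : 0 ≤ r := (le_max_left _ _).trans hr.le
  have hr1 : 2 * (D + ‖b - q‖) / g < r := (le_max_right _ _).trans_lt hr
  refine near_pol_mem hr0 hw ?_
  rw [div_lt_iff₀ hg] at hr1
  have := hgap A h1 h2
  nlinarith

theorem far_sector_disjoint {φ h a₁ a₂ : ℝ} (b q : ℂ) (D : ℝ)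
    (hc : ∀ A, a₁ ≤ A → A ≤ a₂ → Real.cos (A - φ) < Real.cos h) :
    ∃ R, 0 ≤ R ∧ ∀ r A w, R < r → a₁ ≤ A → A ≤ a₂ → ‖w - pol b r A‖ ≤ D → w ∉ cone q φ h := by
  obtain ⟨g, hg, hgap⟩ := exists_gap (f := fun A => Real.cos h - Real.cos (A - φ)) (by fun_prop)
    (fun A h1 h2 => sub_pos.mpr (hc A h1 h2))
  refine ⟨max 0 (2 * (D + ‖b - q‖) / g), le_max_left _ _, fun r A w hr h1 h2 hw hm => ?_⟩
  have hr0 : 0 ≤ r := (le_max_left _ _).trans hr.le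
  have hr1 : 2 * (D + ‖b - q‖) / g < r := (le_max_right _ _).trans_lt hr
  have h3 := near_pol_of_mem hr0 hw hm
  rw [div_lt_iff₀ hg] at hr1
  have := hgap A h1 h2
  nlinarith

theorem cone_shift {q q' z : ℂ} {φ h : ℝ} (hz : z ∈ cone q φ h)
    (hq : ‖q - q'‖ * |Real.cos h| ≤ ((q - q') * Complex.exp (-φ * Complex.I)).re) :
    z ∈ cone q' φ h := by
  rw [cone, Set.mem_ofPred_eq] at hz ⊢
  have e : z - q' = (z - q) + (q - q') := by ring
  have h1 : ‖z - q'‖ * Real.cos h ≤ ‖z - q‖ * Real.cos h + ‖q - q'‖ * |Real.cos h| := by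
    have h2 : ‖z - q'‖ ≤ ‖z - q‖ + ‖q - q'‖ := by rw [e]; exact norm_add_le _ _
    have h3 : ‖z - q‖ ≤ ‖z - q'‖ + ‖q - q'‖ := by
      have : z - q = (z - q') - (q - q') := by ring
      rw [this]; exact norm_sub_le _ _
    rcases le_total 0 (Real.cos h) with hc | hc
    · rw [abs_of_nonneg hc]; nlinarith
    · rw [abs_of_nonpos hc]; nlinarith
  rw [e] at h1 ⊢
  rw [add_mul, Complex.add_re]
  linarith

theorem exp_mul_exp_neg (φ : ℝ) :
    Complex.exp (φ * Complex.I) * Complex.exp (-φ * Complex.I) = 1 := by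
  rw [← Complex.exp_add]; simp

/-- Moving the apex far back along the axis enlarges the cone by more than a bounded amount. -/
theorem exists_shift {h : ℝ} (φ : ℝ) (h0 : 0 < h) (h1 : h < Real.pi) (C : ℝ) :
    ∃ L₀, 0 ≤ L₀ ∧ ∀ L ≥ L₀, ∀ q q' z z' : ℂ, ‖q' - pol q (-L) φ‖ ≤ C → ‖z' - z‖ ≤ C →
      z ∈ cone q φ h → z' ∈ cone q' φ h := by
  have hcos : |Real.cos h| < 1 := by
    rw [abs_lt]
    constructor
    · have := Real.cos_lt_cos_of_nonneg_of_le_pi h0.le le_rfl h1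
      rwa [Real.cos_pi] at this
    · have := Real.cos_lt_cos_of_nonneg_of_le_pi le_rfl h1.le h0
      rwa [Real.cos_zero] at this
  set c := |Real.cos h| with hc
  refine ⟨max 0 (4 * C / (1 - c)), le_max_left _ _, fun L hL q q' z z' hq hz hmem => ?_⟩
  have hL0 : 0 ≤ L := (le_max_left _ _).trans hL
  have hL1 : 4 * C / (1 - c) ≤ L := (le_max_right _ _).trans hL
  rw [div_le_iff₀ (by linarith)] at hL1
  have hmem' : z' ∈ cone (q + (z' - z)) φ h := by
    rw [cone, Set.mem_ofPred_eq] at hmem ⊢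
    have : z' - (q + (z' - z)) = z - q := by ring
    rwa [this]
  refine cone_shift hmem' ?_
  set u : ℂ := (z' - z) - (q' - pol q (-L) φ) with hu
  have hun : ‖u‖ ≤ 2 * C := by
    refine (norm_sub_le _ _).trans ?_; linarith
  have e : q + (z' - z) - q' = (L : ℂ) * Complex.exp (φ * Complex.I) + u := by
    rw [hu, pol]; push_cast; ring
  have hn : ‖q + (z' - z) - q'‖ ≤ L + 2 * C := by
    rw [e]
    refine (norm_add_le _ _).trans ?_
    rw [norm_mul, Complex.norm_exp_ofReal_mul_I, mul_one, Complex.norm_real,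
      Real.norm_of_nonneg hL0]
    linarith
  have hre : L - 2 * C ≤ ((q + (z' - z) - q') * Complex.exp (-φ * Complex.I)).re := by
    rw [e, add_mul, mul_assoc, exp_mul_exp_neg, mul_one, Complex.add_re, Complex.ofReal_re]
    have := (abs_le.mp (abs_re_mul_exp_le u φ)).1
    linarith
  have hc0 : 0 ≤ c := abs_nonneg _
  have hC0 : 0 ≤ C := (norm_nonneg _).trans hz
  nlinarith

/-! ### The translates of the fixed cone -/

theorem translate_cone (Λ₀ : Cone) (x : ℤ × ℤ) :
    cone (toC (Λ₀.translate x).apex) (Λ₀.translate x).axis (Λ₀.translate x).half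
      = cone (toC Λ₀.apex + pos x) Λ₀.axis Λ₀.half := by
  have : toC (Λ₀.translate x).apex = toC Λ₀.apex + pos x := by
    apply Complex.ext <;> simp [toC, Cone.translate, pos]
  rw [this]; rfl

/-- Integral points far back along the axis of a cone. -/
def backSite (φ : ℝ) (n : ℕ) : ℤ × ℤ := (⌊-(n : ℝ) * Real.cos φ⌋, ⌊-(n : ℝ) * Real.sin φ⌋)

theorem norm_backSite (q : ℂ) (φ : ℝ) (n : ℕ) :
    ‖q + pos (backSite φ n) - pol q (-(n : ℝ)) φ‖ ≤ 2 := by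
  refine (Complex.norm_le_abs_re_add_abs_im _).trans ?_
  have h1 : (q + pos (backSite φ n) - pol q (-(n : ℝ)) φ).re
      = ⌊-(n : ℝ) * Real.cos φ⌋ - -(n : ℝ) * Real.cos φ := by
    rw [pol, Complex.sub_re, Complex.add_re, Complex.add_re, Complex.re_ofReal_mul,
      Complex.exp_ofReal_mul_I_re, add_sub_add_left_eq_sub]; rfl
  have h2 : (q + pos (backSite φ n) - pol q (-(n : ℝ)) φ).im
      = ⌊-(n : ℝ) * Real.sin φ⌋ - -(n : ℝ) * Real.sin φ := by
    rw [pol, Complex.sub_im, Complex.add_im, Complex.add_im, Complex.im_ofReal_mul,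
      Complex.exp_ofReal_mul_I_im, add_sub_add_left_eq_sub]; rfl
  rw [h1, h2]
  have key : ∀ x : ℝ, |(⌊x⌋ : ℝ) - x| ≤ 1 := fun x =>
    abs_le.mpr ⟨by linarith [Int.lt_floor_add_one x], by linarith [Int.floor_le x]⟩
  linarith [key (-(n : ℝ) * Real.cos φ), key (-(n : ℝ) * Real.sin φ)]

/-! ### Relative position of cones -/

theorem cos_le_of_subset {q q' : ℂ} {φ h κ θ A : ℝ} (h1 : h < Real.pi)
    (hs : cone q φ h ⊆ cone q' κ θ) (hA : |A - φ| < h) : Real.cos θ ≤ Real.cos (A - κ) := by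
  by_contra! hlt
  obtain ⟨n, hn⟩ := exists_nat_gt (2 * (0 + ‖q - q'‖) / (Real.cos θ - Real.cos (A - κ)))
  have hg : 0 < Real.cos θ - Real.cos (A - κ) := sub_pos.mpr hlt
  rw [div_lt_iff₀ hg] at hn
  have hn0 : (0 : ℝ) < n + 1 := by positivity
  have hm : pol q (n + 1) A ∈ cone q' κ θ := by
    refine hs ((mem_cone_iff ((abs_nonneg _).trans_lt hA) h1).mpr ⟨n + 1, A, hn0, hA, ?_⟩)
    simp
  have := near_pol_of_mem (b := q) (r := n + 1) (A := A) (D := 0) hn0.le (by simp) hm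
  nlinarith

theorem exists_lift_of_subset {q q' : ℂ} {φ h κ θ : ℝ} (h0 : 0 < h) (h1 : h < Real.pi)
    (hθ0 : 0 < θ) (hθ : θ < Real.pi) (hs : cone q φ h ⊆ cone q' κ θ) :
    ∃ k : ℤ, |φ + 2 * Real.pi * k - κ| + h ≤ θ := by
  obtain ⟨k, hk⟩ := exists_near_lift (φ - κ)
  refine ⟨k, ?_⟩
  have e : φ + 2 * Real.pi * k - κ = φ - κ + 2 * Real.pi * k := by ring
  rw [e]
  set B := φ - κ + 2 * Real.pi * k with hB
  have key : ∀ A, |A - B| < h → Real.cos θ ≤ Real.cos A := by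
    intro A hA
    have := cos_le_of_subset h1 hs (A := A + κ - 2 * Real.pi * k) (by
      rw [hB] at hA
      convert hA using 2; ring)
    have e2 : A + κ - 2 * Real.pi * k - κ = A - k * (2 * Real.pi) := by ring
    rwa [e2, Real.cos_sub_int_mul_two_pi] at this
  by_contra! hlt
  rw [abs_le] at hk
  rcases le_total 0 B with hB0 | hB0
  · rw [abs_of_nonneg hB0] at hlt
    obtain ⟨A, hA1, hA2⟩ := exists_between (a₁ := max (B - h) θ)
      (a₂ := min (B + h) (2 * Real.pi - θ))
      (by rw [max_lt_iff, lt_min_iff, lt_min_iff]; constructor <;> constructor <;> linarith)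
    rw [max_lt_iff] at hA1
    rw [lt_min_iff] at hA2
    exact absurd (key A (abs_lt.mpr ⟨by linarith, by linarith⟩))
      (not_le.mpr (cos_lt_of_between hθ0.le hA1.2 hA2.2))
  · rw [abs_of_nonpos hB0] at hlt
    obtain ⟨A, hA1, hA2⟩ := exists_between (a₁ := max (-B - h) θ)
      (a₂ := min (-B + h) (2 * Real.pi - θ))
      (by rw [max_lt_iff, lt_min_iff, lt_min_iff]; constructor <;> constructor <;> linarith)
    rw [max_lt_iff] at hA1
    rw [lt_min_iff] at hA2
    have := key (-A) (abs_lt.mpr ⟨by linarith, by linarith⟩)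
    rw [Real.cos_neg] at this
    exact absurd this (not_le.mpr (cos_lt_of_between hθ0.le hA1.2 hA2.2))

theorem le_abs_of_disjoint {q q' : ℂ} {φ h φ' h' : ℝ} (h0 : 0 < h) (h1 : h ≤ Real.pi)
    (h0' : 0 < h') (h1' : h' ≤ Real.pi)
    (hd : Disjoint (cone q φ h) (cone q' φ' h')) : h + h' ≤ |φ - φ'| := by
  by_contra! hlt
  rw [abs_lt] at hlt
  obtain ⟨A, hA1, hA2⟩ := exists_between (a₁ := max (φ - h) (φ' - h'))
    (a₂ := min (φ + h) (φ' + h'))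
    (by rw [max_lt_iff, lt_min_iff, lt_min_iff]; constructor <;> constructor <;> linarith)
  rw [max_lt_iff] at hA1
  rw [lt_min_iff] at hA2
  obtain ⟨R, -, hR⟩ := far_sector_subset (a₁ := A) (a₂ := A) q q 0 (φ := φ) (h := h) (by
    intro B h2 h3
    exact cos_lt_of_abs_lt (abs_lt.mpr ⟨by linarith, by linarith⟩) h1)
  obtain ⟨R', -, hR'⟩ := far_sector_subset (a₁ := A) (a₂ := A) q q' 0 (φ := φ') (h := h') (by
    intro B h2 h3
    exact cos_lt_of_abs_lt (abs_lt.mpr ⟨by linarith, by linarith⟩) h1')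
  have hz := hR (max R R' + 1) A (pol q (max R R' + 1) A)
    (by linarith [le_max_left R R']) le_rfl le_rfl (by simp)
  have hz' := hR' (max R R' + 1) A (pol q (max R R' + 1) A)
    (by linarith [le_max_right R R']) le_rfl le_rfl (by simp)
  exact Set.disjoint_left.mp hd hz hz'

/-- Far back translates of the fixed cone contain all the cones with a given apex that fit into
its sector. -/
theorem eventually_subset_translate (Λ₀ : Cone) (q : ℂ) : ∀ᶠ n : ℕ in atTop, ∀ φ h : ℝ, 0 < h →
    |φ - Λ₀.axis| + h ≤ Λ₀.half →
    cone q φ h ⊆ cone (toC Λ₀.apex + pos (backSite Λ₀.axis n)) Λ₀.axis Λ₀.half := by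
  obtain ⟨L₀, -, hL⟩ := exists_shift Λ₀.axis Λ₀.half_pos Λ₀.half_lt (2 + ‖toC Λ₀.apex - q‖)
  obtain ⟨N, hN⟩ := exists_nat_gt L₀
  filter_upwards [eventually_ge_atTop N] with n hn φ h h0 hle z hz
  refine hL n (hN.le.trans (by exact_mod_cast hn)) q _ z z ?_ ?_
    (cone_subset_cone h0 Λ₀.half_lt hle hz)
  · have e : toC Λ₀.apex + pos (backSite Λ₀.axis n) - pol q (-(n : ℝ)) Λ₀.axis
        = (toC Λ₀.apex + pos (backSite Λ₀.axis n) - pol (toC Λ₀.apex) (-(n : ℝ)) Λ₀.axis)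
          + (toC Λ₀.apex - q) := by
      rw [pol, pol]; ring
    rw [e]
    exact (norm_add_le _ _).trans (add_le_add_left (norm_backSite _ _ _) _)
  · simp only [sub_self, norm_zero]; positivity

/-- Two cones one of which is to the left of the other occupy sectors in counterclockwise order. -/
theorem LeftOf.exists_lifts {Λ₀ Λt Λ₁ : Cone} (hl : LeftOf Λ₀ Λt Λ₁) :
    ∃ k₁ k : ℤ,
      Λ₀.axis - Λ₀.half ≤ Λ₁.axis + 2 * Real.pi * k₁ - Λ₁.half ∧
      Λ₁.axis + 2 * Real.pi * k₁ + Λ₁.half ≤ Λt.axis + 2 * Real.pi * k - Λt.half ∧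
      Λt.axis + 2 * Real.pi * k + Λt.half ≤ Λ₀.axis + Λ₀.half := by
  obtain ⟨hd, ⟨x, hx, hx'⟩, hrot⟩ := hl
  rw [region_subset_iff, translate_cone] at hx hx'
  obtain ⟨k, hk⟩ := exists_lift_of_subset Λt.half_pos Λt.half_lt Λ₀.half_pos Λ₀.half_lt hx
  obtain ⟨k₁, hk₁⟩ := exists_lift_of_subset Λ₁.half_pos Λ₁.half_lt Λ₀.half_pos Λ₀.half_lt hx'
  refine ⟨k₁, k, ?_⟩
  have ht0 := Λt.half_pos
  have h10 := Λ₁.half_pos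
  set φ := Λt.axis + 2 * Real.pi * k with hφ
  set φ₁ := Λ₁.axis + 2 * Real.pi * k₁ with hφ₁
  have hdist : ∀ s, Disjoint (Λt.rotate s).region Λ₁.region →
      Λt.half + Λ₁.half ≤ |φ + s - φ₁| := by
    intro s hs
    rw [region_disjoint_iff, ← cone_add_two_pi _ _ _ k, ← cone_add_two_pi _ Λ₁.axis _ k₁] at hs
    have e : φ + s = (Λt.rotate s).axis + 2 * Real.pi * k := by
      rw [hφ, Cone.rotate]; ring
    rw [e]
    exact le_abs_of_disjoint (Λt.rotate s).half_pos (Λt.rotate s).half_lt.le Λ₁.half_pos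
      Λ₁.half_lt.le hs
  have h0 : Λt.half + Λ₁.half ≤ |φ - φ₁| := by
    have := hdist 0 (by simpa [Cone.rotate] using hd)
    simpa using this
  have hk' := hk
  have hk₁' := hk₁
  rw [← le_sub_iff_add_le, abs_le] at hk' hk₁'
  rcases le_total φ₁ φ with hle | hle
  · rw [abs_of_nonneg (by linarith)] at h0
    exact ⟨by linarith, by linarith, by linarith⟩
  exfalso
  rw [abs_of_nonpos (by linarith)] at h0
  obtain ⟨n, hn, hn₁⟩ := ((eventually_subset_translate Λ₀ (toC Λt.apex)).and
    (eventually_subset_translate Λ₀ (toC Λ₁.apex))).exists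
  have hsub : ∀ s, |φ + s - Λ₀.axis| + Λt.half ≤ Λ₀.half →
      (Λt.rotate s).region ⊆ (Λ₀.translate (backSite Λ₀.axis n)).region := by
    intro s hs
    rw [region_subset_iff, translate_cone, ← cone_add_two_pi _ _ _ k]
    refine hn _ _ (Λt.rotate s).half_pos ?_
    rw [Cone.rotate]
    convert hs using 4
    rw [hφ]; ring
  obtain ⟨t, ht, hexit, hdis⟩ := hrot (backSite Λ₀.axis n)
    (by simpa [Cone.rotate] using hsub 0 (by simpa using hk))
    (by
      rw [region_subset_iff, translate_cone, ← cone_add_two_pi _ _ _ k₁]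
      exact hn₁ _ _ Λ₁.half_pos hk₁)
  have hex : ¬ |φ + t - Λ₀.axis| + Λt.half ≤ Λ₀.half := fun h => hexit (hsub t h)
  have hgt : Λ₀.axis + Λ₀.half < φ + t + Λt.half := by
    by_contra! hle2
    apply hex
    rw [← le_sub_iff_add_le, abs_le]
    constructor <;> linarith
  have hs := hdist (min t (φ₁ - φ)) (hdis _ (le_min ht (by linarith)) (min_le_left _ _))
  rcases le_total t (φ₁ - φ) with h | h
  · rw [min_eq_left h, abs_of_nonpos (by linarith)] at hs
    linarith
  · rw [min_eq_right h, add_sub_cancel, sub_self, abs_zero] at hs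
    linarith

/-- A thin cone with the same apex that lies counterclockwise is to the left. -/
theorem leftOf_of_sectors {Λ₀ Λ₁ : Cone} {k₁ : ℤ} {ψ δ : ℝ} (hδ : 0 < δ) (hδ' : δ < Real.pi)
    (hw : Λ₀.half + δ ≤ Real.pi)
    (h1 : Λ₀.axis - Λ₀.half ≤ Λ₁.axis + 2 * Real.pi * k₁ - Λ₁.half)
    (h2 : Λ₁.axis + 2 * Real.pi * k₁ + Λ₁.half ≤ ψ - δ) (h3 : ψ + δ ≤ Λ₀.axis + Λ₀.half) :
    LeftOf Λ₀ ⟨Λ₁.apex, ψ, δ, hδ, hδ'⟩ Λ₁ := by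
  have h10 := Λ₁.half_pos
  have h00 := Λ₀.half_pos
  have hdis : ∀ s, 0 ≤ s → s ≤ Λ₀.axis + Λ₀.half + δ - ψ →
      Disjoint ((⟨Λ₁.apex, ψ, δ, hδ, hδ'⟩ : Cone).rotate s).region Λ₁.region := by
    intro s hs0 hs1
    rw [region_disjoint_iff, ← cone_add_two_pi _ Λ₁.axis _ k₁, Set.disjoint_left]
    intro z hz
    obtain ⟨r, A, hr, hA, rfl⟩ := (mem_cone_iff hδ hδ').mp hz
    simp only [Cone.rotate] at hA ⊢
    rw [abs_lt] at hA
    rw [pol_mem_cone hr, not_lt]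
    exact (cos_lt_of_between h10.le (by linarith) (by linarith)).le
  refine ⟨by simpa [Cone.rotate] using hdis 0 le_rfl (by linarith), ?_, ?_⟩
  · obtain ⟨n, hn⟩ := (eventually_subset_translate Λ₀ (toC Λ₁.apex)).exists
    refine ⟨backSite Λ₀.axis n, ?_, ?_⟩
    · rw [region_subset_iff, translate_cone]
      refine hn _ _ hδ ?_
      rw [← le_sub_iff_add_le, abs_le]
      constructor <;> linarith
    · rw [region_subset_iff, translate_cone, ← cone_add_two_pi _ _ _ k₁]
      refine hn _ _ h10 ?_
      rw [← le_sub_iff_add_le, abs_le]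
      constructor <;> linarith
  · intro x _ _
    refine ⟨Λ₀.axis + Λ₀.half + δ - ψ, by linarith, ?_, hdis⟩
    rw [region_subset_iff, translate_cone]
    intro hsub
    obtain ⟨k, hk⟩ := exists_lift_of_subset hδ hδ' h00 Λ₀.half_lt hsub
    simp only [Cone.rotate] at hk
    rw [← le_sub_iff_add_le, abs_le] at hk
    have hp := Real.pi_pos
    rcases le_or_gt 0 k with hk0 | hk0
    · have : (0 : ℝ) ≤ k := by exact_mod_cast hk0
      nlinarith
    · have : (k : ℝ) ≤ -1 := by exact_mod_cast Int.le_sub_one_of_lt hk0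
      have := Λ₀.half_lt
      nlinarith

/-! ### Leaving a cone -/

theorem convex_cone (q : ℂ) (φ : ℝ) {h : ℝ} (hc : 0 ≤ Real.cos h) : Convex ℝ (cone q φ h) := by
  intro z hz w hw s t hs ht hst
  rw [cone, Set.mem_ofPred_eq] at hz hw ⊢
  have e : s • z + t • w - q = s • (z - q) + t • (w - q) := by
    have : q = s • q + t • q := by rw [← add_smul, hst, one_smul]
    nth_rw 1 [this]
    rw [smul_sub, smul_sub]; ring
  have h1 : ‖s • (z - q) + t • (w - q)‖ ≤ s * ‖z - q‖ + t * ‖w - q‖ := by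
    refine (norm_add_le _ _).trans ?_
    rw [norm_smul, norm_smul, Real.norm_of_nonneg hs, Real.norm_of_nonneg ht]
  rw [e, add_mul, Complex.add_re, smul_mul_assoc, smul_mul_assoc, Complex.smul_re, Complex.smul_re,
    smul_eq_mul, smul_eq_mul]
  have h2 := mul_le_mul_of_nonneg_right h1 hc
  rcases hs.lt_or_eq with hs | rfl
  · nlinarith [mul_lt_mul_of_pos_left hz hs, mul_le_mul_of_nonneg_left hw.le ht]
  · have : t = 1 := by linarith
    subst this
    linarith

theorem isOpen_cone (q : ℂ) (φ h : ℝ) : IsOpen (cone q φ h) :=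
  isOpen_lt (by fun_prop) (by fun_prop)

/-- The two signs `σ` for which a linear form increases in the quadrant with the signs `σ`. -/
theorem exists_signs (f : ℂ →ₗ[ℝ] ℝ) : ∃ σ₁ σ₂ : ℤ, (σ₁ = 1 ∨ σ₁ = -1) ∧ (σ₂ = 1 ∨ σ₂ = -1) ∧
    ∀ s₁ s₂ : ℝ, 0 ≤ s₁ → 0 ≤ s₂ → 0 ≤ f ⟨σ₁ * s₁, σ₂ * s₂⟩ := by
  have e : ∀ x y : ℝ, f ⟨x, y⟩ = x * f 1 + y * f Complex.I := by
    intro x y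
    have : (⟨x, y⟩ : ℂ) = x • 1 + y • Complex.I := by apply Complex.ext <;> simp
    rw [this, map_add, map_smul, map_smul, smul_eq_mul, smul_eq_mul]
  have key : ∀ y : ℝ, ∃ σ : ℤ, (σ = 1 ∨ σ = -1) ∧ 0 ≤ σ * y := by
    intro y
    rcases le_total 0 y with h | h
    · exact ⟨1, Or.inl rfl, by simpa⟩
    · exact ⟨-1, Or.inr rfl, by simpa⟩
  obtain ⟨σ₁, h1, h1'⟩ := key (f 1)
  obtain ⟨σ₂, h2, h2'⟩ := key (f Complex.I)
  refine ⟨σ₁, σ₂, h1, h2, fun s₁ s₂ hs1 hs2 => ?_⟩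
  rw [e]
  nlinarith [mul_nonneg hs1 h1', mul_nonneg hs2 h2']

/-- From a point off a cone, far from its apex, one of the four quadrants can be followed for
some way without meeting the cone. -/
theorem exists_quadrant (q : ℂ) (φ : ℝ) {h : ℝ} (h0 : 0 < h) (h1 : h < Real.pi) (M : ℝ) :
    ∃ R : ℝ, ∀ z, z ∉ cone q φ h → R < ‖z - q‖ →
      ∃ σ₁ σ₂ : ℤ, (σ₁ = 1 ∨ σ₁ = -1) ∧ (σ₂ = 1 ∨ σ₂ = -1) ∧
        ∀ s₁ s₂ : ℝ, 0 ≤ s₁ → 0 ≤ s₂ → s₁ ≤ M → s₂ ≤ M →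
          z + ⟨σ₁ * s₁, σ₂ * s₂⟩ ∉ cone q φ h := by
  rcases le_or_gt 0 (Real.cos h) with hc | hc
  · refine ⟨0, fun z hz _ => ?_⟩
    obtain ⟨f, hf⟩ := geometric_hahn_banach_open_point (convex_cone q φ hc) (isOpen_cone q φ h) hz
    obtain ⟨σ₁, σ₂, hσ₁, hσ₂, hσ⟩ := exists_signs (f : ℂ →ₗ[ℝ] ℝ)
    refine ⟨σ₁, σ₂, hσ₁, hσ₂, fun s₁ s₂ hs1 hs2 _ _ hm => ?_⟩
    have h2 := hf _ hm
    rw [map_add] at h2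
    have h3 : 0 ≤ f ⟨σ₁ * s₁, σ₂ * s₂⟩ := hσ s₁ s₂ hs1 hs2
    linarith
  have hs : 0 < Real.sin h := Real.sin_pos_of_pos_of_lt_pi h0 h1
  set c := Real.cos h with hcdef
  set s := Real.sin h with hsdef
  have hsc : s ^ 2 + c ^ 2 = 1 := Real.sin_sq_add_cos_sq h
  have hs1 : s ≤ 1 := Real.sin_le_one h
  have hc1 : -1 ≤ c := Real.neg_one_le_cos h
  set e := Complex.exp (-φ * Complex.I) with he
  have hnorm : ∀ d : ℂ, ‖d‖ ^ 2 = (d * e).re ^ 2 + (d * e).im ^ 2 := by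
    intro d
    rw [← Complex.normSq_eq_norm_sq, sq, sq, ← Complex.normSq_apply, map_mul,
      Complex.normSq_eq_norm_sq e, he, norm_exp_neg]
    ring
  have hmem : ∀ z, z ∉ cone q φ h ↔ s * ((z - q) * e).re ≤ c * |((z - q) * e).im| := by
    intro z
    rw [cone, Set.mem_ofPred_eq, not_lt, ← hcdef, ← he]
    have h2 := hnorm (z - q)
    set x := ((z - q) * e).re
    set y := ((z - q) * e).im
    have hn := norm_nonneg (z - q)
    set n := ‖z - q‖
    have hy := abs_nonneg y
    have hy2 := sq_abs y
    constructor
    · intro hx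
      have hx0 : x ≤ 0 := hx.trans (mul_nonpos_of_nonneg_of_nonpos hn hc.le)
      have h4 := mul_self_le_mul_self (show 0 ≤ n * -c by nlinarith) (show n * -c ≤ -x by linarith)
      have h5 : (c * |y|) ^ 2 ≤ (s * x) ^ 2 := by
        have : (s * x) ^ 2 - (c * |y|) ^ 2 = (-x) * (-x) - n * -c * (n * -c)
            + (s ^ 2 + c ^ 2 - 1) * x ^ 2 + c ^ 2 * (n ^ 2 - (x ^ 2 + y ^ 2))
            + c ^ 2 * (y ^ 2 - |y| ^ 2) := by ring
        rw [hsc, h2, hy2] at this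
        linarith
      have h6 := sq_le_sq.mp h5
      rw [abs_of_nonpos (mul_nonpos_of_nonpos_of_nonneg hc.le hy),
        abs_of_nonpos (mul_nonpos_of_nonneg_of_nonpos hs.le hx0)] at h6
      linarith
    · intro hx
      have hx0 : x ≤ 0 := by
        by_contra! hx0
        nlinarith [mul_nonneg (neg_nonneg.mpr hc.le) hy, mul_pos hs hx0]
      have h4 := mul_self_le_mul_self (show 0 ≤ -c * |y| by nlinarith)
        (show -c * |y| ≤ -(s * x) by linarith)
      have h5 : (n * c) ^ 2 ≤ x ^ 2 := by
        have : x ^ 2 - (n * c) ^ 2 = -(s * x) * -(s * x) - -c * |y| * (-c * |y|)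
            - (s ^ 2 + c ^ 2 - 1) * x ^ 2 - c ^ 2 * (n ^ 2 - (x ^ 2 + y ^ 2))
            - c ^ 2 * (y ^ 2 - |y| ^ 2) := by ring
        rw [hsc, h2, hy2] at this
        linarith
      have h6 := sq_le_sq.mp h5
      rw [abs_of_nonpos (mul_nonpos_of_nonneg_of_nonpos hn hc.le), abs_of_nonpos hx0] at h6
      linarith
  -- the two linear forms that cut out the complement
  let ℓ : ℝ → ℂ →ₗ[ℝ] ℝ := fun u =>
    (s • Complex.reLm + (u * c) • Complex.imLm) ∘ₗ LinearMap.mulRight ℝ e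
  have hℓ : ∀ u d, ℓ u d = s * (d * e).re + u * c * (d * e).im := fun u d => rfl
  have hoff : ∀ z, z ∉ cone q φ h ↔ ℓ 1 (z - q) ≤ 0 ∧ ℓ (-1) (z - q) ≤ 0 := by
    intro z
    rw [hmem, hℓ, hℓ]
    rcases le_total 0 ((z - q) * e).im with hy | hy
    · rw [abs_of_nonneg hy]
      exact ⟨fun hx => ⟨by nlinarith, by linarith⟩, fun hx => by linarith [hx.2]⟩
    · rw [abs_of_nonpos hy]
      exact ⟨fun hx => ⟨by linarith, by nlinarith⟩, fun hx => by linarith [hx.1]⟩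
  have hbox : ∀ u : ℝ, |u| = 1 → ∀ σ₁ σ₂ : ℤ, (σ₁ = 1 ∨ σ₁ = -1) → (σ₂ = 1 ∨ σ₂ = -1) →
      ∀ s₁ s₂ : ℝ, 0 ≤ s₁ → 0 ≤ s₂ → s₁ ≤ M → s₂ ≤ M → ℓ u ⟨σ₁ * s₁, σ₂ * s₂⟩ ≤ 4 * |M| := by
    intro u hu σ₁ σ₂ hσ₁ hσ₂ s₁ s₂ h2 h3 h4 h5
    set w : ℂ := ⟨σ₁ * s₁, σ₂ * s₂⟩ with hw
    have hwn : ‖w‖ ≤ 2 * |M| := by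
      refine (Complex.norm_le_abs_re_add_abs_im w).trans ?_
      have e1 : |w.re| = s₁ := by
        rcases hσ₁ with rfl | rfl <;> simp [hw, abs_of_nonneg h2]
      have e2 : |w.im| = s₂ := by
        rcases hσ₂ with rfl | rfl <;> simp [hw, abs_of_nonneg h3]
      rw [e1, e2]
      linarith [le_abs_self M]
    have hwe : ‖w * e‖ = ‖w‖ := by rw [norm_mul, he, norm_exp_neg, mul_one]
    have h6 := (Complex.abs_re_le_norm (w * e)).trans (hwe.le.trans hwn)
    have h7 := (Complex.abs_im_le_norm (w * e)).trans (hwe.le.trans hwn)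
    rw [hℓ]
    have h8 : |s * (w * e).re| ≤ 2 * |M| := by
      rw [abs_mul, abs_of_pos hs]
      exact (mul_le_of_le_one_left (abs_nonneg _) hs1).trans h6
    have h9 : |u * c * (w * e).im| ≤ 2 * |M| := by
      rw [abs_mul, abs_mul, hu, one_mul]
      exact (mul_le_of_le_one_left (abs_nonneg _) (abs_le.mpr ⟨hc1, by linarith⟩)).trans h7
    linarith [le_abs_self (s * (w * e).re), le_abs_self (u * c * (w * e).im)]
  have main : ∀ u : ℝ, |u| = 1 → ∀ z, ℓ u (z - q) ≤ 0 → ℓ (-u) (z - q) ≤ -(4 * |M|) →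
      ∃ σ₁ σ₂ : ℤ, (σ₁ = 1 ∨ σ₁ = -1) ∧ (σ₂ = 1 ∨ σ₂ = -1) ∧
        ∀ s₁ s₂ : ℝ, 0 ≤ s₁ → 0 ≤ s₂ → s₁ ≤ M → s₂ ≤ M →
          ℓ u (z + ⟨σ₁ * s₁, σ₂ * s₂⟩ - q) ≤ 0 ∧ ℓ (-u) (z + ⟨σ₁ * s₁, σ₂ * s₂⟩ - q) ≤ 0 := by
    intro u hu z hz1 hz2
    obtain ⟨σ₁, σ₂, hσ₁, hσ₂, hσ⟩ := exists_signs (-ℓ u)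
    refine ⟨σ₁, σ₂, hσ₁, hσ₂, fun s₁ s₂ h2 h3 h4 h5 => ?_⟩
    have h6 := hσ s₁ s₂ h2 h3
    have h7 := hbox (-u) (by rwa [abs_neg]) σ₁ σ₂ hσ₁ hσ₂ s₁ s₂ h2 h3 h4 h5
    rw [LinearMap.neg_apply] at h6
    rw [add_sub_right_comm, map_add, map_add]
    constructor <;> linarith
  refine ⟨4 * |M| / s + 4 * |M| / -c, fun z hz hR => ?_⟩
  obtain ⟨hz1, hz2⟩ := (hoff z).mp hz
  by_cases h2 : ℓ (-1) (z - q) ≤ -(4 * |M|)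
  · obtain ⟨σ₁, σ₂, hσ₁, hσ₂, hσ⟩ := main 1 (by simp) z hz1 h2
    exact ⟨σ₁, σ₂, hσ₁, hσ₂, fun s₁ s₂ h3 h4 h5 h6 => (hoff _).mpr (hσ s₁ s₂ h3 h4 h5 h6)⟩
  by_cases h3 : ℓ 1 (z - q) ≤ -(4 * |M|)
  · obtain ⟨σ₁, σ₂, hσ₁, hσ₂, hσ⟩ := main (-1) (by simp) z hz2 (by rwa [neg_neg])
    refine ⟨σ₁, σ₂, hσ₁, hσ₂, fun s₁ s₂ h3 h4 h5 h6 => (hoff _).mpr ?_⟩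
    have := hσ s₁ s₂ h3 h4 h5 h6
    rw [neg_neg] at this
    exact this.symm
  exfalso
  rw [hℓ] at h2 h3
  have h4 := (hmem z).mp hz
  have h5 := hnorm (z - q)
  set x := ((z - q) * e).re
  set y := ((z - q) * e).im
  push Not at h2 h3
  have hy0 := abs_nonneg y
  have hx0 : s * x ≤ 0 := h4.trans (mul_nonpos_of_nonpos_of_nonneg hc.le hy0)
  have hx1 : -x < 4 * |M| / s := by rw [lt_div_iff₀ hs]; linarith
  have hy1 : |y| < 4 * |M| / -c := by rw [lt_div_iff₀ (by linarith)]; linarith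
  have hx2 : 0 ≤ -x := by
    by_contra! h
    nlinarith [mul_pos hs (neg_lt_zero.mp h)]
  have : ‖z - q‖ ≤ -x + |y| := by
    refine le_of_sq_le_sq ?_ (by linarith)
    rw [h5, ← sq_abs y]
    nlinarith [mul_nonneg hx2 hy0]
  linarith

/-! ## Linking faces of the same colour -/

/-- The faces `f` and `g` are the ends of a finite chain of type `c` whose vertices satisfy `P`
and whose pairing with `τ` is `e`. -/
def Linked (c : Color) (τ : Config) (P : Vertex → Prop) (f g : Face) (e : ZMod 2) : Prop :=
  ∃ t : Chain, Orth c t ∧ (∀ h, bdry t h = ind f h + ind g h) ∧ (∀ v ∈ t.support, P v) ∧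
    pair τ t = e

section Linked

variable {c : Color} {τ : Config} {P Q : Vertex → Prop} {f g h : Face} {e e' : ZMod 2}

theorem Linked.refl (c : Color) (τ : Config) (P : Vertex → Prop) (f : Face) :
    Linked c τ P f f 0 :=
  ⟨0, Orth.zero c, fun h => by rw [ind_add_self]; exact bdry_zero h, by simp, map_zero _⟩

theorem Linked.symm (hl : Linked c τ P f g e) : Linked c τ P g f e := by
  obtain ⟨t, h1, h2, h3, h4⟩ := hl
  exact ⟨t, h1, fun h => by rw [h2, add_comm], h3, h4⟩

theorem Linked.trans (hl : Linked c τ P f g e) (hl' : Linked c τ P g h e') :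
    Linked c τ P f h (e + e') := by
  obtain ⟨t, h1, h2, h3, h4⟩ := hl
  obtain ⟨t', h1', h2', h3', h4'⟩ := hl'
  refine ⟨t + t', h1.add h1', fun k => ?_, fun v hv => ?_, by rw [map_add, h4, h4']⟩
  · rw [bdry_chain_add, h2, h2']
    linear_combination ind_add_self g k
  · rcases Finset.mem_union.mp (Finsupp.support_add hv) with hv | hv
    · exact h3 v hv
    · exact h3' v hv

theorem Linked.mono (hPQ : ∀ v, P v → Q v) (hl : Linked c τ P f g e) : Linked c τ Q f g e := by
  obtain ⟨t, h1, h2, h3, h4⟩ := hl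
  exact ⟨t, h1, h2, fun v hv => hPQ v (h3 v hv), h4⟩

theorem CEdge.linked {v w : Vertex} (he : CEdge f g v w) (hf : f.color = c) (hv : P v)
    (hw : P w) : Linked c τ P f g (pair τ (edge v w)) := by
  subst hf
  refine ⟨edge v w, he.orth, he.bdry, fun u hu => ?_, rfl⟩
  rcases support_edge hu with rfl | rfl
  · exact hv
  · exact hw

end Linked

theorem Face.exists_eq_shift {f g : Face} (h : f.color = g.color) : ∃ a b, g = f.shift a b := by
  rw [color_eq_iff] at h
  have := f.odd_mod
  have := g.odd_mod
  refine ⟨((g.x - f.x) / 3 + (g.y - f.y)) / 2, ((g.x - f.x) / 3 - (g.y - f.y)) / 2, ?_⟩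
  apply Face.ext' <;> simp only [Face.shift] <;> omega

theorem Face.center_shift (f : Face) (a b : ℤ) :
    (f.shift a b).center = f.center + ⟨3 * (a + b), a - b⟩ := by
  apply Complex.ext
  · simp [Face.center, Face.shift]; ring
  · simp [Face.center, Face.shift]; ring

theorem norm_le_of_abs {z : ℂ} {a b : ℝ} (h1 : |z.re| ≤ a) (h2 : |z.im| ≤ b) : ‖z‖ ≤ a + b :=
  (Complex.norm_le_abs_re_add_abs_im z).trans (add_le_add h1 h2)

theorem exists_face_near (c : Color) (z : ℂ) : ∃ f : Face, f.color = c ∧ ‖f.center - z‖ ≤ 3 := by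
  obtain ⟨m, hm', hm⟩ : ∃ m : ℤ, m % 3 = m ∧ ∀ f : Face, f.x % 3 = m → f.color = c := by
    cases c
    · exact ⟨0, by norm_num, fun f h => by simp [Face.color, h]⟩
    · exact ⟨1, by norm_num, fun f h => by simp [Face.color, h]⟩
    · exact ⟨2, by norm_num, fun f h => by simp [Face.color, h]⟩
  set x : ℤ := 3 * round ((z.re - 1 - m) / 3) + m with hx
  set y : ℤ := 2 * round ((z.im - 1 / 2 - (x + 1)) / 2) + (x + 1) with hy
  refine ⟨⟨x, y, Int.odd_iff.mpr (by omega)⟩, hm _ (by simp only; omega), ?_⟩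
  have h1 := abs_sub_round ((z.re - 1 - m) / 3)
  have h2 := abs_sub_round ((z.im - 1 / 2 - (x + 1)) / 2)
  refine (norm_le_of_abs (a := 3 / 2) (b := 1) ?_ ?_).trans (by norm_num)
  · have : (Face.center ⟨x, y, Int.odd_iff.mpr (by omega)⟩ - z).re
        = -3 * ((z.re - 1 - m) / 3 - round ((z.re - 1 - m) / 3)) := by
      simp only [Face.center, Complex.sub_re]
      rw [hx]; push_cast; ring
    rw [this, abs_mul]
    norm_num
    linarith
  · have : (Face.center ⟨x, y, Int.odd_iff.mpr (by omega)⟩ - z).im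
        = -2 * ((z.im - 1 / 2 - (x + 1)) / 2 - round ((z.im - 1 / 2 - (x + 1)) / 2)) := by
      simp only [Face.center, Complex.sub_im]
      rw [hy]; push_cast; ring
    rw [this, abs_mul]
    norm_num
    linarith

/-- The angle `A` is a direction of the centre of `f` seen from `b`. -/
def AtAngle (b : ℂ) (f : Face) (A : ℝ) : Prop := f.center = pol b ‖f.center - b‖ A

theorem atAngle_of_eq {b : ℂ} {f : Face} {r A : ℝ} (hr : 0 ≤ r) (h : f.center = pol b r A) :
    AtAngle b f A := by
  rw [AtAngle, h, norm_pol_sub b hr]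

theorem exists_angle (D : ℝ) {η : ℝ} (hη : 0 < η) : ∃ R₀, 0 ≤ R₀ ∧ ∀ (b z : ℂ) (r A : ℝ), R₀ < r →
    ‖z - pol b r A‖ ≤ D → ∃ A', |A' - A| < η ∧ z = pol b ‖z - b‖ A' := by
  have hcont : ContinuousAt Complex.arg 1 := Complex.continuousAt_arg (by simp)
  obtain ⟨ε, hε, hball⟩ := Metric.continuousAt_iff.mp hcont η hη
  refine ⟨max 0 (D / ε), le_max_left _ _, fun b z r A hr hz => ?_⟩
  have hr0 : 0 < r := (le_max_left _ _).trans_lt hr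
  have hr1 : D / ε < r := (le_max_right _ _).trans_lt hr
  rw [div_lt_iff₀ hε] at hr1
  set u : ℂ := (z - b) * Complex.exp (-A * Complex.I) / r with hu
  have hr0' : (r : ℂ) ≠ 0 := by exact_mod_cast hr0.ne'
  have hu1 : u - 1 = (z - pol b r A) * Complex.exp (-A * Complex.I) / r := by
    rw [hu, pol]
    have key := exp_mul_exp_neg A
    generalize Complex.exp (-(A : ℂ) * Complex.I) = x at key ⊢
    generalize Complex.exp ((A : ℂ) * Complex.I) = y at key ⊢
    field_simp
    linear_combination (r : ℂ) * key
  have hd : dist u 1 < ε := by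
    rw [dist_eq_norm, hu1, norm_div, norm_mul, norm_exp_neg, mul_one, Complex.norm_real,
      Real.norm_of_nonneg hr0.le, div_lt_iff₀ hr0]
    linarith
  have harg := hball hd
  rw [Complex.arg_one, dist_zero_right, Real.norm_eq_abs] at harg
  refine ⟨A + Complex.arg u, by rwa [add_sub_cancel_left], ?_⟩
  have hnu : ‖u‖ * r = ‖z - b‖ := by
    rw [hu, norm_div, norm_mul, norm_exp_neg, mul_one, Complex.norm_real,
      Real.norm_of_nonneg hr0.le]
    field_simp
  have h3 := Complex.norm_mul_exp_arg_mul_I u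
  have h4 : z - b = u * r * Complex.exp (A * Complex.I) := by
    have key := exp_mul_exp_neg A
    rw [hu]
    generalize Complex.exp (-(A : ℂ) * Complex.I) = x at key ⊢
    generalize Complex.exp ((A : ℂ) * Complex.I) = y at key ⊢
    field_simp
    linear_combination (b - z) * key
  rw [pol, ← hnu]
  push_cast
  rw [add_mul, Complex.exp_add]
  nth_rw 1 [← h3] at h4
  linear_combination h4

/-- The weight `N` of the directions around `b` computes the pairing of `τ` with the edges of
type `c` that are far from `b`. -/
def TurnsAt (c : Color) (τ : Config) (b : ℂ) (N : ℝ → ZMod 2) : Prop :=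
  ∃ R, ∀ f g v w A A', f.color = c → CEdge f g v w → R < ‖f.center - b‖ → R < ‖g.center - b‖ →
    AtAngle b f A → AtAngle b g A' → |A - A'| < Real.pi / 2 → pair τ (edge v w) = N A + N A'

theorem turnsAt_zero (c : Color) (b : ℂ) : TurnsAt c 0 b 0 :=
  ⟨0, fun f g v w A A' _ _ _ _ _ _ _ => by
    simp [edge, pair_single]⟩

theorem norm_pos_sub_center {v : Vertex} {f : Face} (h : v ∈ f.boundary) :
    ‖pos v - f.center‖ ≤ 2 := by
  rw [mem_boundary] at h
  obtain ⟨h1, h2, h3, h4⟩ := h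
  have h1' : (f.x : ℝ) ≤ v.1 := by exact_mod_cast h1
  have h2' : (v.1 : ℝ) ≤ f.x + 2 := by exact_mod_cast h2
  have h3' : (f.y : ℝ) ≤ v.2 := by exact_mod_cast h3
  have h4' : (v.2 : ℝ) ≤ f.y + 1 := by exact_mod_cast h4
  refine (norm_le_of_abs (a := 1) (b := 1 / 2) ?_ ?_).trans (by norm_num)
  · simp only [pos, Face.center, Complex.sub_re]
    rw [abs_le]; constructor <;> linarith
  · simp only [pos, Face.center, Complex.sub_im]
    rw [abs_le]; constructor <;> linarith

theorem norm_shift_sub_le (f : Face) (a b : ℤ) :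
    ‖(f.shift a b).center - f.center‖ ≤ 4 * (|a| + |b| : ℤ) := by
  rw [f.center_shift, add_sub_cancel_left]
  refine (norm_le_of_abs (a := 3 * |(a : ℝ) + b|) (b := |(a : ℝ) - b|) ?_ ?_).trans ?_
  · simp only [abs_mul]; norm_num
  · simp only [le_refl]
  · have := abs_add_le (a : ℝ) b
    have := abs_sub (a : ℝ) b
    push_cast
    linarith

theorem exists_local_link {c : Color} {τ : Config} {b : ℂ} {N : ℝ → ZMod 2}
    (hN : TurnsAt c τ b N) : ∃ R₀, 0 ≤ R₀ ∧ ∀ (r a : ℝ), R₀ < r → ∀ f g : Face, f.color = c →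
      g.color = c → ‖f.center - pol b r a‖ ≤ 5 → ‖g.center - pol b r a‖ ≤ 5 → ∀ A A',
      AtAngle b f A → AtAngle b g A' → |A - a| < Real.pi / 4 → |A' - a| < Real.pi / 4 →
      Linked c τ (fun v => ‖pos v - pol b r a‖ ≤ 200) f g (N A + N A') := by
  obtain ⟨R, hR⟩ := hN
  obtain ⟨R₁, hR1, hlift⟩ := exists_angle 190 (show 0 < Real.pi / 4 by positivity)
  refine ⟨max R₁ (R + 190), hR1.trans (le_max_left _ _), fun r a hr => ?_⟩
  have hr1 : R₁ < r := (le_max_left _ _).trans_lt hr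
  have hr2 : R + 190 < r := (le_max_right _ _).trans_lt hr
  set z := pol b r a with hz
  let L : Face → Face → Prop := fun f g => ∀ A A', AtAngle b f A → AtAngle b g A' →
    |A - a| < Real.pi / 4 → |A' - a| < Real.pi / 4 →
      Linked c τ (fun v => ‖pos v - z‖ ≤ 200) f g (N A + N A')
  have hsymm : ∀ f g, L f g → L g f := by
    intro f g hl A A' h1 h2 h3 h4
    rw [add_comm]
    exact (hl A' A h2 h1 h4 h3).symm
  have htrans : ∀ f g h, ‖g.center - z‖ ≤ 190 → L f g → L g h → L f h := by
    intro f g h hg hl hl' A A' h1 h2 h3 h4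
    obtain ⟨B, hB, hB'⟩ := hlift b g.center r a hr1 hg
    convert (hl A B h1 hB' h3 hB).trans (hl' B A' hB' h2 hB h4) using 1
    linear_combination -(zmod_two_add_self (N B))
  have hfar : ∀ f : Face, ‖f.center - z‖ ≤ 190 → R < ‖f.center - b‖ := by
    intro f hf
    have h1 : ‖z - b‖ = r := norm_pol_sub b (hR1.trans hr1.le) a
    have h2 := norm_sub_norm_le (z - b) (f.center - b)
    rw [sub_sub_sub_cancel_right, norm_sub_rev z f.center] at h2
    linarith
  have hstep : ∀ f g v w, f.color = c → CEdge f g v w → ‖f.center - z‖ ≤ 186 →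
      ‖g.center - z‖ ≤ 190 → L f g := by
    intro f g v w hf he hfz hgz A A' h1 h2 h3 h4
    rw [← hR f g v w A A' hf he (hfar f (by linarith)) (hfar g hgz) h1 h2 (by
      rw [abs_lt] at h3 h4 ⊢
      constructor <;> linarith)]
    refine he.linked hf ?_ ?_
    · have := norm_add_le (pos v - f.center) (f.center - z)
      rw [sub_add_sub_cancel] at this
      linarith [norm_pos_sub_center he.left]
    · have := norm_add_le (pos w - g.center) (g.center - z)
      rw [sub_add_sub_cancel] at this
      linarith [norm_pos_sub_center he.right]
  have hrefl : ∀ f, f.color = c → ‖f.center - z‖ ≤ 100 → L f f := by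
    intro f hf hfz
    have hs : ‖(f.shift 1 0).center - z‖ ≤ 190 := by
      have := norm_add_le ((f.shift 1 0).center - f.center) (f.center - z)
      rw [sub_add_sub_cancel] at this
      have := norm_shift_sub_le f 1 0
      norm_num at this
      linarith
    have h1 := hstep _ _ _ _ hf (cedge_up f) (by linarith) hs
    exact htrans _ _ _ hs h1 (hsymm _ _ h1)
  have hwalk : ∀ a' b' : ℤ, (∀ f : Face, ∃ v w, CEdge f (f.shift a' b') v w) → |a'| + |b'| ≤ 1 →
      ∀ n : ℕ, ∀ f : Face, f.color = c → ‖f.center - z‖ + 4 * n ≤ 100 →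
        L f (f.shift (n * a') (n * b')) := by
    intro a' b' he hab n
    induction n with
    | zero =>
      intro f hf hfz
      simp only [Nat.cast_zero, zero_mul, Face.shift_zero]
      exact hrefl f hf (by simpa using hfz)
    | succ n ih =>
      intro f hf hfz
      obtain ⟨v, w, hvw⟩ := he f
      have hn : (0 : ℝ) ≤ n := n.cast_nonneg
      push_cast at hfz
      have h1 : ‖(f.shift a' b').center - z‖ ≤ ‖f.center - z‖ + 4 := by
        have h2 := norm_add_le ((f.shift a' b').center - f.center) (f.center - z)
        rw [sub_add_sub_cancel] at h2
        have h3 := norm_shift_sub_le f a' b'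
        have h4 : ((|a'| + |b'| : ℤ) : ℝ) ≤ 1 := by exact_mod_cast hab
        linarith
      have h2 := ih (f.shift a' b') (by rw [f.shift_color, hf]) (by linarith)
      rw [f.shift_shift] at h2
      have h3 := htrans _ _ _ (by linarith) (hstep _ _ _ _ hf hvw (by linarith) (by linarith)) h2
      convert h3 using 2 <;> push_cast <;> ring
  have hwalk' : ∀ a' b' : ℤ, (∀ f : Face, ∃ v w, CEdge f (f.shift a' b') v w) → |a'| + |b'| ≤ 1 →
      ∀ n : ℤ, ∀ f : Face, f.color = c → ‖f.center - z‖ + 8 * |n| ≤ 100 →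
        L f (f.shift (n * a') (n * b')) := by
    intro a' b' he hab n f hf hfz
    obtain ⟨m, rfl | rfl⟩ := n.eq_nat_or_neg
    · refine hwalk a' b' he hab m f hf ?_
      have hn : (0 : ℝ) ≤ m := m.cast_nonneg
      simp only [Nat.abs_cast, Int.cast_natCast] at hfz
      linarith
    · refine hsymm _ _ ?_
      have hn : (0 : ℝ) ≤ m := m.cast_nonneg
      simp only [abs_neg, Nat.abs_cast, Int.cast_natCast] at hfz
      have h1 := norm_shift_sub_le f (-m * a') (-m * b')
      have h3 : |-(m : ℤ) * a'| + |-(m : ℤ) * b'| ≤ m := by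
        rw [abs_mul, abs_mul, abs_neg, Nat.abs_cast, ← mul_add]
        exact mul_le_of_le_one_right (by positivity) hab
      have h4 : ((|-(m : ℤ) * a'| + |-(m : ℤ) * b'| : ℤ) : ℝ) ≤ m := by exact_mod_cast h3
      have h5 := norm_add_le ((f.shift (-m * a') (-m * b')).center - f.center) (f.center - z)
      rw [sub_add_sub_cancel] at h5
      have h2 := hwalk a' b' he hab m (f.shift (-m * a') (-m * b')) (by rw [f.shift_color, hf])
        (by linarith)
      rw [f.shift_shift] at h2
      simpa [Face.shift_zero] using h2
  intro f g hf hg hfz hgz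
  obtain ⟨k, l, rfl⟩ := Face.exists_eq_shift (hf.trans hg.symm)
  have hd : ‖(f.shift k l).center - f.center‖ ≤ 10 := by
    have := norm_sub_le ((f.shift k l).center - z) (f.center - z)
    rw [sub_sub_sub_cancel_right] at this
    linarith
  rw [f.center_shift, add_sub_cancel_left] at hd
  have h1 := (Complex.abs_re_le_norm _).trans hd
  have h2 := (Complex.abs_im_le_norm _).trans hd
  simp only at h1 h2
  have h3 : |3 * (k + l)| ≤ 10 := by exact_mod_cast h1
  have h4 : |k - l| ≤ 10 := by exact_mod_cast h2
  rw [abs_le] at h3 h4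
  have hk : |k| ≤ 6 := abs_le.mpr (by omega)
  have hl : |l| ≤ 6 := abs_le.mpr (by omega)
  have hk' : (|k| : ℝ) ≤ 6 := by exact_mod_cast hk
  have hl' : (|l| : ℝ) ≤ 6 := by exact_mod_cast hl
  have e1 := hwalk' 1 0 (fun f => ⟨_, _, cedge_up f⟩) (by norm_num) k f hf (by
    push_cast; linarith)
  have hmid : ‖(f.shift (k * 1) (k * 0)).center - z‖ ≤ 29 := by
    have h5 := norm_add_le ((f.shift (k * 1) (k * 0)).center - f.center) (f.center - z)
    rw [sub_add_sub_cancel] at h5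
    have h6 := norm_shift_sub_le f (k * 1) (k * 0)
    simp only [mul_one, mul_zero, abs_zero, add_zero, Int.cast_abs] at h5 h6 ⊢
    linarith
  have e2 := hwalk' 0 1 (fun f => ⟨_, _, cedge_down f⟩) (by norm_num) l (f.shift (k * 1) (k * 0))
    (by rw [f.shift_color, hf]) (by push_cast; linarith)
  have e3 := htrans _ _ _ (by linarith) e1 e2
  rw [f.shift_shift] at e3
  simpa using e3

/-- Faces of the same colour far from `b` are linked by chains in the sector between them. -/
theorem exists_ring {c : Color} {τ : Config} {b : ℂ} {N : ℝ → ZMod 2} (hN : TurnsAt c τ b N) :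
    ∃ R₀, 0 ≤ R₀ ∧ ∀ (f g : Face) (r₁ r₂ A₁ A₂ a₁ a₂ : ℝ), f.color = c → g.color = c →
      R₀ < r₁ → R₀ < r₂ → A₁ ∈ Set.Icc a₁ a₂ → A₂ ∈ Set.Icc a₁ a₂ →
      f.center = pol b r₁ A₁ → g.center = pol b r₂ A₂ →
      Linked c τ (fun v => ∃ r A, min r₁ r₂ ≤ r ∧ A ∈ Set.Icc a₁ a₂ ∧ ‖pos v - pol b r A‖ ≤ 200)
        f g (N A₁ + N A₂) := by
  obtain ⟨R, hR0, hR⟩ := exists_local_link hN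
  obtain ⟨R₁, hR1, hlift⟩ := exists_angle 3 (show 0 < Real.pi / 8 by positivity)
  refine ⟨max R R₁, hR0.trans (le_max_left _ _), ?_⟩
  intro f g r₁ r₂ A₁ A₂ a₁ a₂ hf hg hr1 hr2 hA1 hA2 hfc hgc
  set s : Set (ℝ × ℝ) := Set.Ici (min r₁ r₂) ×ˢ Set.Icc a₁ a₂ with hs
  have hfar : ∀ x ∈ s, max R R₁ < x.1 := fun x hx => (lt_min hr1 hr2).trans_le hx.1
  set P : Vertex → Prop := fun v =>
    ∃ r A, min r₁ r₂ ≤ r ∧ A ∈ Set.Icc a₁ a₂ ∧ ‖pos v - pol b r A‖ ≤ 200 with hP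
  let Near : ℝ × ℝ → Face → ℝ → Prop := fun x f A => f.color = c ∧
    ‖f.center - pol b x.1 x.2‖ ≤ 3 ∧ AtAngle b f A ∧ |A - x.2| < Real.pi / 8
  have hex : ∀ x ∈ s, ∃ f A, Near x f A := by
    intro x hx
    obtain ⟨f, hf, hfx⟩ := exists_face_near c (pol b x.1 x.2)
    obtain ⟨A, hA, hA'⟩ := hlift b f.center x.1 x.2 ((le_max_right _ _).trans_lt (hfar x hx)) hfx
    exact ⟨f, A, hf, hfx, hA', hA⟩
  let Q : ℝ × ℝ → ℝ × ℝ → Prop := fun x y => ∀ f A g A', Near x f A → Near y g A' →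
    Linked c τ P f g (N A + N A')
  have hpre : IsPreconnected s := (convex_Ici _).isPreconnected.prod (convex_Icc _ _).isPreconnected
  have hQ : Q (r₁, A₁) (r₂, A₂) := by
    refine hpre.induction₂ Q ?_ ?_ ?_ (x := (r₁, A₁)) (y := (r₂, A₂))
      ⟨Set.mem_Ici.mpr (min_le_left _ _), hA1⟩
      ⟨Set.mem_Ici.mpr (min_le_right _ _), hA2⟩
    · intro x hx
      have hc : Continuous fun y : ℝ × ℝ => pol b y.1 y.2 := by unfold pol; fun_prop
      have e1 : ∀ᶠ y in 𝓝 x, ‖pol b y.1 y.2 - pol b x.1 x.2‖ < 1 :=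
        Metric.eventually_nhds_iff.mpr (by
          simpa [dist_eq_norm] using Metric.continuous_iff.mp hc x 1 one_pos)
      have e2 : ∀ᶠ y : ℝ × ℝ in 𝓝 x, |y.2 - x.2| < Real.pi / 8 :=
        Metric.eventually_nhds_iff.mpr (by
          simpa [Real.dist_eq] using
            Metric.continuous_iff.mp continuous_snd x (Real.pi / 8) (by positivity))
      filter_upwards [nhdsWithin_le_nhds e1, nhdsWithin_le_nhds e2] with y hy1 hy2 f A g A' hfn hgn
      obtain ⟨hf1, hf2, hf3, hf4⟩ := hfn
      obtain ⟨hg1, hg2, hg3, hg4⟩ := hgn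
      refine (hR x.1 x.2 ((le_max_left _ _).trans_lt (hfar x hx)) f g hf1 hg1 (by linarith) ?_
        A A' hf3 hg3 (by linarith [Real.pi_pos]) ?_).mono ?_
      · have := norm_add_le (g.center - pol b y.1 y.2) (pol b y.1 y.2 - pol b x.1 x.2)
        rw [sub_add_sub_cancel] at this
        linarith
      · have := abs_add_le (A' - y.2) (y.2 - x.2)
        rw [sub_add_sub_cancel] at this
        linarith
      · exact fun v hv => ⟨x.1, x.2, hx.1, hx.2, hv⟩
    · intro x y z _ hy _ hxy hyz f A g A' hfn hgn
      obtain ⟨k, B, hk⟩ := hex y hy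
      convert (hxy f A k B hfn hk).trans (hyz k B g A' hk hgn) using 1
      linear_combination -(zmod_two_add_self (N B))
    · intro x y _ _ hxy f A g A' hfn hgn
      rw [add_comm]
      exact (hxy g A' f A hgn hfn).symm
  have hp := Real.pi_pos
  refine hQ f A₁ g A₂ ⟨hf, ?_, atAngle_of_eq ((hR0.trans (le_max_left _ _)).trans hr1.le) hfc, ?_⟩
    ⟨hg, ?_, atAngle_of_eq ((hR0.trans (le_max_left _ _)).trans hr2.le) hgc, ?_⟩
  · simp [hfc]
  · simpa using by positivity
  · simp [hgc]
  · simpa using by positivity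

/-! ## The half line above a face -/

/-- The vertical half line of vertices that starts at the top of the face `f`. -/
def Face.above (f : Face) : Config := fun v => if v.1 = f.x + 1 ∧ f.y + 1 ≤ v.2 then 1 else 0

theorem Face.bdry_above (f h : Face) : bdry f.above h = ind f h := by
  have hf := f.odd_mod
  have hh := h.odd_mod
  by_cases he : h = f
  · subst he
    simp [bdry_eq, Face.above, ind]
  · have hne : ¬ (h.x = f.x ∧ h.y = f.y) := fun hk => he (Face.ext' hk.1 hk.2)
    rw [ind, if_neg he, bdry_eq]
    simp only [Face.above]
    split_ifs <;> first | (exfalso; omega) | decide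

/-- The parity of the number of times that the direction `α` has passed the vertical. -/
def turn (α : ℝ) : ZMod 2 := (⌊(α - Real.pi / 2) / (2 * Real.pi)⌋ : ℤ)

theorem turn_add_two_pi (α : ℝ) : turn (α + 2 * Real.pi) = turn α + 1 := by
  have e : (α + 2 * Real.pi - Real.pi / 2) / (2 * Real.pi)
      = (α - Real.pi / 2) / (2 * Real.pi) + 1 := by
    field_simp; ring
  rw [turn, e, Int.floor_add_one, turn]
  push_cast; rfl

theorem turn_cases {A A' : ℝ} (h : |A - A'| < Real.pi / 2) :
    ∃ B B', 0 ≤ B ∧ B < 2 * Real.pi ∧ |B - B'| < Real.pi / 2 ∧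
      Real.cos A = -Real.sin B ∧ Real.cos A' = -Real.sin B' ∧
      Real.sin A = Real.cos B ∧ Real.sin A' = Real.cos B' ∧
      (0 ≤ B' → B' < 2 * Real.pi → turn A' = turn A) ∧
      ((B' < 0 ∨ 2 * Real.pi ≤ B') → turn A' = turn A + 1) := by
  have hp := Real.pi_pos
  set n := ⌊(A - Real.pi / 2) / (2 * Real.pi)⌋ with hn
  have h1 := Int.floor_le ((A - Real.pi / 2) / (2 * Real.pi))
  have h2 := Int.lt_floor_add_one ((A - Real.pi / 2) / (2 * Real.pi))
  rw [← hn, le_div_iff₀ (by positivity)] at h1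
  rw [← hn, div_lt_iff₀ (by positivity)] at h2
  have hcos : ∀ x, Real.cos x = -Real.sin (x - Real.pi / 2 - n * (2 * Real.pi)) := by
    intro x
    rw [Real.sin_sub_int_mul_two_pi, Real.sin_sub_pi_div_two, neg_neg]
  have hsin : ∀ x, Real.sin x = Real.cos (x - Real.pi / 2 - n * (2 * Real.pi)) := by
    intro x
    rw [Real.cos_sub_int_mul_two_pi, Real.cos_sub_pi_div_two]
  have hturn : ∀ m : ℤ, m * (2 * Real.pi) ≤ A' - Real.pi / 2 - n * (2 * Real.pi) →
      A' - Real.pi / 2 - n * (2 * Real.pi) < (m + 1) * (2 * Real.pi) → turn A' = turn A + m := by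
    intro m hm1 hm2
    have : ⌊(A' - Real.pi / 2) / (2 * Real.pi)⌋ = n + m := by
      rw [Int.floor_eq_iff, le_div_iff₀ (by positivity), div_lt_iff₀ (by positivity)]
      push_cast
      constructor <;> linarith
    rw [turn, this, turn, ← hn]
    push_cast; rfl
  have habs := h
  rw [abs_lt] at habs
  refine ⟨A - Real.pi / 2 - n * (2 * Real.pi), A' - Real.pi / 2 - n * (2 * Real.pi),
    by linarith, by linarith, by convert h using 2; ring, hcos A, hcos A', hsin A, hsin A',
    fun h3 h4 => ?_, fun h3 => ?_⟩
  · simpa using hturn 0 (by simpa using h3) (by simpa using h4)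
  · rcases h3 with h3 | h3
    · have := hturn (-1) (by push_cast; linarith) (by push_cast; linarith)
      rw [this]
      push_cast
      rw [show (-1 : ZMod 2) = 1 by decide]
    · simpa using hturn 1 (by push_cast; linarith) (by push_cast; linarith)

theorem turn_eq_of_cos {A A' : ℝ} (h : |A - A'| < Real.pi / 2)
    (hc : 0 < Real.cos A * Real.cos A') : turn A + turn A' = 0 := by
  have hp := Real.pi_pos
  obtain ⟨B, B', h1, h2, h3, h4, h5, -, -, h6, -⟩ := turn_cases h
  rw [h4, h5, neg_mul_neg] at hc
  rw [abs_lt] at h3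
  rw [h6, zmod_two_add_self]
  · by_contra! hB
    have := Real.sin_neg_of_neg_of_neg_pi_lt hB (by linarith)
    have := Real.sin_nonneg_of_nonneg_of_le_pi h1 (by linarith)
    nlinarith
  · by_contra! hB
    have e1 : Real.sin B' = Real.sin (B' - 2 * Real.pi) := (Real.sin_sub_two_pi B').symm
    have e2 : Real.sin B = Real.sin (B - 2 * Real.pi) := (Real.sin_sub_two_pi B).symm
    have := Real.sin_nonneg_of_nonneg_of_le_pi (x := B' - 2 * Real.pi) (by linarith) (by linarith)
    have := Real.sin_neg_of_neg_of_neg_pi_lt (x := B - 2 * Real.pi) (by linarith) (by linarith)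
    nlinarith

theorem turn_eq_of_sin {A A' : ℝ} (h : |A - A'| < Real.pi / 2)
    (hs : Real.sin A < 0) : turn A + turn A' = 0 := by
  have hp := Real.pi_pos
  obtain ⟨B, B', h1, h2, h3, -, -, h4, h5, h6, -⟩ := turn_cases h
  rw [h4] at hs
  rw [abs_lt] at h3
  have hB1 : Real.pi / 2 < B := by
    by_contra! hB
    exact absurd (Real.cos_nonneg_of_neg_pi_div_two_le_of_le (by linarith) hB) (not_le.mpr hs)
  have hB2 : B < 3 * Real.pi / 2 := by
    by_contra! hB
    have e2 : Real.cos B = Real.cos (B - 2 * Real.pi) := (Real.cos_sub_two_pi B).symm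
    rw [e2] at hs
    exact absurd (Real.cos_nonneg_of_neg_pi_div_two_le_of_le (by linarith) (by linarith))
      (not_le.mpr hs)
  rw [h6 (by linarith) (by linarith), zmod_two_add_self]

theorem turn_ne_of_sin {A A' : ℝ} (h : |A - A'| < Real.pi / 2)
    (hc : Real.cos A * Real.cos A' < 0) (hs : 0 < Real.sin A) (hs' : 0 < Real.sin A') :
    turn A + turn A' = 1 := by
  have hp := Real.pi_pos
  obtain ⟨B, B', h1, h2, h3, h4, h5, h6, h7, -, h8⟩ := turn_cases h
  rw [h4, h5, neg_mul_neg] at hc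
  rw [h6] at hs
  rw [h7] at hs'
  rw [abs_lt] at h3
  suffices hB : B' < 0 ∨ 2 * Real.pi ≤ B' by
    rw [h8 hB, ← add_assoc, zmod_two_add_self, zero_add]
  by_contra! hB
  have hcase : ∀ x, 0 ≤ x → x < 2 * Real.pi → 0 < Real.cos x →
      x < Real.pi / 2 ∧ 0 ≤ Real.sin x ∨ 3 * Real.pi / 2 < x ∧ Real.sin x ≤ 0 := by
    intro x hx1 hx2 hx3
    rcases lt_or_ge x (Real.pi / 2) with hx | hx
    · exact Or.inl ⟨hx, Real.sin_nonneg_of_nonneg_of_le_pi hx1 (by linarith)⟩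
    · right
      rcases le_or_gt x (3 * Real.pi / 2) with hx4 | hx4
      · exact absurd (Real.cos_nonpos_of_pi_div_two_le_of_le hx (by linarith)) (not_le.mpr hx3)
      · refine ⟨hx4, ?_⟩
        rw [← Real.sin_sub_two_pi]
        exact Real.sin_nonpos_of_nonpos_of_neg_pi_le (by linarith) (by linarith)
  rcases hcase B h1 h2 hs with ⟨c1, c2⟩ | ⟨c1, c2⟩ <;>
    rcases hcase B' hB.1 hB.2 hs' with ⟨d1, d2⟩ | ⟨d1, d2⟩
  · nlinarith
  · linarith
  · linarith
  · nlinarith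

theorem turnsAt_above {c : Color} {f₀ : Face} (hc : f₀.color ≠ c) :
    TurnsAt c f₀.above f₀.center turn := by
  refine ⟨10, fun f g v w A A' hf he hfr hgr hA hA' hAA => ?_⟩
  have hcoord : ∀ (k : Face) (B : ℝ), AtAngle f₀.center k B →
      (k.x : ℝ) - f₀.x = ‖k.center - f₀.center‖ * Real.cos B ∧
      (k.y : ℝ) - f₀.y = ‖k.center - f₀.center‖ * Real.sin B := by
    intro k B hk
    rw [AtAngle, pol] at hk
    have h1 := congrArg Complex.re hk
    have h2 := congrArg Complex.im hk
    rw [Complex.add_re, Complex.re_ofReal_mul, Complex.exp_ofReal_mul_I_re] at h1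
    rw [Complex.add_im, Complex.im_ofReal_mul, Complex.exp_ofReal_mul_I_im] at h2
    simp only [Face.center] at h1 h2 ⊢
    constructor <;> linarith
  obtain ⟨hx, hy⟩ := hcoord f A hA
  obtain ⟨hx', hy'⟩ := hcoord g A' hA'
  set r := ‖f.center - f₀.center‖
  set r' := ‖g.center - f₀.center‖
  have hr : 10 < |(f.x : ℝ) - f₀.x| + |(f.y : ℝ) - f₀.y| := by
    refine hfr.trans_le ?_
    refine (Complex.norm_le_abs_re_add_abs_im _).trans (le_of_eq ?_)
    simp [Face.center]
  have hrI : 10 < |f.x - f₀.x| + |f.y - f₀.y| := by exact_mod_cast hr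
  have hcol : f.x % 3 ≠ f₀.x % 3 := fun h => hc (by rw [← hf, ← color_eq_iff.mpr h])
  have hcol' : g.x % 3 ≠ f₀.x % 3 := fun h => hc (by
    rw [← hf, he.color, ← color_eq_iff.mpr h])
  have hr0 : (0 : ℝ) < r := by linarith
  have hr0' : (0 : ℝ) < r' := by linarith
  have hcc : (((f.x - f₀.x) * (g.x - f₀.x) : ℤ) : ℝ) = (r * r') * (Real.cos A * Real.cos A') := by
    push_cast
    rw [hx, hx']; ring
  have hpair : pair f₀.above (edge v w) = f₀.above v + f₀.above w := by
    rw [edge, map_add, pair_single, pair_single]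
  rw [hpair]
  by_cases hpos : 0 < (f.x - f₀.x) * (g.x - f₀.x)
  · have h1 : 0 < Real.cos A * Real.cos A' := by
      have : (0 : ℝ) < (((f.x - f₀.x) * (g.x - f₀.x) : ℤ) : ℝ) := by exact_mod_cast hpos
      rw [hcc] at this
      exact pos_of_mul_pos_right this (by positivity)
    rw [turn_eq_of_cos hAA h1]
    have h2 : v.1 ≠ f₀.x + 1 ∧ w.1 ≠ f₀.x + 1 := by
      rcases mul_pos_iff.mp hpos with ⟨p1, p2⟩ | ⟨p1, p2⟩ <;>
        rcases he.cases with ⟨q1, -⟩ | ⟨q1, -⟩ | ⟨q1, -⟩ <;> constructor <;> intro h3 <;> omega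
    simp [Face.above, h2.1, h2.2]
  have hneg : (f.x - f₀.x) * (g.x - f₀.x) < 0 := by
    refine lt_of_le_of_ne (not_lt.mp hpos) fun h0 => ?_
    rcases mul_eq_zero.mp h0 with h0 | h0 <;> omega
  have h1 : Real.cos A * Real.cos A' < 0 := by
    have : (((f.x - f₀.x) * (g.x - f₀.x) : ℤ) : ℝ) < 0 := by exact_mod_cast hneg
    rw [hcc] at this
    by_contra! h2
    exact absurd this (not_lt.mpr (mul_nonneg (by positivity) h2))
  have hsides : (0 < f.x - f₀.x ∧ f.x - f₀.x ≤ 2 ∧ g.x = f.x - 3 ∨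
      f.x - f₀.x < 0 ∧ -2 ≤ f.x - f₀.x ∧ g.x = f.x + 3) := by
    rcases mul_neg_iff.mp hneg with ⟨p1, p2⟩ | ⟨p1, p2⟩ <;>
      rcases he.cases with ⟨q1, -⟩ | ⟨q1, -⟩ | ⟨q1, -⟩ <;> omega
  have hux : |f.x - f₀.x| ≤ 2 := abs_le.mpr (by omega)
  have hgy : f.y - 1 ≤ g.y ∧ g.y ≤ f.y + 1 ∧ f.y ≤ v.2 ∧ v.2 ≤ f.y + 1 ∧ w.2 = v.2 := by
    rcases he.cases with ⟨q1, q2⟩ | ⟨q1, q2⟩ | ⟨q1, q2⟩ <;> omega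
  have hone : (v.1 = f₀.x + 1 ∧ w.1 ≠ f₀.x + 1) ∨ (v.1 ≠ f₀.x + 1 ∧ w.1 = f₀.x + 1) := by
    rcases he.cases with ⟨q1, -⟩ | ⟨q1, -⟩ | ⟨q1, -⟩ <;> omega
  rcases le_total 0 (f.y - f₀.y) with hy0 | hy0
  · rw [abs_of_nonneg hy0] at hrI
    have hs : 0 < Real.sin A := by
      have : (0 : ℝ) < (f.y : ℝ) - f₀.y := by
        rw [sub_pos]; exact_mod_cast (by omega : f₀.y < f.y)
      rw [hy] at this
      exact pos_of_mul_pos_right this hr0.le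
    have hs' : 0 < Real.sin A' := by
      have : (0 : ℝ) < (g.y : ℝ) - f₀.y := by
        rw [sub_pos]; exact_mod_cast (by omega : f₀.y < g.y)
      rw [hy'] at this
      exact pos_of_mul_pos_right this hr0'.le
    rw [turn_ne_of_sin hAA h1 hs hs']
    have hv2 : f₀.y + 1 ≤ v.2 := by omega
    rw [Face.above, Face.above, hgy.2.2.2.2]
    rcases hone with ⟨p1, p2⟩ | ⟨p1, p2⟩ <;> simp [p1, p2, hv2]
  · rw [abs_of_nonpos hy0] at hrI
    have hs : Real.sin A < 0 := by
      have : (f.y : ℝ) - f₀.y < 0 := by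
        rw [sub_neg]; exact_mod_cast (by omega : f.y < f₀.y)
      rw [hy] at this
      by_contra! h2
      exact absurd this (not_lt.mpr (mul_nonneg hr0.le h2))
    rw [turn_eq_of_sin hAA hs]
    have hv2 : ¬ f₀.y + 1 ≤ v.2 := by omega
    simp [Face.above, hgy.2.2.2.2, hv2]

/-! ## Rays -/

theorem exists_cedge_shift (f : Face) (a b : ℤ) (h : |a| + |b| = 1) :
    ∃ v w, CEdge f (f.shift a b) v w := by
  have : (a = 1 ∧ b = 0) ∨ (a = 0 ∧ b = 1) ∨ (a = -1 ∧ b = 0) ∨ (a = 0 ∧ b = -1) := by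
    rcases abs_cases a with h1 | h1 <;> rcases abs_cases b with h2 | h2 <;> omega
  rcases this with ⟨rfl, rfl⟩ | ⟨rfl, rfl⟩ | ⟨rfl, rfl⟩ | ⟨rfl, rfl⟩
  · exact ⟨_, _, cedge_up f⟩
  · exact ⟨_, _, cedge_down f⟩
  · have := cedge_up (f.shift (-1) 0)
    rw [f.shift_shift] at this
    simp only [neg_add_cancel, add_zero, Face.shift_zero] at this
    exact ⟨_, _, this.symm⟩
  · have := cedge_down (f.shift 0 (-1))
    rw [f.shift_shift] at this
    simp only [neg_add_cancel, add_zero, Face.shift_zero] at this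
    exact ⟨_, _, this.symm⟩

theorem exists_halfString {c : Color} (face : ℕ → Face) (hc : ∀ i, (face i).color = c)
    (hinj : Function.Injective face)
    (he : ∀ i, ∃ v w, CEdge (face i) (face (i + 1)) v w) :
    ∃ γ : HalfString c, γ.face = face := by
  choose v w hvw using he
  let vert : ℕ → Vertex := fun j => if j % 2 = 0 then v (j / 2) else w (j / 2)
  have h0 : ∀ i, vert (2 * i) = v i := fun i => by
    simp only [vert]
    rw [if_pos (by omega), show 2 * i / 2 = i by omega]
  have h1 : ∀ i, vert (2 * i + 1) = w i := fun i => by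
    simp only [vert]
    rw [if_neg (by omega), show (2 * i + 1) / 2 = i by omega]
  have huniq : ∀ {u : Vertex} {i j : ℕ}, u ∈ (face i).boundary → u ∈ (face j).boundary → i = j :=
    fun hi hj => hinj (face_unique hi hj (by rw [hc, hc]))
  have hne : ∀ i j, v i ≠ w j := by
    intro i j hij
    have hi := (hvw i).left
    rw [hij] at hi
    obtain rfl := huniq hi (hvw j).right
    have h2 := hvw (j + 1)
    rw [hij] at h2
    have h3 := (hvw j).symm.partner_unique h2
    have h4 := (hvw j).left
    rw [h3] at h4
    have := huniq h4 h2.right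
    omega
  refine ⟨⟨face, vert, hc, fun i => (hvw i).ne, fun i => ?_, fun i => ?_, fun i => ?_, ?_⟩, rfl⟩
  · rw [h0]; exact (hvw i).left
  · rw [h1]; exact (hvw i).right
  · rw [h0, h1]; exact (hvw i).adj
  · intro j j' hj
    obtain ⟨i, rfl | rfl⟩ := j.even_or_odd' <;> obtain ⟨i', rfl | rfl⟩ := j'.even_or_odd'
    · rw [h0, h0] at hj
      have hm := (hvw i).left
      rw [hj] at hm
      rw [huniq hm (hvw i').left]
    · rw [h0, h1] at hj
      exact absurd hj (hne _ _)
    · rw [h0, h1] at hj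
      exact absurd hj.symm (hne _ _)
    · rw [h1, h1] at hj
      have hm := (hvw i).right
      rw [hj] at hm
      have := huniq hm (hvw i').right
      omega

theorem floor_succ_cases {p : ℝ} (h0 : 0 ≤ p) (h1 : p ≤ 1) (i : ℕ) :
    ⌊((i + 1 : ℕ) : ℝ) * p⌋ = ⌊(i : ℝ) * p⌋ ∨ ⌊((i + 1 : ℕ) : ℝ) * p⌋ = ⌊(i : ℝ) * p⌋ + 1 := by
  have h2 : ⌊(i : ℝ) * p⌋ ≤ ⌊((i + 1 : ℕ) : ℝ) * p⌋ :=
    Int.floor_le_floor (by push_cast; nlinarith)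
  have h3 : ⌊((i + 1 : ℕ) : ℝ) * p⌋ ≤ ⌊(i : ℝ) * p⌋ + 1 := by
    rw [← Int.floor_add_one]
    exact Int.floor_le_floor (by push_cast; linarith)
  omega

/-- A sequence of steps between faces that follows a half line. -/
theorem exists_face_ray (f : Face) (ψ : ℝ) : ∃ (face : ℕ → Face) (s : ℝ), 0 < s ∧
    (∀ i, (face i).color = f.color) ∧ Function.Injective face ∧
    (∀ i, ∃ v w, CEdge (face i) (face (i + 1)) v w) ∧
    ∀ i : ℕ, ‖(face i).center - (f.center + (i * s : ℝ) * Complex.exp (ψ * Complex.I))‖ ≤ 8 := by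
  set α := Real.cos ψ / 3 + Real.sin ψ with hα
  set β := Real.cos ψ / 3 - Real.sin ψ with hβ
  have hpos : 0 < |α| + |β| := by
    by_contra! h
    have h1 : α = 0 := abs_eq_zero.mp (by linarith [abs_nonneg α, abs_nonneg β])
    have h2 : β = 0 := abs_eq_zero.mp (by linarith [abs_nonneg α, abs_nonneg β])
    have h3 := Real.sin_sq_add_cos_sq ψ
    have h4 : Real.cos ψ = 0 := by linarith
    have h5 : Real.sin ψ = 0 := by linarith
    rw [h4, h5] at h3
    norm_num at h3
  set p := |α| / (|α| + |β|) with hp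
  have hp0 : 0 ≤ p := by positivity
  have hp1 : p ≤ 1 := by
    rw [hp, div_le_one hpos]; linarith [abs_nonneg β]
  have hsign : ∀ y : ℝ, ∃ σ : ℤ, (σ = 1 ∨ σ = -1) ∧ σ * |y| = y := by
    intro y
    rcases le_total 0 y with h | h
    · exact ⟨1, Or.inl rfl, by simp [abs_of_nonneg h]⟩
    · exact ⟨-1, Or.inr rfl, by simp [abs_of_nonpos h]⟩
  obtain ⟨σ, hσ, hσα⟩ := hsign α
  obtain ⟨σ', hσ', hσβ⟩ := hsign β
  set n : ℕ → ℤ := fun i => ⌊(i : ℝ) * p⌋ with hn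
  have hn0 : ∀ i, 0 ≤ n i := fun i => Int.floor_nonneg.mpr (by positivity)
  have hni : ∀ i : ℕ, n i ≤ i := fun i => by
    have : (n i : ℝ) ≤ i := (Int.floor_le _).trans (mul_le_of_le_one_right (by positivity) hp1)
    exact_mod_cast this
  refine ⟨fun i => f.shift (σ * n i) (σ' * (i - n i)), 2 / (|α| + |β|), by positivity,
    fun i => f.shift_color _ _, ?_, ?_, ?_⟩
  · intro i j hij
    have h1 := congrArg Face.x hij
    have h2 := congrArg Face.y hij
    simp only [Face.shift] at h1 h2
    have h3 : σ * n i = σ * n j := by linarith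
    have h4 : σ' * (i - n i) = σ' * (j - n j) := by linarith
    have h5 : n i = n j := by rcases hσ with rfl | rfl <;> linarith
    rw [h5] at h4
    have h6 : (i : ℤ) = j := by rcases hσ' with rfl | rfl <;> linarith
    exact_mod_cast h6
  · intro i
    have habs : ∀ {τ : ℤ}, (τ = 1 ∨ τ = -1) → |τ| = 1 := by
      rintro τ (rfl | rfl) <;> rfl
    rcases floor_succ_cases hp0 hp1 i with h | h
    · have := exists_cedge_shift (f.shift (σ * n i) (σ' * (i - n i))) 0 σ'
        (by rw [abs_zero, zero_add, habs hσ'])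
      rw [f.shift_shift] at this
      have e1 : n (i + 1) = n i := h
      have e2 : f.shift (σ * n (i + 1)) (σ' * ((i + 1 : ℕ) - n (i + 1)))
          = f.shift (σ * n i + 0) (σ' * (i - n i) + σ') := by
        rw [e1]; congr 1 <;> push_cast <;> ring
      rwa [← e2] at this
    · have := exists_cedge_shift (f.shift (σ * n i) (σ' * (i - n i))) σ 0
        (by rw [abs_zero, add_zero, habs hσ])
      rw [f.shift_shift] at this
      have e1 : n (i + 1) = n i + 1 := h
      have e2 : f.shift (σ * n (i + 1)) (σ' * ((i + 1 : ℕ) - n (i + 1)))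
          = f.shift (σ * n i + σ) (σ' * (i - n i) + 0) := by
        rw [e1]; congr 1 <;> push_cast <;> ring
      rwa [← e2] at this
  · intro i
    set δ : ℝ := i * p - n i with hδ
    have hδ0 : 0 ≤ δ := by linarith [Int.floor_le ((i : ℝ) * p)]
    have hδ1 : δ ≤ 1 := by linarith [Int.lt_floor_add_one ((i : ℝ) * p)]
    have e1 : σ * (i * p) = i / (|α| + |β|) * α := by
      rw [hp]; linear_combination (i / (|α| + |β|)) * hσα
    have e2 : σ' * (i * (1 - p)) = i / (|α| + |β|) * β := by
      have hp' : 1 - p = |β| / (|α| + |β|) := by rw [hp]; field_simp; ring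
      rw [hp']; linear_combination (i / (|α| + |β|)) * hσβ
    have hσabs : |(σ : ℝ)| = 1 := by rcases hσ with rfl | rfl <;> simp
    have hσabs' : |(σ' : ℝ)| = 1 := by rcases hσ' with rfl | rfl <;> simp
    have hb : |(σ : ℝ) * δ| ≤ 1 := by rwa [abs_mul, hσabs, one_mul, abs_of_nonneg hδ0]
    have hb' : |(σ' : ℝ) * δ| ≤ 1 := by rwa [abs_mul, hσabs', one_mul, abs_of_nonneg hδ0]
    rw [abs_le] at hb hb'
    rw [f.center_shift]
    refine (norm_le_of_abs (a := 6) (b := 2) ?_ ?_).trans (by norm_num)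
    · have : (f.center + ⟨3 * ((σ * n i : ℤ) + (σ' * (i - n i) : ℤ)),
          (σ * n i : ℤ) - (σ' * (i - n i) : ℤ)⟩ - (f.center + ((i * (2 / (|α| + |β|)) : ℝ) : ℂ) *
          Complex.exp (ψ * Complex.I))).re = 3 * (σ' * δ - σ * δ) := by
        rw [Complex.sub_re, Complex.add_re, Complex.add_re, Complex.re_ofReal_mul,
          Complex.exp_ofReal_mul_I_re]
        simp only
        push_cast
        have e3 : Real.cos ψ = 3 / 2 * (α + β) := by rw [hα, hβ]; ring
        rw [hδ, e3]
        linear_combination 3 * e1 + 3 * e2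
      rw [this, abs_le]
      constructor <;> linarith
    · have : (f.center + ⟨3 * ((σ * n i : ℤ) + (σ' * (i - n i) : ℤ)),
          (σ * n i : ℤ) - (σ' * (i - n i) : ℤ)⟩ - (f.center + ((i * (2 / (|α| + |β|)) : ℝ) : ℂ) *
          Complex.exp (ψ * Complex.I))).im = -(σ' * δ) - σ * δ := by
        rw [Complex.sub_im, Complex.add_im, Complex.add_im, Complex.im_ofReal_mul,
          Complex.exp_ofReal_mul_I_im]
        simp only
        push_cast
        have e3 : Real.sin ψ = 1 / 2 * (α - β) := by rw [hα, hβ]; ring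
        rw [hδ, e3]
        linear_combination e1 - e2
      rw [this, abs_le]
      constructor <;> linarith

theorem exists_ray (c : Color) (b : ℂ) (ψ R : ℝ) {η : ℝ} (hη : 0 < η) : ∃ γ : HalfString c,
    (∀ j, ∃ r A, R < r ∧ |A - ψ| < η ∧ pos (γ.vert j) = pol b r A) ∧
    ∀ i, ∃ r A, R < r ∧ |A - ψ| < η ∧ (γ.face i).center = pol b r A := by
  obtain ⟨R₀, hR0, hR⟩ := exists_angle 13 hη
  set r₀ := max R R₀ + 14 with hr0
  have hrR : R + 14 ≤ r₀ := by rw [hr0]; linarith [le_max_left R R₀]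
  have hrR0 : R₀ + 14 ≤ r₀ := by rw [hr0]; linarith [le_max_right R R₀]
  obtain ⟨f, hf, hfc⟩ := exists_face_near c (pol b r₀ ψ)
  obtain ⟨face, s, hs, hcol, hinj, hedge, hnear⟩ := exists_face_ray f ψ
  obtain ⟨γ, rfl⟩ := exists_halfString face (fun i => (hcol i).trans hf) hinj hedge
  have hclose : ∀ i : ℕ, ‖(γ.face i).center - pol b (r₀ + i * s) ψ‖ ≤ 11 := by
    intro i
    have e : (γ.face i).center - pol b (r₀ + i * s) ψ
        = ((γ.face i).center - (f.center + (i * s : ℝ) * Complex.exp (ψ * Complex.I)))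
          + (f.center - pol b r₀ ψ) := by
      rw [pol, pol]; push_cast; ring
    rw [e]
    exact (norm_add_le _ _).trans (by linarith [hnear i])
  have hpt : ∀ (z : ℂ) (i : ℕ), ‖z - (γ.face i).center‖ ≤ 2 →
      ∃ r A, R < r ∧ |A - ψ| < η ∧ z = pol b r A := by
    intro z i hz
    have hr : r₀ ≤ r₀ + i * s := by
      have : 0 ≤ i * s := by positivity
      linarith
    have hz2 : ‖z - pol b (r₀ + i * s) ψ‖ ≤ 13 := by
      have := norm_add_le (z - (γ.face i).center) ((γ.face i).center - pol b (r₀ + i * s) ψ)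
      rw [sub_add_sub_cancel] at this
      linarith [hclose i]
    obtain ⟨A, hA, hzA⟩ := hR b z (r₀ + i * s) ψ (by linarith) hz2
    refine ⟨‖z - b‖, A, ?_, hA, hzA⟩
    have h1 := norm_sub_norm_le (pol b (r₀ + i * s) ψ - b) (z - b)
    rw [norm_pol_sub b (by linarith), sub_sub_sub_cancel_right, norm_sub_rev _ z] at h1
    linarith
  refine ⟨γ, fun j => ?_, fun i => hpt _ i (by simp)⟩
  obtain ⟨i, rfl | rfl⟩ := j.even_or_odd'
  · exact hpt _ i (norm_pos_sub_center (γ.start_mem i))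
  · exact hpt _ (i + 1) (norm_pos_sub_center (γ.end_mem i))

/-! ## Joining half-infinite strings -/

theorem finite_ball (b : ℂ) (R : ℝ) : {v : Vertex | ‖pos v - b‖ ≤ R}.Finite := by
  refine Set.Finite.subset ((Set.finite_Icc ⌊b.re - R⌋ ⌈b.re + R⌉).prod
    (Set.finite_Icc ⌊b.im - R⌋ ⌈b.im + R⌉)) fun v hv => ?_
  have h1 := abs_le.mp ((Complex.abs_re_le_norm _).trans hv)
  have h2 := abs_le.mp ((Complex.abs_im_le_norm _).trans hv)
  simp only [pos, Complex.sub_re, Complex.sub_im] at h1 h2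
  refine ⟨⟨?_, ?_⟩, ⟨?_, ?_⟩⟩
  · exact Int.cast_le.mp ((Int.floor_le _).trans (by linarith) : _ ≤ (v.1 : ℝ))
  · exact Int.cast_le.mp ((by linarith : (v.1 : ℝ) ≤ _).trans (Int.le_ceil _))
  · exact Int.cast_le.mp ((Int.floor_le _).trans (by linarith) : _ ≤ (v.2 : ℝ))
  · exact Int.cast_le.mp ((by linarith : (v.2 : ℝ) ≤ _).trans (Int.le_ceil _))

theorem tendsto_min_atTop {f g : ℕ → ℝ} (hf : Tendsto f atTop atTop) (hg : Tendsto g atTop atTop) :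
    Tendsto (fun m => min (f m) (g m)) atTop atTop := by
  refine tendsto_atTop.mpr fun R => ?_
  filter_upwards [tendsto_atTop.mp hf R, tendsto_atTop.mp hg R] with m h1 h2
  exact le_min h1 h2

section Strings

variable {c : Color}

theorem HalfString.tendsto_vert (γ : HalfString c) (b : ℂ) :
    Tendsto (fun j => ‖pos (γ.vert j) - b‖) atTop atTop := by
  refine tendsto_atTop.mpr fun R => ?_
  have := (((finite_ball b R).preimage γ.vert_injective.injOn).eventually_cofinite_notMem)
  rw [Nat.cofinite_eq_atTop] at this
  filter_upwards [this] with j hj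
  exact (not_le.mp hj).le

theorem HalfString.tendsto_start (γ : HalfString c) (b : ℂ) :
    Tendsto (fun i => ‖pos (γ.vert (2 * i)) - b‖) atTop atTop :=
  (γ.tendsto_vert b).comp (tendsto_id.const_mul_atTop' two_pos)

theorem HalfString.tendsto_face (γ : HalfString c) (b : ℂ) :
    Tendsto (fun i => ‖(γ.face i).center - b‖) atTop atTop := by
  refine tendsto_atTop_mono (f := fun i => ‖pos (γ.vert (2 * i)) - b‖ + (-2)) (fun i => ?_)
    (tendsto_atTop_add_const_right _ _ (γ.tendsto_start b))
  have h1 := norm_add_le (pos (γ.vert (2 * i)) - (γ.face i).center) ((γ.face i).center - b)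
  rw [sub_add_sub_cancel] at h1
  linarith [norm_pos_sub_center (γ.start_mem i)]

/-- The chains `Q m` join the ends of the initial segments of two half-infinite strings, further
and further away. -/
structure IsJoin (γ γ' : HalfString c) (m₀ : ℕ) (Q : ℕ → Chain) : Prop where
  orth : ∀ m, Orth c (Q m)
  bdry : ∀ m h, bdry (Q m) h = ind (γ.face (m + m₀)) h + ind (γ'.face (m + m₀)) h
  far : ∀ b R, ∀ᶠ m in atTop, ∀ v ∈ (Q m).support, R < ‖pos v - b‖

/-- The two initial segments together with the chain that joins their ends. -/
def path (γ γ' : HalfString c) (m₀ : ℕ) (Q : ℕ → Chain) (m : ℕ) : Chain :=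
  γ.chain (m + m₀) + Q m + γ'.chain (m + m₀)

variable {γ γ' : HalfString c} {m₀ : ℕ} {Q : ℕ → Chain}

theorem IsJoin.bdry_path (hj : IsJoin γ γ' m₀ Q) (m : ℕ) (h : Face) :
    ColorCode.bdry (path γ γ' m₀ Q m) h = ind (γ.face 0) h + ind (γ'.face 0) h := by
  rw [path, bdry_chain_add, bdry_chain_add, γ.bdry_chain, γ'.bdry_chain, hj.bdry]
  linear_combination ind_add_self (γ.face (m + m₀)) h + ind_add_self (γ'.face (m + m₀)) h

theorem IsJoin.orth_path (hj : IsJoin γ γ' m₀ Q) (m : ℕ) : Orth c (path γ γ' m₀ Q m) :=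
  ((γ.orth_chain _).add (hj.orth m)).add (γ'.orth_chain _)

theorem IsJoin.locTendsto (hj : IsJoin γ γ' m₀ Q) :
    LocTendsto (path γ γ' m₀ Q) atTop (γ.config + γ'.config) := by
  intro v
  have ha : Tendsto (fun m : ℕ => m + m₀) atTop atTop := tendsto_add_atTop_nat m₀
  filter_upwards [ha.eventually (γ.locTendsto_chain v), ha.eventually (γ'.locTendsto_chain v),
    hj.far (pos v) 0] with m h1 h2 h3
  have h4 : Q m v = 0 := by
    by_contra hne
    have := h3 v (Finsupp.mem_support_iff.mpr hne)
    simp at this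
  simp [path, h1, h2, h4]

theorem mem_support_path {m : ℕ} {v : Vertex} (h : v ∈ (path γ γ' m₀ Q m).support) :
    (∃ j, γ.vert j = v) ∨ v ∈ (Q m).support ∨ ∃ j, γ'.vert j = v := by
  rcases Finset.mem_union.mp (Finsupp.support_add h) with h | h
  · rcases Finset.mem_union.mp (Finsupp.support_add h) with h | h
    · exact Or.inl (γ.mem_support_chain h)
    · exact Or.inr (Or.inl h)
  · exact Or.inr (Or.inr (γ'.mem_support_chain h))

theorem exists_join {τ : Config} {b : ℂ} {P : Vertex → Prop} {e : ℕ → ZMod 2} {ρ : ℕ → ℝ}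
    (hρ : Tendsto ρ atTop atTop)
    (h : ∀ᶠ m in atTop, Linked c τ (fun v => P v ∧ ρ m ≤ ‖pos v - b‖) (γ.face m) (γ'.face m)
      (e m)) :
    ∃ m₀ Q, IsJoin γ γ' m₀ Q ∧ (∀ m, pair τ (Q m) = e (m + m₀)) ∧
      ∀ m, ∀ v ∈ (Q m).support, P v := by
  obtain ⟨m₀, hm₀⟩ := eventually_atTop.mp h
  choose Q h1 h2 h3 h4 using fun m => hm₀ (m + m₀) (Nat.le_add_left _ _)
  refine ⟨m₀, Q, ⟨h1, h2, fun b' R => ?_⟩, h4, fun m v hv => (h3 m v hv).1⟩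
  have ha : Tendsto (fun m : ℕ => ρ (m + m₀)) atTop atTop := hρ.comp (tendsto_add_atTop_nat m₀)
  filter_upwards [ha.eventually_gt_atTop (R + ‖b' - b‖)] with m hm v hv
  have h5 := norm_add_le (pos v - b') (b' - b)
  rw [sub_add_sub_cancel] at h5
  linarith [(h3 m v hv).2]

theorem exists_ring_join {τ : Config} {b : ℂ} {N : ℝ → ZMod 2} (hN : TurnsAt c τ b N)
    {A A' : ℕ → ℝ} {a₁ a₂ : ℝ} (R : ℝ)
    (hA : ∀ᶠ m in atTop, AtAngle b (γ.face m) (A m) ∧ A m ∈ Set.Icc a₁ a₂)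
    (hA' : ∀ᶠ m in atTop, AtAngle b (γ'.face m) (A' m) ∧ A' m ∈ Set.Icc a₁ a₂) :
    ∃ m₀ Q, IsJoin γ γ' m₀ Q ∧ (∀ m, pair τ (Q m) = N (A (m + m₀)) + N (A' (m + m₀))) ∧
      ∀ m, ∀ v ∈ (Q m).support,
        ∃ r B, R < r ∧ B ∈ Set.Icc a₁ a₂ ∧ ‖pos v - pol b r B‖ ≤ 200 := by
  obtain ⟨R₀, hR0, hR⟩ := exists_ring hN
  refine exists_join (b := b) (e := fun m => N (A m) + N (A' m))
    (ρ := fun m => min ‖(γ.face m).center - b‖ ‖(γ'.face m).center - b‖ + (-200))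
    (tendsto_atTop_add_const_right _ _ (tendsto_min_atTop (γ.tendsto_face b) (γ'.tendsto_face b)))
    ?_
  filter_upwards [hA, hA', (γ.tendsto_face b).eventually_gt_atTop (max R R₀),
    (γ'.tendsto_face b).eventually_gt_atTop (max R R₀)] with m h1 h2 h3 h4
  refine (hR _ _ _ _ _ _ a₁ a₂ (γ.color_face m) (γ'.color_face m)
    ((le_max_right _ _).trans_lt h3) ((le_max_right _ _).trans_lt h4) h1.2 h2.2 h1.1 h2.1).mono ?_
  rintro v ⟨r, B, hr, hB, hv⟩
  have hr1 : max R R₀ < r := (lt_min h3 h4).trans_le hr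
  refine ⟨⟨r, B, (le_max_left _ _).trans_lt hr1, hB, hv⟩, ?_⟩
  have h5 := norm_sub_norm_le (pol b r B - b) (pos v - b)
  rw [norm_pol_sub b ((hR0.trans (le_max_right _ _)).trans hr1.le), sub_sub_sub_cancel_right,
    norm_sub_rev _ (pos v)] at h5
  linarith

end Strings

/-! ### Strings off a cone -/

theorem quadrant_linked (f : Face) {u : Vertex} (hu : u ∈ f.boundary) {σ₁ σ₂ : ℤ}
    (h1 : σ₁ = 1 ∨ σ₁ = -1) (h2 : σ₂ = 1 ∨ σ₂ = -1) (n : ℕ) :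
    ∃ g : Face, g.x = f.x + 3 * n * σ₁ ∧ g.y = f.y + n * σ₂ ∧
      Linked f.color 0 (fun v => ∃ s₁ s₂ : ℤ, 0 ≤ s₁ ∧ s₁ ≤ 3 * n ∧ 0 ≤ s₂ ∧ s₂ ≤ n ∧
        v.1 = u.1 + σ₁ * s₁ ∧ v.2 = u.2 + σ₂ * s₂) f g 0 := by
  have hz : ∀ t : Chain, pair 0 t = 0 := fun t => pair_eq_zero fun _ _ => rfl
  rw [mem_boundary] at hu
  induction n with
  | zero => exact ⟨f, by simp, by simp, Linked.refl _ _ _ _⟩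
  | succ n ih =>
    obtain ⟨g, hgx, hgy, hl⟩ := ih
    have hgc : g.color = f.color := by
      rw [color_eq_iff, hgx, mul_assoc, Int.add_mul_emod_self_left]
    obtain ⟨g', v, w, he, hx', hy', hv1, hv2, hw1, hw2⟩ : ∃ g' v w, CEdge g g' v w ∧
        g'.x = g.x + 3 * σ₁ ∧ g'.y = g.y + σ₂ ∧ v.1 = g.x + 1 + σ₁ ∧ 2 * v.2 = 2 * g.y + 1 + σ₂ ∧
        w.1 = g.x + 1 + 2 * σ₁ ∧ w.2 = v.2 := by
      rcases h1 with rfl | rfl <;> rcases h2 with rfl | rfl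
      · exact ⟨_, _, _, cedge_up g, by simp [Face.shift], by simp [Face.shift], by simp; ring,
          by simp; ring, by simp; ring, rfl⟩
      · exact ⟨_, _, _, cedge_down g, by simp [Face.shift], by simp [Face.shift], by simp; ring,
          by simp, by simp; ring, rfl⟩
      · have := cedge_down (g.shift 0 (-1))
        rw [g.shift_shift] at this
        simp only [neg_add_cancel, add_zero, Face.shift_zero] at this
        exact ⟨_, _, _, this.symm, by simp [Face.shift], by simp [Face.shift],
          by simp [Face.shift], by simp [Face.shift]; ring, by simp [Face.shift]; ring, rfl⟩
      · have := cedge_up (g.shift (-1) 0)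
        rw [g.shift_shift] at this
        simp only [neg_add_cancel, add_zero, Face.shift_zero] at this
        exact ⟨_, _, _, this.symm, by simp [Face.shift], by simp [Face.shift],
          by simp [Face.shift], by simp [Face.shift], by simp [Face.shift]; ring, rfl⟩
    refine ⟨g', by rw [hx', hgx]; push_cast; ring, by rw [hy', hgy]; push_cast; ring, ?_⟩
    have hle := he.linked (τ := 0) (P := fun v => ∃ s₁ s₂ : ℤ, 0 ≤ s₁ ∧ s₁ ≤ 3 * (n + 1 : ℕ) ∧
      0 ≤ s₂ ∧ s₂ ≤ (n + 1 : ℕ) ∧ v.1 = u.1 + σ₁ * s₁ ∧ v.2 = u.2 + σ₂ * s₂) hgc ?_ ?_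
    · rw [hz] at hle
      have := Linked.trans (hl.mono ?_) hle
      · simpa using this
      · rintro v ⟨s₁, s₂, a1, a2, a3, a4, a5, a6⟩
        exact ⟨s₁, s₂, a1, by push_cast; linarith, a3, by push_cast; linarith, a5, a6⟩
    · refine ⟨σ₁ * (v.1 - u.1), σ₂ * (v.2 - u.2), ?_⟩
      push_cast
      rcases h1 with rfl | rfl <;> rcases h2 with rfl | rfl <;> omega
    · refine ⟨σ₁ * (w.1 - u.1), σ₂ * (w.2 - u.2), ?_⟩
      push_cast
      rcases h1 with rfl | rfl <;> rcases h2 with rfl | rfl <;> omega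

theorem exists_exit (q : ℂ) (φ : ℝ) {h : ℝ} (h0 : 0 < h) (h1 : h < Real.pi) (L : ℝ) :
    ∃ R C : ℝ, ∀ (f : Face) (u : Vertex), u ∈ f.boundary → pos u ∉ cone q φ h →
      R < ‖pos u - q‖ → ∃ g : Face, g.color = f.color ∧
        Linked f.color 0 (fun v => pos v ∉ cone q φ h ∧ ‖pos v - pos u‖ ≤ C) f g 0 ∧
        (∀ z, ‖z - g.center‖ ≤ L → z ∉ cone q φ h) ∧ ‖g.center - pos u‖ ≤ C := by
  obtain ⟨n, hn⟩ := exists_nat_gt (|L| + 2)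
  obtain ⟨R, hR⟩ := exists_quadrant q φ h0 h1 (4 * n + 4)
  have hLn := le_abs_self L
  have hL0 := abs_nonneg L
  refine ⟨R, 8 * n + 8, fun f u hu hout hfar => ?_⟩
  obtain ⟨σ₁, σ₂, hσ₁, hσ₂, hσ⟩ := hR (pos u) hout hfar
  obtain ⟨g, hgx, hgy, hl⟩ := quadrant_linked f hu hσ₁ hσ₂ n
  have hgc : g.color = f.color := by
    rw [color_eq_iff, hgx, mul_assoc, Int.add_mul_emod_self_left]
  have e1 : ∀ {σ : ℤ}, (σ = 1 ∨ σ = -1) → ∀ x : ℝ, (σ : ℝ) * (σ * x) = x := by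
    rintro σ (rfl | rfl) x <;> simp
  have e2 : ∀ {σ : ℤ}, (σ = 1 ∨ σ = -1) → ∀ x : ℝ, |x| = |(σ : ℝ) * x| := by
    rintro σ (rfl | rfl) x <;> simp
  rw [mem_boundary] at hu
  obtain ⟨u1, u2, u3, u4⟩ := hu
  have u1' : (f.x : ℝ) ≤ u.1 := by exact_mod_cast u1
  have u2' : (u.1 : ℝ) ≤ f.x + 2 := by exact_mod_cast u2
  have u3' : (f.y : ℝ) ≤ u.2 := by exact_mod_cast u3
  have u4' : (u.2 : ℝ) ≤ f.y + 1 := by exact_mod_cast u4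
  have hgx' : (g.x : ℝ) = f.x + 3 * n * σ₁ := by rw [hgx]; push_cast; ring
  have hgy' : (g.y : ℝ) = f.y + n * σ₂ := by rw [hgy]; push_cast; ring
  have hre : |σ₁ * (g.center - pos u).re - 3 * n| ≤ 1 := by
    rw [e2 hσ₁, mul_sub, e1 hσ₁]
    simp only [Face.center, pos, Complex.sub_re]
    rw [hgx', abs_le]; constructor <;> linarith
  have him : |σ₂ * (g.center - pos u).im - n| ≤ 1 := by
    rw [e2 hσ₂, mul_sub, e1 hσ₂]
    simp only [Face.center, pos, Complex.sub_im]
    rw [hgy', abs_le]; constructor <;> linarith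
  rw [abs_le] at hre him
  have hn0 : (0 : ℝ) ≤ n := n.cast_nonneg
  refine ⟨g, hgc, hl.mono ?_, fun z hz => ?_, ?_⟩
  · rintro v ⟨s₁, s₂, a1, a2, a3, a4, a5, a6⟩
    have a1' : (0 : ℝ) ≤ s₁ := by exact_mod_cast a1
    have a2' : (s₁ : ℝ) ≤ 3 * n := by exact_mod_cast a2
    have a3' : (0 : ℝ) ≤ s₂ := by exact_mod_cast a3
    have a4' : (s₂ : ℝ) ≤ n := by exact_mod_cast a4
    have hv : pos v = pos u + ⟨σ₁ * s₁, σ₂ * s₂⟩ := by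
      apply Complex.ext
      · simp [pos, a5]
      · simp [pos, a6]
    rw [hv]
    refine ⟨hσ s₁ s₂ a1' a3' (by linarith) (by linarith), ?_⟩
    rw [add_sub_cancel_left]
    refine (norm_le_of_abs (a := s₁) (b := s₂) ?_ ?_).trans (by linarith)
    · simp only; rw [e2 hσ₁, e1 hσ₁, abs_of_nonneg a1']
    · simp only; rw [e2 hσ₂, e1 hσ₂, abs_of_nonneg a3']
  · have hzre : |σ₁ * (z - g.center).re| ≤ L := by
      rw [← e2 hσ₁]; exact (Complex.abs_re_le_norm _).trans hz
    have hzim : |σ₂ * (z - g.center).im| ≤ L := by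
      rw [← e2 hσ₂]; exact (Complex.abs_im_le_norm _).trans hz
    rw [abs_le] at hzre hzim
    have hzu : z = pos u + ⟨σ₁ * (σ₁ * (z - pos u).re), σ₂ * (σ₂ * (z - pos u).im)⟩ := by
      rw [e1 hσ₁, e1 hσ₂]
      apply Complex.ext <;> simp
    have s1 : σ₁ * (z - pos u).re = σ₁ * (z - g.center).re + σ₁ * (g.center - pos u).re := by
      simp only [Complex.sub_re]; ring
    have s2 : σ₂ * (z - pos u).im = σ₂ * (z - g.center).im + σ₂ * (g.center - pos u).im := by
      simp only [Complex.sub_im]; ring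
    rw [hzu]
    apply hσ <;> linarith
  · refine (norm_le_of_abs (a := 3 * n + 1) (b := n + 1) ?_ ?_).trans (by linarith)
    · rw [e2 hσ₁, abs_le]; constructor <;> linarith
    · rw [e2 hσ₂, abs_le]; constructor <;> linarith

theorem exists_lift_of_not_mem {q z : ℂ} {φ h : ℝ} (h1 : h ≤ Real.pi) (hz : z ∉ cone q φ h)
    (hq : 0 < ‖z - q‖) : ∃ A ∈ Set.Icc (φ + h) (φ + 2 * Real.pi - h), z = pol q ‖z - q‖ A := by
  obtain ⟨A, hA⟩ := exists_pol q z
  rw [hA, pol_mem_cone hq, not_lt] at hz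
  obtain ⟨k, hk⟩ := exists_near_lift (A - φ - Real.pi)
  rw [abs_le] at hk
  have hp := Real.pi_pos
  have e : Real.cos (A - φ) = Real.cos (A - φ + 2 * Real.pi * k) := by
    rw [mul_comm (2 * Real.pi) (k : ℝ), Real.cos_add_int_mul_two_pi]
  rw [e] at hz
  refine ⟨A + 2 * Real.pi * k, ⟨?_, ?_⟩, by rw [pol_add_two_pi]; exact hA⟩
  · by_contra! hlt
    have := Real.cos_lt_cos_of_nonneg_of_le_pi (x := A - φ + 2 * Real.pi * k) (y := h)
      (by linarith) h1 (by linarith)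
    linarith
  · by_contra! hlt
    have h2 := Real.cos_lt_cos_of_nonneg_of_le_pi (x := 2 * Real.pi - (A - φ + 2 * Real.pi * k))
      (y := h) (by linarith) h1 (by linarith)
    rw [Real.cos_two_pi_sub] at h2
    linarith

/-- A string off a cone can be joined, off the cone, to a string that leaves a given sector. -/
theorem exists_exit_join {c : Color} (γ : HalfString c) {q : ℂ} {φ h κ θ : ℝ} (q₁ : ℂ) (h0 : 0 < h)
    (hθ : θ < Real.pi) (hle : |φ - κ| + h ≤ θ) (hγ : ∀ j, pos (γ.vert j) ∉ cone q φ h) :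
    ∃ (γ' : HalfString c) (m₀ : ℕ) (Q : ℕ → Chain), IsJoin γ γ' m₀ Q ∧
      (∀ j, pos (γ'.vert j) ∉ cone q₁ κ θ) ∧
      ∀ m, ∀ v ∈ (path γ γ' m₀ Q m).support, pos v ∉ cone q φ h := by
  have h1 : h < Real.pi := by linarith [abs_nonneg (φ - κ)]
  have hθ0 : 0 < θ := by linarith [abs_nonneg (φ - κ)]
  have hφ := hle
  rw [← le_sub_iff_add_le, abs_le] at hφ
  obtain ⟨L, hL0, hL⟩ := exists_shift φ h0 h1 200
  set b := pol q (-L) φ with hb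
  have hqb : ‖q - b‖ = L := by
    rw [hb, pol, sub_add_cancel_left, norm_neg, norm_mul, Complex.norm_exp_ofReal_mul_I, mul_one,
      Complex.norm_real, norm_neg, Real.norm_of_nonneg hL0]
  have hback : ∀ z z', ‖z' - z‖ ≤ 200 → z ∉ cone b φ h → z' ∉ cone q φ h := fun z z' hz hm hm' =>
    hm (hL L le_rfl q b z' z (by simp [hb]) (by rwa [norm_sub_rev]) hm')
  set η := (Real.pi - θ) / 2 with hη
  have hη0 : 0 < η := by rw [hη]; linarith
  obtain ⟨R₁, hR10, hR₁⟩ := far_sector_disjoint (φ := κ) (h := θ) (a₁ := κ + Real.pi - η)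
    (a₂ := κ + Real.pi + η) b q₁ 0
    (fun A hA hA' => cos_lt_of_between hθ0.le (by linarith) (by linarith))
  obtain ⟨γ', hv', hf'⟩ := exists_ray c b (κ + Real.pi) R₁ hη0
  have hsec : ∀ A, |A - (κ + Real.pi)| < η → A ∈ Set.Icc (φ + h) (φ + 2 * Real.pi - h) := by
    intro A hA
    rw [abs_lt] at hA
    constructor <;> linarith
  have hoff : ∀ r A, 0 ≤ r → A ∈ Set.Icc (φ + h) (φ + 2 * Real.pi - h) →
      pol b r A ∉ cone b φ h := by
    intro r A hr hA hm
    rw [cone, Set.mem_ofPred_eq, norm_pol_sub b hr, pol_sub_mul] at hm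
    have h2 : Real.cos (A - φ) ≤ Real.cos h := by
      rcases le_total (A - φ) Real.pi with h3 | h3
      · exact Real.cos_le_cos_of_nonneg_of_le_pi h0.le h3 (by linarith [hA.1])
      · rw [← Real.cos_two_pi_sub (A - φ)]
        exact Real.cos_le_cos_of_nonneg_of_le_pi h0.le (by linarith) (by linarith [hA.2])
    exact absurd (mul_le_mul_of_nonneg_left h2 hr) (not_le.mpr hm)
  have hγ'off : ∀ j, pos (γ'.vert j) ∉ cone q φ h := by
    intro j
    obtain ⟨r, A, hr, hA, e⟩ := hv' j
    rw [e]
    exact hback _ _ (by simp) (hoff r A (hR10.trans hr.le) (hsec A hA))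
  obtain ⟨R₂, C, hexit⟩ := exists_exit q φ h0 h1 L
  obtain ⟨R₃, hR30, hring⟩ := exists_ring (turnsAt_zero c b)
  set ρ : ℕ → ℝ := fun m => min ‖pos (γ.vert (2 * m)) - b‖ ‖(γ'.face m).center - b‖ with hρ
  have hρt : Tendsto ρ atTop atTop := tendsto_min_atTop (γ.tendsto_start b) (γ'.tendsto_face b)
  obtain ⟨m₀, Q, hj, -, hQ⟩ := exists_join (γ := γ) (γ' := γ') (τ := 0) (b := b)
    (P := fun v => pos v ∉ cone q φ h) (e := fun _ => 0) (ρ := fun m => ρ m + (-(|C| + 200)))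
    (tendsto_atTop_add_const_right _ _ hρt) (by
      filter_upwards [(γ.tendsto_start q).eventually_gt_atTop R₂,
        (γ.tendsto_start b).eventually_gt_atTop (R₃ + |C|),
        (γ'.tendsto_face b).eventually_gt_atTop R₃] with m hm1 hm2 hm3
      have hC := le_abs_self C
      have hC0 := abs_nonneg C
      obtain ⟨g, hgc, hl, hball, hgu⟩ := hexit (γ.face m) _ (γ.start_mem m) (hγ _) hm1
      rw [γ.color_face] at hgc hl
      have hgb : ‖pos (γ.vert (2 * m)) - b‖ - |C| ≤ ‖g.center - b‖ := by
        have := norm_sub_norm_le (pos (γ.vert (2 * m)) - b) (g.center - b)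
        rw [sub_sub_sub_cancel_right, norm_sub_rev _ g.center] at this
        linarith
      have hgoff : g.center ∉ cone b φ h := by
        intro hm
        refine hball (g.center + (q - b)) (by rw [add_sub_cancel_left, hqb]) ?_
        rw [cone, Set.mem_ofPred_eq] at hm ⊢
        have e : g.center + (q - b) - q = g.center - b := by ring
        rwa [e]
      obtain ⟨A, hA, hgA⟩ := exists_lift_of_not_mem h1.le hgoff (by linarith)
      obtain ⟨r', A', hr', hA', hgA'⟩ := hf' m
      have hr'b : ‖(γ'.face m).center - b‖ = r' := by
        rw [hgA', norm_pol_sub b (hR10.trans hr'.le)]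
      have hl2 := hring g (γ'.face m) _ r' A A' _ _ hgc (γ'.color_face m) (by linarith)
        (by rw [← hr'b]; exact hm3) hA (hsec A' hA') hgA hgA'
      have := Linked.trans (P := fun v => pos v ∉ cone q φ h ∧
        ρ m + (-(|C| + 200)) ≤ ‖pos v - b‖) (hl.mono ?_) (hl2.mono ?_)
      · simpa using this
      · rintro v ⟨hv1, hv2⟩
        refine ⟨hv1, ?_⟩
        have h3 := norm_sub_norm_le (pos (γ.vert (2 * m)) - b) (pos v - b)
        rw [sub_sub_sub_cancel_right, norm_sub_rev _ (pos v)] at h3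
        have h4 : ρ m ≤ ‖pos (γ.vert (2 * m)) - b‖ := min_le_left _ _
        linarith
      · rintro v ⟨r, B, hr, hB, hv⟩
        have hmin : ρ m - |C| ≤ min ‖g.center - b‖ r' := by
          refine le_min ?_ ?_
          · have h4 : ρ m ≤ ‖pos (γ.vert (2 * m)) - b‖ := min_le_left _ _
            linarith
          · have h4 : ρ m ≤ ‖(γ'.face m).center - b‖ := min_le_right _ _
            linarith
        have hr0 : 0 ≤ r := (le_min (norm_nonneg _) (by rw [← hr'b]; exact norm_nonneg _)).trans hr
        refine ⟨hback _ _ hv (hoff r B hr0 hB), ?_⟩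
        have h3 := norm_sub_norm_le (pol b r B - b) (pos v - b)
        rw [norm_pol_sub b hr0, sub_sub_sub_cancel_right, norm_sub_rev _ (pos v)] at h3
        linarith)
  refine ⟨γ', m₀, Q, hj, fun j => ?_, fun m v hv => ?_⟩
  · obtain ⟨r, A, hr, hA, e⟩ := hv' j
    rw [abs_lt] at hA
    exact hR₁ r A _ hr (by linarith) (by linarith) (by rw [e]; simp)
  · rcases mem_support_path hv with ⟨j, rfl⟩ | hv | ⟨j, rfl⟩
    · exact hγ j
    · exact hQ m v hv
    · exact hγ'off j

/-! ## Transporters of string endomorphisms -/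

theorem backSite_sites_subset (Λ₀ : Cone) (x : ℤ × ℤ) : ∀ᶠ n in atTop,
    (Λ₀.translate x).sites ⊆ (Λ₀.translate (backSite Λ₀.axis n)).sites := by
  filter_upwards [eventually_subset_translate Λ₀ (toC Λ₀.apex + pos x)] with n hn
  refine sites_subset ?_
  rw [region_subset_iff, translate_cone, translate_cone]
  exact hn _ _ Λ₀.half_pos (by simp)

theorem finset_subset_backSite (Λ₀ : Cone) (F : Finset Vertex) : ∀ᶠ n in atTop,
    (F : Set Vertex) ⊆ (Λ₀.translate (backSite Λ₀.axis n)).sites := by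
  refine (Filter.eventually_all_finset F).mpr fun v _ => ?_
  filter_upwards [eventually_subset_translate Λ₀ (pol (pos v) (-1) Λ₀.axis)] with n hn
  rw [mem_sites_iff, translate_cone]
  refine hn Λ₀.axis Λ₀.half Λ₀.half_pos (by simp) ((mem_cone_iff Λ₀.half_pos Λ₀.half_lt).mpr
    ⟨1, Λ₀.axis, one_pos, by simpa using Λ₀.half_pos, ?_⟩)
  rw [pol, pol]; push_cast; ring

section Transport

variable {H : Type*} [NormedAddCommGroup H] [InnerProductSpace ℂ H] [CompleteSpace H]
  {π₀ : QuasiLocal →⋆ₐ[ℂ] (H →L[ℂ] H)} {Ω : H} {Λ₀ : Cone} {c c' : Color} {k k' : Pauli}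

theorem eq_zero_of_eq_neg {E : Type*} [AddCommGroup E] [Module ℂ E] {x : E} (h : x = -x) :
    x = 0 := by
  have h2 : (2 : ℂ) • x = 0 := by
    rw [two_smul]
    nth_rw 1 [h]
    exact neg_add_cancel x
  exact (smul_eq_zero.mp h2).resolve_left two_ne_zero

theorem IsVacuum.one_ne_zero (hv : IsVacuum π₀ Ω) : (1 : H →L[ℂ] H) ≠ 0 := fun h =>
  hv.ne_zero (by simpa using congrArg (fun T : H →L[ℂ] H => T Ω) h)

theorem IsVacuum.one_ne_neg_one (hv : IsVacuum π₀ Ω) : (1 : H →L[ℂ] H) ≠ -1 := fun h =>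
  hv.ne_zero (by
    have h1 := congrArg (fun T : H →L[ℂ] H => T Ω) h
    simp only [one_apply_eq_self, neg_apply] at h1
    exact eq_zero_of_eq_neg h1)

theorem exists_kap_eq_one (k : Pauli) : ∃ k', kap k k' = 1 := by
  cases k
  · exact ⟨.z, by decide⟩
  · exact ⟨.z, by decide⟩
  · exact ⟨.x, by decide⟩

/-- A string lies in every cone in which its endomorphism is localized. -/
theorem containedIn_of_isLocalized (hv : IsVacuum π₀ Ω) {γ : HalfString c} {Λ : Cone}
    (hl : IsLocalized π₀ (fun a => π₀ (stringEndo γ k a)) Λ) : γ.ContainedIn Λ := by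
  intro j
  by_contra hj
  obtain ⟨k', hk'⟩ := exists_kap_eq_one k
  have h1 := hl (E k' (Finsupp.single (γ.vert j) 1)) (E_localized k' _ fun v hv => by
    rw [Finset.mem_singleton.mp (Finsupp.support_single_subset hv)]
    exact hj)
  simp only [stringEndo_eq, autE_E, pair_single, γ.config_vert, hk', mul_one, map_smul,
    sgn_one] at h1
  have h2 : π₀ (E k' (Finsupp.single (γ.vert j) 1)) = 0 := by
    rw [neg_smul, one_smul] at h1
    exact eq_zero_of_eq_neg h1.symm
  have h3 := congrArg π₀ (star_E_mul k' (Finsupp.single (γ.vert j) 1))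
  rw [map_mul, h2, mul_zero, map_one] at h3
  exact hv.one_ne_zero h3.symm

theorem stringEndo_eq_of_off {γ γ₁ : HalfString c} {Λ : Set Vertex} (h : ∀ j, γ₁.vert j ∉ Λ)
    (k : Pauli) {a : QuasiLocal} (ha : LocalizedIn Λ a) :
    autE k (γ.config + γ₁.config) a = stringEndo γ k a := by
  rw [stringEndo_eq]
  refine autE_congr k (fun v hv => ?_) ha
  rw [Pi.add_apply, γ₁.config_eq_zero, add_zero]
  rintro j rfl
  exact h j hv

theorem exists_transporter_off (hv : IsVacuum π₀ Ω) (γ : HalfString c) (k : Pauli) {Λt : Cone}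
    {m : ℤ} (hm : |Λt.axis + 2 * Real.pi * m - Λ₀.axis| + Λt.half ≤ Λ₀.half)
    (hγ : ∀ j, γ.vert j ∉ Λt.sites) (x : ℤ × ℤ) :
    ∃ V ∈ unitary (H →L[ℂ] H),
      (∀ a, LocalizedIn (Λ₀.translate x).sites a →
        star V * π₀ a * V = π₀ (stringEndo γ k a)) ∧
      ∀ W : H →L[ℂ] H, (∀ a, LocalizedIn Λt.sitesᶜ a → W * π₀ a = π₀ a * W) →
        W * V = V * W := by
  obtain ⟨γ', m₀, Q, hj, hγ', hp⟩ := exists_exit_join γ (q := toC Λt.apex) (h := Λt.half)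
    (toC Λ₀.apex + pos x) Λt.half_pos Λ₀.half_lt hm (fun j => by
      rw [cone_add_two_pi]
      exact fun h => hγ j ((mem_sites_iff _ _).mpr h))
  obtain ⟨V, hV⟩ := exists_transporter hv k hj.locTendsto
    (fun m n f => by rw [hj.bdry_path, hj.bdry_path])
  refine ⟨V, hV.unitary, fun a ha => ?_, fun W hW => hV.commute (Eventually.of_forall fun i =>
    hW _ (E_localized k _ fun v hv => ?_))⟩
  · rw [hV.conj hj.locTendsto, stringEndo_eq_of_off (Λ := (Λ₀.translate x).sites) (fun j hv => ?_)
      k ha]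
    rw [mem_sites_iff, translate_cone] at hv
    exact hγ' j hv
  · intro hm
    rw [mem_sites_iff, ← cone_add_two_pi _ _ _ m] at hm
    exact hp i v hv hm

theorem exists_extension_stringEndo (hv : IsVacuum π₀ Ω) (γ : HalfString c) (k : Pauli) {Λt : Cone}
    {m : ℤ} (hm : |Λt.axis + 2 * Real.pi * m - Λ₀.axis| + Λt.half ≤ Λ₀.half)
    (hγ : ∀ j, γ.vert j ∉ Λt.sites) : ∃ ρbar, IsExtension π₀ Λ₀ (stringEndo γ k) ρbar := by
  choose V hu hV _ using fun n => exists_transporter_off hv γ k hm hγ (backSite Λ₀.axis n)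
  exact exists_extension (fun a b => by
    rw [stringEndo_eq, stringEndo_eq]; exact norm_autE_sub_le k _ a b)
    (backSite_sites_subset Λ₀) (finset_subset_backSite Λ₀) hu hV

theorem coneVN_mono {Λ Λ' : Cone} (h : Λ.sites ⊆ Λ'.sites) : coneVN π₀ Λ ≤ coneVN π₀ Λ' :=
  fun _ hT => mem_coneVN_iff.mpr fun g hg => mem_coneVN_iff.mp hT g fun a ha =>
    hg a (regionAlg_mono h ha)

theorem exists_near_mem_coneVN (W : auxAlg π₀ Λ₀) {ε : ℝ} (hε : 0 < ε) :
    ∃ (x : ℤ × ℤ) (T : auxAlg π₀ Λ₀), (T : H →L[ℂ] H) ∈ coneVN π₀ (Λ₀.translate x) ∧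
      ‖(W : H →L[ℂ] H) - T‖ < ε := by
  have hdir : Directed (· ≤ ·) fun x : ℤ × ℤ => coneVN π₀ (Λ₀.translate x) := by
    intro x y
    obtain ⟨n, h1, h2⟩ := ((backSite_sites_subset Λ₀ x).and (backSite_sites_subset Λ₀ y)).exists
    exact ⟨_, coneVN_mono h1, coneVN_mono h2⟩
  have hW : (W : H →L[ℂ] H) ∈ closure
      ((⨆ x : ℤ × ℤ, coneVN π₀ (Λ₀.translate x) : StarSubalgebra ℂ (H →L[ℂ] H)) :
        Set (H →L[ℂ] H)) := W.2
  obtain ⟨T, hT, hd⟩ := Metric.mem_closure_iff.mp hW ε hε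
  rw [StarSubalgebra.coe_iSup_of_directed hdir, Set.mem_iUnion] at hT
  obtain ⟨x, hx⟩ := hT
  exact ⟨x, ⟨T, coneVN_le_auxAlg x hx⟩, hx, by rwa [dist_eq_norm] at hd⟩

theorem isClosed_auxAlg : IsClosed (auxAlg π₀ Λ₀ : Set (H →L[ℂ] H)) :=
  StarSubalgebra.isClosed_topologicalClosure _

theorem norm_hom_auxAlg_le (ρbar : auxAlg π₀ Λ₀ →⋆ₐ[ℂ] (H →L[ℂ] H)) (T : auxAlg π₀ Λ₀) :
    ‖ρbar T‖ ≤ ‖(T : H →L[ℂ] H)‖ := by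
  have : IsClosed (auxAlg π₀ Λ₀ : Set (H →L[ℂ] H)) := isClosed_auxAlg
  exact NonUnitalStarAlgHom.norm_apply_le ρbar T

/-- The extension fixes the elements that commute with the observables outside a cone that the
string avoids. -/
theorem IsExtension.eq_self (hv : IsVacuum π₀ Ω) {γ : HalfString c} {Λt : Cone} {m : ℤ}
    (hm : |Λt.axis + 2 * Real.pi * m - Λ₀.axis| + Λt.half ≤ Λ₀.half)
    (hγ : ∀ j, γ.vert j ∉ Λt.sites) {ρbar : auxAlg π₀ Λ₀ →⋆ₐ[ℂ] (H →L[ℂ] H)}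
    (hρ : IsExtension π₀ Λ₀ (stringEndo γ k) ρbar) (W : auxAlg π₀ Λ₀)
    (hW : ∀ a, LocalizedIn Λt.sitesᶜ a → (W : H →L[ℂ] H) * π₀ a = π₀ a * W) :
    ρbar W = W := by
  refine eq_of_norm_sub_le_zero (le_of_forall_pos_lt_add fun ε hε => ?_)
  obtain ⟨x, T, hT, hWT⟩ := exists_near_mem_coneVN W (half_pos hε)
  obtain ⟨V, hu, hV, hcomm⟩ := exists_transporter_off hv γ k hm hγ x
  have h1 : ρbar T = star V * T * V := hρ.eq_conj hV T hT
  have h2 : star V * (W : H →L[ℂ] H) * V = W := by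
    rw [mul_assoc, hcomm _ hW, ← mul_assoc, (Unitary.mem_iff.mp hu).1, one_mul]
  have e : ρbar W - W = ρbar (W - T) - star V * ((W : H →L[ℂ] H) - T) * V := by
    rw [map_sub, h1, mul_sub, sub_mul, h2]; abel
  rw [e]
  have h3 : ‖ρbar (W - T)‖ ≤ ‖(W : H →L[ℂ] H) - T‖ := norm_hom_auxAlg_le ρbar (W - T)
  have h4 : ‖star V * ((W : H →L[ℂ] H) - T) * V‖ = ‖(W : H →L[ℂ] H) - T‖ := by
    rw [CStarRing.norm_mul_mem_unitary _ hu, CStarRing.norm_mem_unitary_mul _ (Unitary.star_mem hu)]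
  calc _ ≤ _ := norm_sub_le _ _
    _ < 0 + ε := by rw [h4]; linarith

/-- The braiding is computed by any charge transporter into the cone `Λt`. -/
theorem braiding_eq (hv : IsVacuum π₀ Ω) {γ : HalfString c} {γ' γ₁ : HalfString c'} {Λt : Cone}
    {m : ℤ} (hm : |Λt.axis + 2 * Real.pi * m - Λ₀.axis| + Λt.half ≤ Λ₀.half)
    (hγ : ∀ j, γ.vert j ∉ Λt.sites) (hγ₁ : γ₁.ContainedIn Λt)
    {ρbar : auxAlg π₀ Λ₀ →⋆ₐ[ℂ] (H →L[ℂ] H)} (hρ : IsExtension π₀ Λ₀ (stringEndo γ k) ρbar)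
    {U : auxAlg π₀ Λ₀} (hU : (U : H →L[ℂ] H) ∈ unitary (H →L[ℂ] H))
    (hl : IsLocalized π₀
      (fun a => (U : H →L[ℂ] H) * π₀ (stringEndo γ' k' a) * star (U : H →L[ℂ] H)) Λt)
    {t : ℕ → Chain} (ht : LocTendsto t atTop (γ'.config + γ₁.config))
    (hb : ∀ m n f, bdry (t m) f = bdry (t n) f) {x : ℤ × ℤ}
    (hx : ∀ m, ∀ v ∈ (t m).support, v ∈ (Λ₀.translate x).sites) {e : ZMod 2}
    (he : ∀ᶠ m in atTop, kap k k' * pair γ.config (t m) = e) :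
    star (U : H →L[ℂ] H) * ρbar U = sgn e • 1 := by
  obtain ⟨T, hT⟩ := exists_transporter hv k' ht hb
  have hTmem : T ∈ auxAlg π₀ Λ₀ := coneVN_le_auxAlg x (hT.mem_coneVN hx)
  set T' : auxAlg π₀ Λ₀ := ⟨T, hTmem⟩ with hT'
  have hρ' : IsExtension π₀ Λ₀ (autE k γ.config) ρbar := by
    rwa [show autE k γ.config = stringEndo γ k from funext fun a => (stringEndo_eq γ k a).symm]
  have h1 : ρbar T' = sgn e • T := hρ'.transporter (U := T') hT hx he
  set W : auxAlg π₀ Λ₀ := U * star T' with hWdef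
  have hWc : (W : H →L[ℂ] H) = U * star T := rfl
  have hUu := Unitary.mem_iff.mp hU
  have hW : ∀ a, LocalizedIn Λt.sitesᶜ a → (W : H →L[ℂ] H) * π₀ a = π₀ a * W := by
    intro a ha
    have h2 : star T * π₀ a * T = π₀ (stringEndo γ' k' a) := by
      rw [hT.conj ht, stringEndo_eq_of_off (Λ := Λt.sitesᶜ) (fun j hj => hj (hγ₁ j)) k' ha]
    have h3 : (U : H →L[ℂ] H) * π₀ (stringEndo γ' k' a) * star (U : H →L[ℂ] H) = π₀ a := hl a ha
    rw [hWc]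
    calc (U : H →L[ℂ] H) * star T * π₀ a = U * (star T * π₀ a * T) * star T := by
          simp only [mul_assoc, hT.mul_star_self, mul_one]
      _ = U * π₀ (stringEndo γ' k' a) * star (U : H →L[ℂ] H) * (U * star T) := by
          rw [h2]; simp only [mul_assoc]
          rw [← mul_assoc (star (U : H →L[ℂ] H)), hUu.1, one_mul]
      _ = π₀ a * (U * star T) := by rw [h3]
  have hWρ := hρ.eq_self hv hm hγ W hW
  have hUW : U = W * T' := by
    apply Subtype.ext
    change (U : H →L[ℂ] H) = U * star T * T
    rw [mul_assoc, hT.star_mul_self, mul_one]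
  have h5 : ρbar U = (W : H →L[ℂ] H) * (sgn e • T) := by
    nth_rw 1 [hUW]
    rw [map_mul, hWρ, h1]
  rw [h5, mul_smul_comm, mul_smul_comm, hWc, mul_assoc, hT.star_mul_self, mul_one, hUu.1]

end Transport

/-! ## Braidings of strings -/

theorem abs_cos_lt_one {h : ℝ} (h0 : 0 < h) (h1 : h < Real.pi) : |Real.cos h| < 1 := by
  rw [abs_lt]
  constructor
  · have := Real.cos_lt_cos_of_nonneg_of_le_pi h0.le le_rfl h1
    rwa [Real.cos_pi] at this
  · have := Real.cos_lt_cos_of_nonneg_of_le_pi le_rfl h1.le h0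
    rwa [Real.cos_zero] at this

theorem pol_mem_cone_shift {b : ℂ} {κ θ r A : ℝ} (hr : 0 ≤ r) (h0 : 0 < θ) (h1 : θ < Real.pi)
    (hA : A ∈ Set.Icc (κ - θ) (κ + θ)) : pol b r A ∈ cone (pol b (-1) κ) κ θ := by
  have hc : Real.cos θ ≤ Real.cos (A - κ) := by
    rw [← Real.cos_abs (A - κ)]
    refine Real.cos_le_cos_of_nonneg_of_le_pi (abs_nonneg _) h1.le (abs_le.mpr ⟨?_, ?_⟩)
    · linarith [hA.1]
    · linarith [hA.2]
  have hlt := abs_cos_lt_one h0 h1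
  have e : pol b r A - pol b (-1) κ = (pol b r A - b) + Complex.exp (κ * Complex.I) := by
    rw [pol, pol]; push_cast; ring
  have h2 := norm_add_le (pol b r A - b) (Complex.exp (κ * Complex.I))
  have h3 := norm_sub_le ((pol b r A - b) + Complex.exp (κ * Complex.I))
    (Complex.exp (κ * Complex.I))
  rw [add_sub_cancel_right] at h3
  rw [Complex.norm_exp_ofReal_mul_I, norm_pol_sub b hr] at h2 h3
  rw [cone, Set.mem_ofPred_eq, e, add_mul, Complex.add_re, pol_sub_mul, exp_mul_exp_neg,
    Complex.one_re]
  rw [abs_lt] at hlt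
  have h4 := mul_le_mul_of_nonneg_left hc hr
  rcases le_total 0 (Real.cos θ) with h5 | h5 <;> nlinarith

/-- Far back translates of the fixed cone contain the neighbourhoods of its sector. -/
theorem eventually_sector_subset (Λ₀ : Cone) (b : ℂ) (D : ℝ) : ∀ᶠ n : ℕ in atTop,
    ∀ r A w, 0 ≤ r → A ∈ Set.Icc (Λ₀.axis - Λ₀.half) (Λ₀.axis + Λ₀.half) → ‖w - pol b r A‖ ≤ D →
      w ∈ cone (toC Λ₀.apex + pos (backSite Λ₀.axis n)) Λ₀.axis Λ₀.half := by
  set q := pol b (-1) Λ₀.axis with hq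
  obtain ⟨L₀, -, hL⟩ := exists_shift Λ₀.axis Λ₀.half_pos Λ₀.half_lt
    (|D| + 2 + ‖toC Λ₀.apex - q‖)
  obtain ⟨N, hN⟩ := exists_nat_gt L₀
  filter_upwards [eventually_ge_atTop N] with n hn r A w hr hA hw
  refine hL n (hN.le.trans (by exact_mod_cast hn)) q _ (pol b r A) w ?_ ?_
    (pol_mem_cone_shift hr Λ₀.half_pos Λ₀.half_lt hA)
  · have e : toC Λ₀.apex + pos (backSite Λ₀.axis n) - pol q (-(n : ℝ)) Λ₀.axis
        = (toC Λ₀.apex + pos (backSite Λ₀.axis n) - pol (toC Λ₀.apex) (-(n : ℝ)) Λ₀.axis)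
          + (toC Λ₀.apex - q) := by
      rw [pol, pol]; ring
    rw [e]
    refine (norm_add_le _ _).trans ?_
    linarith [norm_backSite (toC Λ₀.apex) Λ₀.axis n, abs_nonneg D]
  · linarith [le_abs_self D, norm_nonneg (toC Λ₀.apex - q)]

section Angles

variable {c : Color} (γ : HalfString c)

theorem HalfString.exists_angles {q : ℂ} {φ h : ℝ} (h0 : 0 < h) (h1 : h < Real.pi)
    (hγ : ∀ j, pos (γ.vert j) ∈ cone q φ h) (b : ℂ) {δ : ℝ} (hδ : 0 < δ) :
    ∃ A : ℕ → ℝ, ∀ᶠ m in atTop, AtAngle b (γ.face m) (A m) ∧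
      A m ∈ Set.Icc (φ - h - δ) (φ + h + δ) := by
  obtain ⟨R, hR0, hR⟩ := exists_angle (2 + ‖q - b‖) hδ
  have key : ∀ m, ∃ A, R < ‖pos (γ.vert (2 * m)) - q‖ → AtAngle b (γ.face m) A ∧
      A ∈ Set.Icc (φ - h - δ) (φ + h + δ) := by
    intro m
    by_cases hm : R < ‖pos (γ.vert (2 * m)) - q‖
    · obtain ⟨r, A, hr, hA, e⟩ := (mem_cone_iff h0 h1).mp (hγ (2 * m))
      rw [e, norm_pol_sub q hr.le] at hm
      obtain ⟨A', hA', h2⟩ := hR b (γ.face m).center r A hm (by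
        have e2 : (γ.face m).center - pol b r A
            = ((γ.face m).center - pos (γ.vert (2 * m))) + (q - b) := by
          rw [e, pol, pol]; ring
        rw [e2]
        refine (norm_add_le _ _).trans (add_le_add_left ?_ _)
        rw [norm_sub_rev]
        exact norm_pos_sub_center (γ.start_mem m))
      rw [abs_lt] at hA hA'
      exact ⟨A', fun _ => ⟨h2, by linarith, by linarith⟩⟩
    · exact ⟨0, fun h => absurd h hm⟩
  choose A hA using key
  exact ⟨A, ((γ.tendsto_start q).eventually_gt_atTop R).mono fun m hm => hA m hm⟩

theorem HalfString.exists_angles_of_mem {q : ℂ} {φ h κ θ : ℝ} (h0 : 0 < h) (h1 : h < Real.pi)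
    (hγ : ∀ j, pos (γ.vert j) ∈ cone q φ h) {b : ℂ} {δ : ℝ} (hδ : 0 < δ) (hθ0 : 0 < θ)
    (hθ : θ + δ ≤ Real.pi) (hb : ∀ m, (γ.face m).center ∈ cone b κ θ) (hl : κ - θ ≤ φ - h) :
    ∃ A : ℕ → ℝ, ∀ᶠ m in atTop, AtAngle b (γ.face m) (A m) ∧
      A m ∈ Set.Icc (κ - θ) (φ + h + δ) := by
  obtain ⟨A, hA⟩ := γ.exists_angles h0 h1 hγ b hδ
  refine ⟨A, ?_⟩
  filter_upwards [hA, (γ.tendsto_face b).eventually_gt_atTop 0] with m hm hr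
  refine ⟨hm.1, ?_, hm.2.2⟩
  by_contra! hlt
  have h2 := hb m
  rw [hm.1, pol_mem_cone hr] at h2
  have h3 := cos_lt_of_between (B := κ - A m) hθ0.le (by linarith) (by linarith [hm.2.1])
  rw [← Real.cos_neg, neg_sub] at h3
  linarith

theorem exists_angles_of_ray {b : ℂ} {ψ η : ℝ}
    (hf : ∀ i, ∃ r A, 0 < r ∧ |A - ψ| < η ∧ (γ.face i).center = pol b r A) :
    ∃ A : ℕ → ℝ, ∀ᶠ m in atTop, AtAngle b (γ.face m) (A m) ∧
      A m ∈ Set.Icc (ψ - η) (ψ + η) := by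
  choose r A hr hA hf using hf
  refine ⟨A, Eventually.of_forall fun m => ⟨atAngle_of_eq (hr m).le (hf m), ?_⟩⟩
  have := abs_lt.mp (hA m)
  constructor <;> linarith

end Angles

/-- A string `σ` in a thin sector counterclockwise from the cone `Λ`, and a sequence of chains that
transports the string `γ'` to `σ`. -/
structure IsTransport (Λ₀ Λ : Cone) (k₁ : ℤ) (b : ℂ) (ψ η : ℝ) {c : Color} (γ σ : HalfString c)
    (T : ℕ → Chain) : Prop where
  eta_pos : 0 < η
  low : Λ₀.axis - Λ₀.half ≤ Λ.axis + 2 * Real.pi * k₁ - Λ.half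
  mid : Λ.axis + 2 * Real.pi * k₁ + Λ.half < ψ - η
  high : ψ + η ≤ Λ₀.axis + Λ₀.half
  vert : ∀ j, ∃ r A, 0 < r ∧ |A - ψ| < η ∧ pos (σ.vert j) = pol b r A
  face : ∀ j, ∃ r A, 0 < r ∧ |A - ψ| < η ∧ (σ.face j).center = pol b r A
  off : ∀ j, σ.vert j ∉ Λ.sites
  lim : LocTendsto T atTop (γ.config + σ.config)
  bdry : ∀ m n f, bdry (T m) f = bdry (T n) f
  support : ∀ᶠ n in atTop, ∀ m, ∀ v ∈ (T m).support,
    v ∈ (Λ₀.translate (backSite Λ₀.axis n)).sites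

section Braid

variable {H : Type*} [NormedAddCommGroup H] [InnerProductSpace ℂ H] [CompleteSpace H]
  {π₀ : QuasiLocal →⋆ₐ[ℂ] (H →L[ℂ] H)} {Ω : H} {Λ₀ Λ : Cone} {c c' : Color} {k k' : Pauli}
  {k₁ : ℤ} {b : ℂ} {ψ η : ℝ} {γ : HalfString c} {γ' σ : HalfString c'} {T : ℕ → Chain} {e : ZMod 2}

theorem config_eq_zero_of_not_mem {Λ : Cone} (hγ : γ.ContainedIn Λ) {v : Vertex}
    (hv : v ∉ Λ.sites) : γ.config v = 0 :=
  γ.config_eq_zero fun j h => hv (h ▸ hγ j)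

theorem sites_disjoint {Λ Λ' : Cone} (h : Disjoint Λ.region Λ'.region) {v : Vertex}
    (hv : v ∈ Λ.sites) : v ∉ Λ'.sites := fun hv' => Set.disjoint_left.mp h hv hv'

theorem not_mem_sites_of_far {Λ₁ : Cone} {k₂ : ℤ} {a₁ a₂ : ℝ} (b : ℂ)
    (h1 : Λ₁.axis + 2 * Real.pi * k₂ + Λ₁.half < a₁)
    (h2 : a₂ < Λ₁.axis + 2 * Real.pi * k₂ + (2 * Real.pi - Λ₁.half)) :
    ∃ R, 0 ≤ R ∧ ∀ r A v, R < r → A ∈ Set.Icc a₁ a₂ → ‖pos v - pol b r A‖ ≤ 200 →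
      v ∉ Λ₁.sites := by
  obtain ⟨R, hR0, hR⟩ := far_sector_disjoint (φ := Λ₁.axis + 2 * Real.pi * k₂) (h := Λ₁.half)
    (a₁ := a₁) (a₂ := a₂) b (toC Λ₁.apex) 200
    (fun A hA hA' => cos_lt_of_between Λ₁.half_pos.le (by linarith) (by linarith))
  refine ⟨R, hR0, fun r A v hr hA hv hm => ?_⟩
  rw [mem_sites_iff, ← cone_add_two_pi _ _ _ k₂] at hm
  exact hR r A _ hr hA.1 hA.2 hv hm

/-- Every braiding is given by the sign of the transporting chains. -/
theorem IsTransport.eq_of_isBraiding (hv : IsVacuum π₀ Ω) (hγ : γ.ContainedIn Λ)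
    (h : IsTransport Λ₀ Λ k₁ b ψ η γ' σ T)
    (he : ∀ᶠ m in atTop, kap k k' * pair γ.config (T m) = e) {ε : H →L[ℂ] H}
    (hε : IsBraiding π₀ Λ₀ (stringEndo γ k) (stringEndo γ' k') ε) : ε = sgn e • 1 := by
  obtain ⟨Λ₁, Λt, U, ρbar, hloc, hleft, hU, hlocU, hρ, rfl⟩ := hε
  have hγ₁ : γ.ContainedIn Λ₁ := containedIn_of_isLocalized hv hloc
  obtain ⟨k₂, m, hl1, hl2, hl3⟩ := hleft.exists_lifts
  set φ₁ := Λ₁.axis + 2 * Real.pi * k₂ with hφ₁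
  set φt := Λt.axis + 2 * Real.pi * m with hφt
  have hΛt := Λt.half_pos
  have hΛ₁ := Λ₁.half_pos
  have hΛ := Λ.half_pos
  have hη := h.eta_pos
  have hlow := h.low
  have hmid := h.mid
  have hhigh := h.high
  have hθ := Λ₀.half_lt
  have hm : |φt - Λ₀.axis| + Λt.half ≤ Λ₀.half := by
    rw [← le_sub_iff_add_le, abs_le]
    constructor <;> linarith
  have hoff : ∀ j, γ.vert j ∉ Λt.sites := fun j hj => sites_disjoint hleft.1 hj (hγ₁ j)
  obtain ⟨γ₁, hγ₁v, -⟩ := exists_ray c' (toC Λt.apex) φt 0 (show 0 < Λt.half / 4 by linarith)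
  have hq : Λt.half / 4 < Real.pi := by linarith [Λt.half_lt]
  have hγ₁c : ∀ j, pos (γ₁.vert j) ∈ cone (toC Λt.apex) φt (Λt.half / 4) := fun j =>
    (mem_cone_iff (by linarith) hq).mpr (hγ₁v j)
  have hγ₁t : γ₁.ContainedIn Λt := by
    intro j
    rw [mem_sites_iff, ← cone_add_two_pi _ _ _ m]
    exact cone_subset_cone (by linarith) Λt.half_lt
      (by simp only [← hφt, sub_self, abs_zero]; linarith)
      (hγ₁c j)
  obtain ⟨A', hA'⟩ := γ₁.exists_angles (by linarith) hq hγ₁c b (show 0 < Λt.half / 4 by linarith)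
  obtain ⟨A, hA⟩ := exists_angles_of_ray σ h.face
  set a₁ := min (ψ - η) (φt - Λt.half / 2) with ha₁
  set a₂ := max (ψ + η) (φt + Λt.half / 2) with ha₂
  have hla : Λ₀.axis - Λ₀.half ≤ a₁ := le_min (by linarith) (by linarith)
  have hua : a₂ ≤ Λ₀.axis + Λ₀.half := max_le (by linarith) (by linarith)
  obtain ⟨R, hR0, hR⟩ : ∃ R, 0 ≤ R ∧ ∀ r B v, R < r → B ∈ Set.Icc a₁ a₂ →
      ‖pos v - pol b r B‖ ≤ 200 → γ.config v = 0 := by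
    rcases le_total (ψ - η) (φt - Λt.half / 2) with hle | hle
    · obtain ⟨R, hR0, hR⟩ := not_mem_sites_of_far (Λ₁ := Λ) (k₂ := k₁) (a₁ := a₁) (a₂ := a₂) b
        (by rw [ha₁, min_eq_left hle]; linarith) (by linarith)
      exact ⟨R, hR0, fun r B v h1 h2 h3 => config_eq_zero_of_not_mem hγ (hR r B v h1 h2 h3)⟩
    · obtain ⟨R, hR0, hR⟩ := not_mem_sites_of_far (Λ₁ := Λ₁) (k₂ := k₂) (a₁ := a₁) (a₂ := a₂) b
        (by rw [ha₁, min_eq_right hle]; linarith) (by linarith)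
      exact ⟨R, hR0, fun r B v h1 h2 h3 => config_eq_zero_of_not_mem hγ₁ (hR r B v h1 h2 h3)⟩
  obtain ⟨m₀, Q, hj, -, hQ⟩ := exists_ring_join (γ := σ) (γ' := γ₁) (turnsAt_zero c' b)
    (A := A) (A' := A') (a₁ := a₁) (a₂ := a₂) R
    (hA.mono fun i hi => ⟨hi.1, (min_le_left _ _).trans hi.2.1, hi.2.2.trans (le_max_left _ _)⟩)
    (hA'.mono fun i hi => ⟨hi.1, (min_le_right _ _).trans (by linarith [hi.2.1]),
      le_trans (by linarith [hi.2.2]) (le_max_right _ _)⟩)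
  have hzero : ∀ i, pair γ.config (path σ γ₁ m₀ Q i) = 0 := by
    intro i
    refine pair_eq_zero fun v hvs => ?_
    rcases mem_support_path hvs with ⟨j, rfl⟩ | hvs | ⟨j, rfl⟩
    · exact config_eq_zero_of_not_mem hγ (h.off j)
    · obtain ⟨r, B, hr, hB, hd⟩ := hQ i v hvs
      exact hR r B v hr hB hd
    · exact config_eq_zero_of_not_mem hγ₁ (sites_disjoint hleft.1 (hγ₁t j))
  obtain ⟨n, hn1, hn2, hn3⟩ := (h.support.and ((eventually_sector_subset Λ₀ b 200).and
    (eventually_subset_translate Λ₀ (toC Λt.apex)))).exists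
  refine braiding_eq hv (γ₁ := γ₁) hm hoff hγ₁t hρ hU hlocU
    (t := fun i => T i + path σ γ₁ m₀ Q i) (x := backSite Λ₀.axis n) ?_ (fun i i' f => ?_)
    (fun i v hvs => ?_) ?_
  · have := h.lim.add hj.locTendsto
    rwa [add_assoc, ← add_assoc σ.config, add_self_config, zero_add] at this
  · rw [bdry_chain_add, bdry_chain_add, h.bdry i i', hj.bdry_path, hj.bdry_path]
  · rcases Finset.mem_union.mp (Finsupp.support_add hvs) with hvs | hvs
    · exact hn1 i v hvs
    rw [mem_sites_iff, translate_cone]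
    rcases mem_support_path hvs with ⟨j, rfl⟩ | hvs | ⟨j, rfl⟩
    · obtain ⟨r, B, hr, hB, hp⟩ := h.vert j
      rw [abs_lt] at hB
      exact hn2 r B _ hr.le ⟨by linarith, by linarith⟩ (by rw [hp]; simp)
    · obtain ⟨r, B, hr, hB, hd⟩ := hQ i v hvs
      exact hn2 r B _ (hR0.trans hr.le) ⟨hla.trans hB.1, hB.2.trans hua⟩ hd
    · exact hn3 φt (Λt.half / 4) (by linarith) (by linarith) (hγ₁c j)
  · filter_upwards [he] with i hi
    rw [map_add, hzero, add_zero, hi]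

theorem IsTransport.exists_isBraiding (hv : IsVacuum π₀ Ω) (hγ : γ.ContainedIn Λ)
    (h : IsTransport Λ₀ Λ k₁ b ψ η γ' σ T) {Λt : Cone} {m : ℤ}
    (hm : |Λt.axis + 2 * Real.pi * m - Λ₀.axis| + Λt.half ≤ Λ₀.half)
    (hleft : LeftOf Λ₀ Λt Λ) (hσ : σ.ContainedIn Λt) :
    ∃ ε, IsBraiding π₀ Λ₀ (stringEndo γ k) (stringEndo γ' k') ε := by
  have hoff : ∀ j, γ.vert j ∉ Λt.sites := fun j hj => sites_disjoint hleft.1 hj (hγ j)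
  obtain ⟨ρbar, hρ⟩ := exists_extension_stringEndo hv γ k hm hoff
  obtain ⟨U, hU⟩ := exists_transporter hv k' h.lim h.bdry
  obtain ⟨n, hn⟩ := h.support.exists
  refine ⟨_, Λ, Λt, ⟨U, coneVN_le_auxAlg _ (hU.mem_coneVN hn)⟩, ρbar, fun a ha => ?_, hleft,
    hU.unitary, fun a ha => ?_, hρ, rfl⟩
  · change π₀ (stringEndo γ k a) = π₀ a
    rw [stringEndo_eq, autE_of_disjoint k (fun v hv => config_eq_zero_of_not_mem hγ hv) ha]
  · simp only
    rw [← stringEndo_eq_of_off (Λ := Λt.sitesᶜ) (γ₁ := σ) (fun j hj => hj (hσ j)) k' ha,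
      ← hU.conj h.lim]
    calc U * (star U * π₀ a * U) * star U = (U * star U) * π₀ a * (U * star U) := by
          simp only [mul_assoc]
      _ = π₀ a := by rw [hU.mul_star_self, one_mul, mul_one]

end Braid

/-! ## The signs of the braidings -/

theorem exists_chain_linking {f g : Face} (h : f.color = g.color) :
    ∃ s : Chain, ∀ k, bdry s k = ind f k + ind g k := by
  have key : ∀ (m n : ℕ) (f : Face), Linked f.color 0 (fun _ => True) f (f.shift m n) 0 := by
    intro m n
    have hz : ∀ t : Chain, pair 0 t = 0 := fun t => pair_eq_zero fun _ _ => rfl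
    induction m with
    | zero =>
      induction n with
      | zero => intro f; simpa [Face.shift_zero] using Linked.refl f.color 0 (fun _ => True) f
      | succ n ih =>
        intro f
        have h1 := (cedge_down f).linked (τ := 0) (P := fun _ => True) rfl trivial trivial
        have h2 := ih (f.shift 0 1)
        rw [hz] at h1
        rw [f.shift_color, f.shift_shift] at h2
        have h3 := h1.trans h2
        rw [zero_add, add_zero] at h3
        rwa [Nat.cast_succ, add_comm (n : ℤ) 1]
    | succ m ih =>
      intro f
      have h1 := (cedge_up f).linked (τ := 0) (P := fun _ => True) rfl trivial trivial
      have h2 := ih (f.shift 1 0)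
      rw [hz] at h1
      rw [f.shift_color, f.shift_shift] at h2
      have h3 := h1.trans h2
      rw [zero_add, add_zero] at h3
      rwa [Nat.cast_succ, add_comm (m : ℤ) 1]
  obtain ⟨a, b, rfl⟩ := Face.exists_eq_shift h
  have h1 := key a.natAbs b.natAbs (f.shift (-a.natAbs) (-b.natAbs))
  have h2 := key (a + a.natAbs).toNat (b + b.natAbs).toNat (f.shift (-a.natAbs) (-b.natAbs))
  rw [f.shift_shift, Int.toNat_of_nonneg (by omega), Int.toNat_of_nonneg (by omega)] at h2
  rw [f.shift_shift] at h1
  simp only [neg_add_cancel, Face.shift_zero, neg_add_cancel_comm_assoc] at h1 h2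
  obtain ⟨s, -, hs, -⟩ := h1.symm.trans h2
  exact ⟨s, hs⟩

/-- The half-infinite string `σ` crosses the chains that join `γ` with `σ'` an odd number of times,
if it lies between them. -/
theorem eventually_pair_eq_one {c c' : Color} (hc : c ≠ c') {f₀ : Face} (hf₀ : f₀.color = c')
    {γ σ' : HalfString c} {σ : HalfString c'} {m₀ : ℕ} {Q : ℕ → Chain} (hj : IsJoin γ σ' m₀ Q)
    {A A' : ℕ → ℝ} {ψ η a₁ a₂ a₁' a₂' : ℝ} (hη : 0 < η) (hη' : η < Real.pi)
    (hA : ∀ᶠ m in atTop, AtAngle f₀.center (γ.face m) (A m) ∧ A m ∈ Set.Icc a₁ a₂)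
    (hA' : ∀ᶠ m in atTop, AtAngle f₀.center (σ'.face m) (A' m) ∧ A' m ∈ Set.Icc a₁' a₂')
    (h1 : ψ + η < a₁') (h2 : a₂ < ψ - η) (h3 : a₁' ≤ a₁ + 2 * Real.pi)
    (h4 : a₂' ≤ a₂ + 2 * Real.pi)
    (hQ : ∀ m, pair f₀.above (Q m) = turn (A (m + m₀)) + turn (A' (m + m₀)))
    (hσ : ∀ j, ∃ r B, 0 < r ∧ |B - ψ| < η ∧ pos (σ.vert j) = pol f₀.center r B) :
    ∀ᶠ m in atTop, pair σ.config (Q m) = 1 := by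
  set b := f₀.center with hb
  obtain ⟨R, hR0, hR⟩ := far_sector_disjoint (φ := ψ) (h := η) (a₁ := a₁') (a₂ := a₂ + 2 * Real.pi)
    b b 200 (fun B hB hB' => cos_lt_of_between hη.le (by linarith) (by linarith))
  obtain ⟨R₁, hR1, hring⟩ := exists_ring
    (turnsAt_above (c := c) (f₀ := f₀) (fun h => hc (h.symm.trans hf₀)))
  obtain ⟨s, hs⟩ := exists_chain_linking (f := σ.face 0) (g := f₀) (by rw [σ.color_face, hf₀])
  obtain ⟨R₂, hR2⟩ : ∃ R₂, ∀ v ∈ s.support, ‖pos v - b‖ ≤ R₂ :=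
    ⟨∑ v ∈ s.support, ‖pos v - b‖, fun v hv =>
      Finset.single_le_sum (f := fun v => ‖pos v - b‖) (fun _ _ => norm_nonneg _) hv⟩
  have ha : Tendsto (fun m : ℕ => m + m₀) atTop atTop := tendsto_add_atTop_nat m₀
  set R₃ := max R (max R₁ (R₂ + 200)) with hR₃
  have e1 : R ≤ R₃ := le_max_left _ _
  have e2 : R₁ ≤ R₃ := (le_max_left _ _).trans (le_max_right _ _)
  have e3 : R₂ + 200 ≤ R₃ := (le_max_right _ _).trans (le_max_right _ _)
  filter_upwards [ha.eventually hA, ha.eventually hA', hj.far b R₂,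
    ha.eventually ((γ.tendsto_face b).eventually_gt_atTop R₃),
    ha.eventually ((σ'.tendsto_face b).eventually_gt_atTop R₃)] with m hm hm' hfar hr hr'
  have hang : (γ.face (m + m₀)).center
      = pol b ‖(γ.face (m + m₀)).center - b‖ (A (m + m₀) + 2 * Real.pi) := by
    have := pol_add_two_pi b ‖(γ.face (m + m₀)).center - b‖ (A (m + m₀)) 1
    rw [Int.cast_one, mul_one] at this
    rw [this]; exact hm.1
  obtain ⟨t, -, ht, htP, hte⟩ := hring (σ'.face (m + m₀)) (γ.face (m + m₀)) _ _ (A' (m + m₀))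
    (A (m + m₀) + 2 * Real.pi) a₁' (a₂ + 2 * Real.pi) (σ'.color_face _) (γ.color_face _)
    (e2.trans_lt hr') (e2.trans_lt hr) ⟨hm'.2.1, hm'.2.2.trans h4⟩
    ⟨by linarith [hm.2.1], by linarith [hm.2.2]⟩ hm'.1 hang
  have htfar : ∀ v ∈ t.support, R₂ < ‖pos v - b‖ ∧ σ.config v = 0 := by
    intro v hv
    obtain ⟨r, B, hrm, hB, hd⟩ := htP v hv
    have hrR : R₃ < r := (lt_min hr' hr).trans_le hrm
    constructor
    · have h5 := norm_sub_norm_le (pol b r B - b) (pos v - b)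
      rw [norm_pol_sub b (by linarith), sub_sub_sub_cancel_right, norm_sub_rev _ (pos v)] at h5
      linarith
    · refine σ.config_eq_zero fun j hjv => ?_
      obtain ⟨r', B', hr', hB', hp⟩ := hσ j
      refine hR r B (pos v) (e1.trans_lt hrR) hB.1 hB.2 hd ?_
      rw [← hjv]
      exact (mem_cone_iff hη hη').mpr ⟨r', B', hr', hB', hp⟩
  have hclosed : pair (σ.config + f₀.above + s) (Q m + t) = 0 := by
    refine pair_of_closed (fun f => ?_) (fun f => ?_)
    · rw [bdry_add, bdry_add, σ.bdry_config, Face.bdry_above, hs]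
      linear_combination ind_add_self (σ.face 0) f + ind_add_self f₀ f
    · rw [bdry_chain_add, hj.bdry, ht]
      linear_combination ind_add_self (γ.face (m + m₀)) f + ind_add_self (σ'.face (m + m₀)) f
  have hs0 : pair s (Q m + t) = 0 := by
    refine pair_eq_zero fun v hv => ?_
    by_contra hne
    have h5 := hR2 v (Finsupp.mem_support_iff.mpr hne)
    rcases Finset.mem_union.mp (Finsupp.support_add hv) with hv | hv
    · exact absurd (hfar v hv) (not_lt.mpr h5)
    · exact absurd (htfar v hv).1 (not_lt.mpr h5)
  have ht0 : pair σ.config t = 0 := pair_eq_zero fun v hv => (htfar v hv).2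
  rw [pair_add_left, pair_add_left, hs0, add_zero, map_add, map_add, ht0, add_zero, hQ, hte,
    turn_add_two_pi] at hclosed
  have e4 := zmod_two_add_self (turn (A (m + m₀)))
  have e5 := zmod_two_add_self (turn (A' (m + m₀)))
  have e6 : (1 : ZMod 2) + 1 = 0 := by decide
  linear_combination hclosed - e4 - e5 - e6

theorem exists_base_face (Λ₀ : Cone) (q q' : ℂ) (c : Color) : ∃ f : Face, f.color = c ∧
    ∀ φ h, 0 < h → |φ - Λ₀.axis| + h ≤ Λ₀.half → ∀ z z', ‖z' - z‖ ≤ 2 →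
      (z ∈ cone q φ h ∨ z ∈ cone q' φ h) → z' ∈ cone f.center Λ₀.axis Λ₀.half := by
  obtain ⟨L, -, hL⟩ := exists_shift Λ₀.axis Λ₀.half_pos Λ₀.half_lt (3 + ‖q - q'‖)
  obtain ⟨f, hf, hfq⟩ := exists_face_near c (pol q (-L) Λ₀.axis)
  have hn := norm_nonneg (q - q')
  refine ⟨f, hf, fun φ h h0 hle z z' hz hm => ?_⟩
  rcases hm with hm | hm
  · exact hL L le_rfl q f.center z z' (by linarith) (by linarith)
      (cone_subset_cone h0 Λ₀.half_lt hle hm)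
  · refine hL L le_rfl q' f.center z z' ?_ (by linarith)
      (cone_subset_cone h0 Λ₀.half_lt hle hm)
    have e : f.center - pol q' (-L) Λ₀.axis = (f.center - pol q (-L) Λ₀.axis) + (q - q') := by
      rw [pol, pol]; ring
    rw [e]
    exact (norm_add_le _ _).trans (by linarith)

theorem exists_isTransport {Λ₀ Λ Λ' : Cone} {k₁ k₁' : ℤ} {b : ℂ} {ψ η : ℝ} {c : Color}
    {γ σ : HalfString c} {τ : Config} {N : ℝ → ZMod 2} (hN : TurnsAt c τ b N) {R : ℝ}
    (hR : 0 ≤ R) (hη : 0 < η) (hθ : Λ₀.half + η ≤ Real.pi) (hγ : γ.ContainedIn Λ')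
    (hb : ∀ m, (γ.face m).center ∈ cone b Λ₀.axis Λ₀.half)
    (low : Λ₀.axis - Λ₀.half ≤ Λ.axis + 2 * Real.pi * k₁ - Λ.half)
    (mid : Λ.axis + 2 * Real.pi * k₁ + Λ.half < ψ - η)
    (low' : Λ₀.axis - Λ₀.half ≤ Λ'.axis + 2 * Real.pi * k₁' - Λ'.half)
    (mid' : Λ'.axis + 2 * Real.pi * k₁' + Λ'.half ≤ ψ)
    (high : ψ + η ≤ Λ₀.axis + Λ₀.half)
    (vert : ∀ j, ∃ r A, 0 < r ∧ |A - ψ| < η ∧ pos (σ.vert j) = pol b r A)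
    (face : ∀ j, ∃ r A, 0 < r ∧ |A - ψ| < η ∧ (σ.face j).center = pol b r A)
    (off : ∀ j, σ.vert j ∉ Λ.sites) :
    ∃ (m₀ : ℕ) (Q : ℕ → Chain) (A A' : ℕ → ℝ), IsJoin γ σ m₀ Q ∧
      IsTransport Λ₀ Λ k₁ b ψ η γ σ (path γ σ m₀ Q) ∧
      (∀ m, pair τ (Q m) = N (A (m + m₀)) + N (A' (m + m₀))) ∧
      (∀ᶠ m in atTop, AtAngle b (γ.face m) (A m) ∧ A m ∈ Set.Icc (Λ₀.axis - Λ₀.half)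
        (Λ'.axis + 2 * Real.pi * k₁' + Λ'.half + η)) ∧
      (∀ᶠ m in atTop, AtAngle b (σ.face m) (A' m) ∧ A' m ∈ Set.Icc (ψ - η) (ψ + η)) ∧
      ∀ m, ∀ v ∈ (Q m).support, ∃ r B, R < r ∧
        B ∈ Set.Icc (Λ₀.axis - Λ₀.half) (ψ + η) ∧ ‖pos v - pol b r B‖ ≤ 200 := by
  have hΛ := Λ.half_pos
  have hΛ' := Λ'.half_pos
  have hγ' : ∀ j, pos (γ.vert j) ∈ cone (toC Λ'.apex) (Λ'.axis + 2 * Real.pi * k₁') Λ'.half := by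
    intro j
    rw [cone_add_two_pi]
    exact (mem_sites_iff _ _).mp (hγ j)
  obtain ⟨A, hA⟩ := γ.exists_angles_of_mem hΛ' Λ'.half_lt hγ' hη Λ₀.half_pos hθ hb low'
  obtain ⟨A', hA'⟩ := exists_angles_of_ray σ face
  obtain ⟨m₀, Q, hj, hpair, hQ⟩ := exists_ring_join (γ := γ) (γ' := σ) hN (A := A) (A' := A')
    (a₁ := Λ₀.axis - Λ₀.half) (a₂ := ψ + η) R
    (hA.mono fun m hm => ⟨hm.1, hm.2.1, by linarith [hm.2.2]⟩)
    (hA'.mono fun m hm => ⟨hm.1, by linarith [hm.2.1], hm.2.2⟩)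
  refine ⟨m₀, Q, A, A', hj, ⟨hη, low, mid, high, vert, face, off, hj.locTendsto,
    fun m n f => by rw [hj.bdry_path, hj.bdry_path], ?_⟩, hpair, hA, hA', hQ⟩
  filter_upwards [eventually_sector_subset Λ₀ b 200,
    eventually_subset_translate Λ₀ (toC Λ'.apex)] with n hn1 hn2 m v hv
  rw [mem_sites_iff, translate_cone]
  rcases mem_support_path hv with ⟨j, rfl⟩ | hv | ⟨j, rfl⟩
  · refine hn2 _ _ hΛ' ?_ (hγ' j)
    rw [← le_sub_iff_add_le, abs_le]
    constructor <;> linarith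
  · obtain ⟨r, B, hr, hB, hd⟩ := hQ m v hv
    exact hn1 r B _ (hR.trans hr.le) ⟨hB.1, hB.2.trans high⟩ hd
  · obtain ⟨r, B, hr, hB, hp⟩ := vert j
    rw [abs_lt] at hB
    exact hn1 r B _ hr.le ⟨by linarith, by linarith⟩ (by rw [hp]; simp)

/-! ## The braiding of two strings -/

theorem exists_ray_leftOf {Λ₀ Λ : Cone} {k₁ : ℤ} {ψ δ : ℝ} (c : Color) (b : ℂ) (hδ : 0 < δ)
    (hw : Λ₀.half + δ ≤ Real.pi)
    (low : Λ₀.axis - Λ₀.half ≤ Λ.axis + 2 * Real.pi * k₁ - Λ.half)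
    (mid : Λ.axis + 2 * Real.pi * k₁ + Λ.half ≤ ψ - δ) (high : ψ + δ ≤ Λ₀.axis + Λ₀.half) :
    ∃ σ : HalfString c, (∀ j, ∃ r A, 0 < r ∧ |A - ψ| < δ / 2 ∧ pos (σ.vert j) = pol b r A) ∧
      (∀ j, ∃ r A, 0 < r ∧ |A - ψ| < δ / 2 ∧ (σ.face j).center = pol b r A) ∧
      ∃ Λt : Cone, |Λt.axis + 2 * Real.pi * (0 : ℤ) - Λ₀.axis| + Λt.half ≤ Λ₀.half ∧
        LeftOf Λ₀ Λt Λ ∧ σ.ContainedIn Λt := by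
  have h0 := Λ₀.half_pos
  have h1 := Λ.half_pos
  have hδ' : δ < Real.pi := by linarith
  obtain ⟨R, hR0, hR⟩ := far_sector_subset (φ := ψ) (h := δ) (a₁ := ψ - δ / 2) (a₂ := ψ + δ / 2)
    b (toC Λ.apex) 0
    (fun A hA hA' => cos_lt_of_abs_lt (abs_lt.mpr ⟨by linarith, by linarith⟩) hδ'.le)
  obtain ⟨σ, hv, hf⟩ := exists_ray c b ψ R (half_pos hδ)
  refine ⟨σ, fun j => ?_, fun j => ?_, ⟨Λ.apex, ψ, δ, hδ, hδ'⟩, ?_,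
    leftOf_of_sectors hδ hδ' hw low mid high, fun j => ?_⟩
  · obtain ⟨r, A, hr, h⟩ := hv j
    exact ⟨r, A, hR0.trans_lt hr, h⟩
  · obtain ⟨r, A, hr, h⟩ := hf j
    exact ⟨r, A, hR0.trans_lt hr, h⟩
  · rw [← le_sub_iff_add_le, abs_le]
    push_cast
    constructor <;> linarith
  · obtain ⟨r, A, hr, hA, hp⟩ := hv j
    rw [abs_lt] at hA
    rw [mem_sites_iff]
    exact hR r A _ hr (by linarith) (by linarith) (by rw [hp, sub_self, norm_zero])

/-- Two strings can be transported to strings counterclockwise of both of them, along chains that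
do not cross each other, except that the second transport crosses the end of the first. -/
theorem exists_transports {Λ₀ Λ Λ' : Cone} {c c' : Color} {γ : HalfString c} {γ' : HalfString c'}
    (hγ : γ.ContainedIn Λ) (hγ' : γ'.ContainedIn Λ')
    (hleft : ∃ Λt, LeftOf Λ₀ Λt Λ) (hleft' : ∃ Λt, LeftOf Λ₀ Λt Λ') :
    ∃ (k₁ k₁' : ℤ) (b : ℂ) (ψ ψ' η : ℝ) (σ : HalfString c') (σ' : HalfString c)
      (T T' : ℕ → Chain),
      IsTransport Λ₀ Λ k₁ b ψ η γ' σ T ∧ IsTransport Λ₀ Λ' k₁' b ψ' η γ σ' T' ∧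
      (∃ Λt : Cone, |Λt.axis + 2 * Real.pi * (0 : ℤ) - Λ₀.axis| + Λt.half ≤ Λ₀.half ∧
        LeftOf Λ₀ Λt Λ ∧ σ.ContainedIn Λt) ∧
      (∃ Λt : Cone, |Λt.axis + 2 * Real.pi * (0 : ℤ) - Λ₀.axis| + Λt.half ≤ Λ₀.half ∧
        LeftOf Λ₀ Λt Λ' ∧ σ'.ContainedIn Λt) ∧
      (∀ m, Orth c' (T m)) ∧ (∀ n, Orth c (T' n)) ∧ (∀ m, pair σ'.config (T m) = 0) ∧
      (c ≠ c' → ∀ᶠ n in atTop, pair σ.config (T' n) = 1) := by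
  obtain ⟨Λ₁, hl⟩ := hleft
  obtain ⟨Λ₁', hl'⟩ := hleft'
  obtain ⟨k₁, m₁, hk1, hk2, hk3⟩ := hl.exists_lifts
  obtain ⟨k₁', m₁', hk1', hk2', hk3'⟩ := hl'.exists_lifts
  have hΛ := Λ.half_pos
  have hΛ' := Λ'.half_pos
  have hΛ₁ := Λ₁.half_pos
  have hΛ₁' := Λ₁'.half_pos
  have hθ0 := Λ₀.half_pos
  have hθπ := Λ₀.half_lt
  obtain ⟨δ, hδ, hδ1, hδ2, hδ3⟩ : ∃ δ, 0 < δ ∧ Λ₀.half + δ ≤ Real.pi ∧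
      Λ.axis + 2 * Real.pi * k₁ + Λ.half ≤ Λ₀.axis + Λ₀.half - 8 * δ ∧
      Λ'.axis + 2 * Real.pi * k₁' + Λ'.half ≤ Λ₀.axis + Λ₀.half - 8 * δ := by
    refine ⟨min (Real.pi - Λ₀.half) (min (Λ₁.half / 8) (Λ₁'.half / 8)),
      lt_min (by linarith) (lt_min (by linarith) (by linarith)), ?_, ?_, ?_⟩
    · linarith [min_le_left (Real.pi - Λ₀.half) (min (Λ₁.half / 8) (Λ₁'.half / 8))]
    · linarith [(min_le_right (Real.pi - Λ₀.half) _).trans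
        (min_le_left (Λ₁.half / 8) (Λ₁'.half / 8))]
    · linarith [(min_le_right (Real.pi - Λ₀.half) _).trans
        (min_le_right (Λ₁.half / 8) (Λ₁'.half / 8))]
  obtain ⟨f₀, hf₀, hbase⟩ := exists_base_face Λ₀ (toC Λ.apex) (toC Λ'.apex) c'
  have hb : ∀ m, (γ.face m).center ∈ cone f₀.center Λ₀.axis Λ₀.half := by
    intro m
    refine hbase (Λ.axis + 2 * Real.pi * k₁) Λ.half hΛ ?_ (pos (γ.vert (2 * m))) _
      (by rw [norm_sub_rev]; exact norm_pos_sub_center (γ.start_mem m)) (Or.inl ?_)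
    · rw [← le_sub_iff_add_le, abs_le]
      constructor <;> linarith
    · rw [cone_add_two_pi]
      exact (mem_sites_iff _ _).mp (hγ _)
  have hb' : ∀ m, (γ'.face m).center ∈ cone f₀.center Λ₀.axis Λ₀.half := by
    intro m
    refine hbase (Λ'.axis + 2 * Real.pi * k₁') Λ'.half hΛ' ?_ (pos (γ'.vert (2 * m))) _
      (by rw [norm_sub_rev]; exact norm_pos_sub_center (γ'.start_mem m)) (Or.inr ?_)
    · rw [← le_sub_iff_add_le, abs_le]
      constructor <;> linarith
    · rw [cone_add_two_pi]
      exact (mem_sites_iff _ _).mp (hγ' _)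
  set b := f₀.center with hbdef
  set ψ := Λ₀.axis + Λ₀.half - 5 * δ with hψ
  set ψ' := Λ₀.axis + Λ₀.half - 2 * δ with hψ'
  obtain ⟨σ, hσv, hσf, Λt, ht1, ht2, ht3⟩ := exists_ray_leftOf (Λ₀ := Λ₀) (Λ := Λ) (ψ := ψ) c' b hδ
    hδ1 hk1 (by linarith) (by linarith)
  obtain ⟨σ', hσv', hσf', Λt', ht1', ht2', ht3'⟩ := exists_ray_leftOf (Λ₀ := Λ₀) (Λ := Λ')
    (ψ := ψ') c b hδ hδ1 hk1' (by linarith) (by linarith)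
  have hη : 0 < δ / 2 := half_pos hδ
  have hηπ : δ / 2 < Real.pi := by linarith
  have hσoff : ∀ j, σ.vert j ∉ Λ.sites := fun j => sites_disjoint ht2.1 (ht3 j)
  have hσoff' : ∀ j, σ'.vert j ∉ Λ'.sites := fun j => sites_disjoint ht2'.1 (ht3' j)
  have hcos : ∀ A, Λ₀.axis - Λ₀.half ≤ A → A ≤ ψ + δ / 2 →
      Real.cos (A - ψ') < Real.cos (δ / 2) := by
    intro A hA hA'
    rw [← Real.cos_neg, neg_sub]
    exact cos_lt_of_between hη.le (by linarith) (by linarith)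
  have hσcone : ∀ j, pos (σ'.vert j) ∈ cone b ψ' (δ / 2) := fun j =>
    (mem_cone_iff hη hηπ).mpr (hσv' j)
  have hdisj : ∀ i j, σ.vert i ≠ σ'.vert j := by
    intro i j hij
    obtain ⟨r, A, hr, hA, hp⟩ := hσv i
    have h1 := hσcone j
    rw [abs_lt] at hA
    rw [← hij, hp, pol_mem_cone hr] at h1
    exact lt_asymm h1 (hcos A (by linarith) (by linarith))
  obtain ⟨R, hR0, hR⟩ := far_sector_disjoint b b 200 hcos
  obtain ⟨m₀, Q, -, -, hj, hT, -, -, -, hQ⟩ := exists_isTransport (Λ := Λ) (Λ' := Λ') (k₁ := k₁)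
    (k₁' := k₁') (ψ := ψ) (turnsAt_zero c' b) hR0 hη (by linarith) hγ' hb' hk1 (by linarith) hk1'
    (by linarith) (by linarith) hσv hσf hσoff
  have hT0 : ∀ m, pair σ'.config (path γ' σ m₀ Q m) = 0 := by
    intro m
    refine pair_eq_zero fun v hv => σ'.config_eq_zero fun j hjv => ?_
    rcases mem_support_path hv with ⟨i, rfl⟩ | hv | ⟨i, rfl⟩
    · exact hσoff' j (hjv ▸ hγ' i)
    · obtain ⟨r, B, hr, hB, hd⟩ := hQ m v hv
      exact hR r B _ hr hB.1 hB.2 hd (hjv ▸ hσcone j)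
    · exact hdisj i j hjv.symm
  obtain ⟨N, hN, hNt⟩ : ∃ N, TurnsAt c (if c = c' then 0 else f₀.above) b N ∧
      (c ≠ c' → N = turn) := by
    by_cases hc : c = c'
    · rw [if_pos hc]
      exact ⟨0, turnsAt_zero c b, fun h => absurd hc h⟩
    · rw [if_neg hc]
      exact ⟨turn, turnsAt_above fun h => hc (h.symm.trans hf₀), fun _ => rfl⟩
  obtain ⟨m₀', Q', A, A', hj', hT', hpair, hA, hA', -⟩ := exists_isTransport (Λ := Λ') (Λ' := Λ)
    (k₁ := k₁') (k₁' := k₁) (ψ := ψ') hN le_rfl hη (by linarith) hγ hb hk1' (by linarith) hk1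
    (by linarith) (by linarith) hσv' hσf' hσoff'
  refine ⟨k₁, k₁', b, ψ, ψ', δ / 2, σ, σ', _, _, hT, hT', ⟨Λt, ht1, ht2, ht3⟩,
    ⟨Λt', ht1', ht2', ht3'⟩, hj.orth_path, hj'.orth_path, hT0, fun hc => ?_⟩
  simp only [if_neg hc, hNt hc] at hpair
  filter_upwards [eventually_pair_eq_one hc hf₀ hj' hη hηπ hA hA' (by linarith) (by linarith)
    (by linarith) (by linarith) hpair hσv] with n hn
  have h1 : pair σ.config (γ.chain (n + m₀')) = 0 := pair_eq_zero fun v hv =>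
    σ.config_eq_zero fun j hjv => by
      obtain ⟨i, rfl⟩ := γ.mem_support_chain hv
      exact hσoff j (hjv ▸ hγ i)
  have h2 : pair σ.config (σ'.chain (n + m₀')) = 0 := pair_eq_zero fun v hv =>
    σ.config_eq_zero fun j hjv => by
      obtain ⟨i, rfl⟩ := σ'.mem_support_chain hv
      exact hdisj j i hjv
  rw [path, map_add, map_add, h1, h2, hn, zero_add, add_zero]

section

variable {H : Type*} [NormedAddCommGroup H] [InnerProductSpace ℂ H] [CompleteSpace H]
  {π₀ : QuasiLocal →⋆ₐ[ℂ] (H →L[ℂ] H)} {Ω : H} {k k' : Pauli} {s t : ℕ → Chain} {τ τ' : Config}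

/-- The mutual sign of two transporters can be computed in both iterated limits. -/
theorem exists_sign (hv : IsVacuum π₀ Ω) (ht : LocTendsto t atTop τ)
    (htb : ∀ m n f, bdry (t m) f = bdry (t n) f) (hs : LocTendsto s atTop τ')
    (hsb : ∀ m n f, bdry (s m) f = bdry (s n) f) :
    ∃ x, (∀ᶠ m in atTop, kap k k' * pair τ' (t m) = x) ∧
      ∀ᶠ n in atTop, kap k k' * pair τ (s n) = x := by
  obtain ⟨U, hU⟩ := exists_transporter hv k ht htb
  obtain ⟨V, hV⟩ := exists_transporter hv k' hs hsb
  obtain ⟨x, hx⟩ := hU.joint_sign hv hV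
  refine ⟨x, ?_, ?_⟩
  · filter_upwards [hx.curry] with m hm
    obtain ⟨n, hn, hn'⟩ := (hm.and (hs.finset (t m).support)).exists
    rw [← hn, pair_comm, pair_congr hn']
  · filter_upwards [((tendsto_snd.prodMk tendsto_fst).eventually hx).curry] with n hn
    obtain ⟨m, hm, hm'⟩ := (hn.and (ht.finset (s n).support)).exists
    rw [← hm, ← pair_congr hm']

/-- Two strings have transports whose signs `x` and `e` determine the two braidings. -/
theorem exists_braiding_signs (hv : IsVacuum π₀ Ω) {Λ₀ Λ Λ' : Cone} {c c' : Color}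
    {γ : HalfString c} {γ' : HalfString c'} (hγ : γ.ContainedIn Λ) (hγ' : γ'.ContainedIn Λ')
    (hleft : ∃ Λt, LeftOf Λ₀ Λt Λ) (hleft' : ∃ Λt, LeftOf Λ₀ Λt Λ') :
    ∃ x e : ZMod 2,
      ((∃ ε, IsBraiding π₀ Λ₀ (stringEndo γ k) (stringEndo γ' k') ε) ∧
        ∀ ε, IsBraiding π₀ Λ₀ (stringEndo γ k) (stringEndo γ' k') ε → ε = sgn x • 1) ∧
      ((∃ ε, IsBraiding π₀ Λ₀ (stringEndo γ' k') (stringEndo γ k) ε) ∧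
        ∀ ε, IsBraiding π₀ Λ₀ (stringEndo γ' k') (stringEndo γ k) ε → ε = sgn e • 1) ∧
      (c = c' ∨ k = k' → x = 0) ∧ (c ≠ c' ∧ k ≠ k' → e = x + 1) := by
  obtain ⟨k₁, k₁', b, ψ, ψ', η, σ, σ', T, T', hT, hT', ⟨Λt, h1, h2, h3⟩, ⟨Λt', h1', h2', h3'⟩,
    hO, hO', h0, hone⟩ := exists_transports hγ hγ' hleft hleft'
  obtain ⟨x, hx, hx'⟩ := exists_sign (k := k) (k' := k') hv hT'.lim hT'.bdry hT.lim hT.bdry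
  have hxT : ∀ᶠ m in atTop, kap k k' * pair γ.config (T m) = x := by
    filter_upwards [hx'] with m hm
    rwa [pair_add_left, h0, add_zero] at hm
  obtain ⟨e, he, hex⟩ : ∃ e, (∀ᶠ n in atTop, kap k' k * pair γ'.config (T' n) = e) ∧
      (c ≠ c' ∧ k ≠ k' → e = x + 1) := by
    by_cases hc : c = c'
    · subst hc
      exact ⟨0, Eventually.of_forall fun n => by rw [hO' n _ γ'.isType_config, mul_zero],
        fun h => absurd rfl h.1⟩
    · refine ⟨x + kap k k', ?_, fun h => by rw [kap_of_ne h.2]⟩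
      filter_upwards [hx, hone hc] with n hn hn'
      rw [pair_add_left, hn'] at hn
      rw [kap_comm]
      linear_combination hn - zmod_two_add_self (kap k k')
  refine ⟨x, e, ⟨hT.exists_isBraiding hv hγ h1 h2 h3, fun ε => hT.eq_of_isBraiding hv hγ hxT⟩,
    ⟨hT'.exists_isBraiding hv hγ' h1' h2' h3', fun ε => hT'.eq_of_isBraiding hv hγ' he⟩, ?_, hex⟩
  obtain ⟨m, hm⟩ := hxT.exists
  rintro (rfl | rfl)
  · rw [← hm, hO m _ γ.isType_config, mul_zero]
  · rw [← hm, kap_self, zero_mul]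

end

end ColorCode

end

theorem mainTheorem8 {H : Type*} [NormedAddCommGroup H] [InnerProductSpace ℂ H] [CompleteSpace H]
    (ω₀ : QuasiLocal →ₗ[ℂ] ℂ) (hω : IsGroundState ω₀) (hinv : IsTranslationInvariant ω₀)
    (π₀ : QuasiLocal →⋆ₐ[ℂ] (H →L[ℂ] H)) (Ω : H) (hGNS : IsGNS ω₀ π₀ Ω)
    (Λ₀ : Cone) (c c' : Color) (k k' : Pauli)
    (γ : HalfString c) (γ' : HalfString c') (Λ Λ' : Cone)
    (hγ : γ.ContainedIn Λ) (hγ' : γ'.ContainedIn Λ')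
    (hleft : ∃ Λt, LeftOf Λ₀ Λt Λ) (hleft' : ∃ Λt, LeftOf Λ₀ Λt Λ') :
    (∃! ε, IsBraiding π₀ Λ₀ (stringEndo γ k) (stringEndo γ' k') ε) ∧
    (∃! ε', IsBraiding π₀ Λ₀ (stringEndo γ' k') (stringEndo γ k) ε') ∧
    ∀ ε ε' : H →L[ℂ] H,
      IsBraiding π₀ Λ₀ (stringEndo γ k) (stringEndo γ' k') ε →
      IsBraiding π₀ Λ₀ (stringEndo γ' k') (stringEndo γ k) ε' →
      (c = c' ∨ k = k' → ε = 1) ∧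
      (c ≠ c' ∧ k ≠ k' → (ε = 1 ∨ ε = -1) ∧ (ε' = 1 ∨ ε' = -1) ∧ (ε = -1 ↔ ε' ≠ -1)) := by
  have hv := isVacuum hω hinv hGNS
  obtain ⟨x, e, ⟨⟨ε, hε⟩, hx⟩, ⟨⟨ε', hε'⟩, he⟩, h0, h1⟩ :=
    exists_braiding_signs (k := k) (k' := k') hv hγ hγ' hleft hleft'
  refine ⟨⟨ε, hε, fun _ h => (hx _ h).trans (hx _ hε).symm⟩,
    ⟨ε', hε', fun _ h => (he _ h).trans (he _ hε').symm⟩, fun ε ε' hε hε' => ?_⟩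
  rw [hx _ hε, he _ hε']
  refine ⟨fun h => by rw [h0 h, sgn_zero, one_smul], fun h => ?_⟩
  rw [h1 h]
  rcases zmod_two_cases x with rfl | rfl
  · simp [hv.one_ne_neg_one]
  · simp [zmod_two_add_self, hv.one_ne_neg_one]
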